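/- **Setting.** Let $p,m,q_1,\dots,q_m\in\mathbb N$. On a probability space consider the system $$y_{k+1}=\sum_{j=1}^{p}a_jy_{k+1-j}+\sum_{i=1}^m\sum_{j=1}^{q_i}b_{i,j}u_{i,k+1-j}+\omega_{k+1}=\theta^T\varphi_k+\omega_{k+1},\qquad k\ge 0,$$ with $y_k=0$ for $k\le 0$, $u_{i,k}=0$ for $k<0$, $\theta=[a_1,\dots,a_p,b_{1,1},\dots,b_{1,q_1},\dots,b_{m,1},\dots,b_{m,q_m}]^T$ and $\varphi_k=[y_k,\dots,y_{k+1-p},u_{1,k},\dots,u_{1,k+1-q_1},\dots,u_{m,k},\dots,u_{m,k+1-q_m}]^T$. Participant $0$ sends $\bar y_k=y_k+\eta_k$ ($k\ge1$; $\bar y_k=0$ for $k\le 0$) and participant $i\in\{1,\dots,m\}$ sends $\bar u_{i,k}=u_{i,k}+\xi_{i,k}$ ($k\ge0$; $\bar u_{i,k}=0$ for $k<0$), where $\eta_k$ and $\xi_{i,k}$ have the Laplace laws $L(0,b_0)$ and $L(0,b_i)$ (density $\frac1{2b}e^{-|x|/b}$), $b_0,b_i>0$. Let $\bar\varphi_k$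 be $\varphi_k$ with $y,u$ replaced by $\bar y,\bar u$. For given $\alpha>0$ and $\theta_0$, let $\bar P_0^{-1}=\alpha I$ and $$\bar a_k=(1+\bar\varphi_k^T\bar P_k\bar\varphi_k)^{-1},\quad \theta_{k+1}=\theta_k+\bar a_k\bar P_k\bar\varphi_k(\bar y_{k+1}-\bar\varphi_k^T\theta_k),\quad \bar P_{k+1}=\bar P_k-\bar a_k\bar P_k\bar\varphi_k\bar\varphi_k^T\bar P_k .$$ Put $r_k=e+\sum_{t=0}^k\|\bar\varphi_t\|^2$ and $\tilde\theta_k=\theta-\theta_k$. **Hypotheses.** 1. $1-a_1z-\dots-a_pz^p\ne0$ for all complex $|z|\le1$. 2. All the variables $\eta_{k+1},\xi_{i,k}$ ($k\ge 0$, $1\le i\le m$) are mutually independent, and together they are independent of the processes $(y_k),(u_{i,k}),(\omega_k)$. 3. $(\omega_k,\mathscr F_k)$ is a martingale difference sequence with $\sup_k E(|\omega_{k+1}|^\beta\mid\mathscr F_k)<\infty$ a.s. for some $\beta\ge2$. 4. $\varphi_k$ is $\mathscr F_k$-measurable for every $k\ge0$. 5. (Noise levels.) Let $\varepsilon,\delta>0$,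 and let $c_0>0$, $\lambda\in(0,1)$ be such that $\|A^k\|\le c_0\lambda^k$ for all $k\in\mathbb N$, where $A$ is the $p\times p$ companion matrix with ones on the superdiagonal and last row $(a_p,\dots,a_1)$. With $C_1=1+\frac{\sqrt p\,c_0\lambda}{1-\lambda}$ and $C_{i,2}=C_1\sum_{j=1}^{q_i}|b_{i,j}|$, $$\frac{C_1}{b_0}\delta\le\varepsilon,\qquad \Big(\frac{C_{i,2}}{b_0}+\frac1{b_i}\Big)\delta\le\varepsilon\quad(i=1,\dots,m).$$ 6. (Excitation.) For some $\kappa>1$, a.s. as $k\to\infty$, $\frac{\ln r_{k-1}(\ln(e+\ln r_{k-1}))^\kappa}{\lambda_{\min}(\bar P_k^{-1})}\to0$ if $\beta=2$, and $\frac{\ln r_{k-1}}{\lambda_{\min}(\bar P_k^{-1})}\to0$ if $\beta>2$. 7. Almost surely $\liminf_{k\to\infty}\lambda_{\min}\big(\tfrac1k\bar P_k^{-1}\big)=\gamma_1$, where $0<\gamma_1<\infty$ ($\gamma_1$ may be a constant or random). **Conclusions.** (i) The algorithm is $\varepsilon$-differentially private under $\delta$-adjacency for each participant: for all $1\le T_1\le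 T_2$, each mechanism $\mathcal M$ below satisfies $\mathbb P(\mathcal M(x)\in D)\le e^\varepsilon\,\mathbb P(\mathcal M(x')\in D)$ for all $x,x'\in\mathbb R^{T_1}$ with $\|x-x'\|_1\le\delta$ and all Borel sets $D$. - For participant $0$: $\mathcal M(x)=(\bar y_1,\dots,\bar y_{T_2})$, where $(y_1,\dots,y_{T_1})$ is set to $x$ and $y_k$ follows the system equation for $k>T_1$. - For participant $i\ge1$: $\mathcal M(x)=(\bar y_1,\dots,\bar y_{T_2},\bar u_{i,0},\dots,\bar u_{i,T_2-1})$, where $(u_{i,0},\dots,u_{i,T_1-1})$ is set to $x$ and $y$ follows the system equation. In both cases the remaining inputs and the system noises are the given random sequences. (ii) Almost surely $$\limsup_{k\to\infty}\|\tilde\theta_k\|\le 2\|\theta\|\sqrt{\frac{p\,b_0^2+\sum_{i=1}^mq_ib_i^2}{\gamma_1}} .$$ -/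

import Mathlib

open MeasureTheory ProbabilityTheory Filter Topology Matrix
open scoped ENNReal

namespace DPLS

noncomputable section

/-! ### The multi-participant ARX system -/

/-- Index set of the parameter and of the regression vectors: `p` output lags and, for each
participant `i`, `q i` input lags. -/
abbrev RegIndex (p : ℕ) {m : ℕ} (q : Fin m → ℕ) : Type :=
  Fin p ⊕ (Σ i : Fin m, Fin (q i))

/-- The value `x_{k-j}` of a signal that vanishes at negative times. -/
def lag (x : ℕ → ℝ) (k j : ℕ) : ℝ := if j ≤ k then x (k - j) else 0

/-- The regression vector
`[y_k, …, y_{k+1-p}, u_{1,k}, …, u_{1,k+1-q_1}, …, u_{m,k}, …, u_{m,k+1-q_m}]`. -/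
def regressor {p m : ℕ} (q : Fin m → ℕ) (y : ℕ → ℝ) (u : Fin m → ℕ → ℝ) (k : ℕ) :
    RegIndex p q → ℝ
  | Sum.inl j => lag y k j
  | Sum.inr ij => lag (u ij.1) k ij.2

/-- Euclidean norm of a vector. -/
def euclNorm {ι : Type*} [Fintype ι] (v : ι → ℝ) : ℝ := ‖WithLp.toLp 2 v‖

/-- `y` is the output of the system: `y_0 = 0` and `y_{k+1} = θᵀ φ_k + ω_{k+1}`. -/
def IsOutput {p m : ℕ} {q : Fin m → ℕ} (θ : RegIndex p q → ℝ) (u : Fin m → ℕ → ℝ)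
    (ω : ℕ → ℝ) (y : ℕ → ℝ) : Prop :=
  y 0 = 0 ∧ ∀ k, y (k + 1) = θ ⬝ᵥ regressor q y u k + ω (k + 1)

/-- Autoregressive coefficients `a_1, …, a_p` (with `arCoeff θ j = a_{j+1}`). -/
def arCoeff {p m : ℕ} {q : Fin m → ℕ} (θ : RegIndex p q → ℝ) (j : Fin p) : ℝ := θ (Sum.inl j)

/-- Input coefficients of participant `i` (with `inCoeff θ i j = b_{i,j+1}`). -/
def inCoeff {p m : ℕ} {q : Fin m → ℕ} (θ : RegIndex p q → ℝ) (i : Fin m) (j : Fin (q i)) : ℝ :=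
  θ (Sum.inr ⟨i, j⟩)

/-- `1 - a_1 z - ⋯ - a_p z^p ≠ 0` on the closed unit disc. -/
def AsymptoticallyStable {p : ℕ} (a : Fin p → ℝ) : Prop :=
  ∀ z : ℂ, ‖z‖ ≤ 1 → 1 - ∑ j : Fin p, (a j : ℂ) * z ^ ((j : ℕ) + 1) ≠ 0

/-- The companion matrix: ones above the diagonal, last row `a_p, a_{p-1}, …, a_1`. -/
def companionMatrix {p : ℕ} (a : Fin p → ℝ) : Matrix (Fin p) (Fin p) ℝ :=
  Matrix.of fun i j =>
    if (i : ℕ) + 1 = p then a j.rev else if (j : ℕ) = i + 1 then 1 else 0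

/-- Operator norm of a square matrix with respect to the Euclidean norm. -/
def matNorm {ι : Type*} [Fintype ι] [DecidableEq ι] (M : Matrix ι ι ℝ) : ℝ :=
  ‖Matrix.toEuclideanCLM (n := ι) (𝕜 := ℝ) M‖

/-- `C₁ = 1 + √p c₀ lam / (1 - lam)`. -/
def C₁ (p : ℕ) (c₀ lam : ℝ) : ℝ := 1 + Real.sqrt p * c₀ * lam / (1 - lam)

/-- `C_{i,2} = (1 + √p c₀ lam / (1 - lam)) ∑_j |b_{i,j}|`. -/
def C₂ {p m : ℕ} {q : Fin m → ℕ} (θ : RegIndex p q → ℝ) (c₀ lam : ℝ) (i : Fin m) : ℝ :=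
  C₁ p c₀ lam * ∑ j : Fin (q i), |inCoeff θ i j|

/-! ### The algorithm -/

/-- The Laplace law `L(0, b)`. -/
def laplaceMeasure (b : ℝ) : Measure ℝ :=
  volume.withDensity fun x => ENNReal.ofReal (1 / (2 * b) * Real.exp (-|x| / b))

/-- The output `ȳ_k = y_k + η_k` for `k ≥ 1` sent by participant `0`; it is zero at time `0`
(where `y_0 = η_0 = 0`). -/
def noisyOutput (y η : ℕ → ℝ) (k : ℕ) : ℝ := if k = 0 then 0 else y k + η k

/-- The input `ū_{i,k} = u_{i,k} + ξ_{i,k}` sent by participant `i`. -/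
def noisyInput {m : ℕ} (u ξ : Fin m → ℕ → ℝ) (i : Fin m) (k : ℕ) : ℝ := u i k + ξ i k

section RLS

variable {ι : Type*} [Fintype ι] [DecidableEq ι]

/-- The gain `ā = (1 + φᵀ P φ)⁻¹`. -/
def gain (P : Matrix ι ι ℝ) (φ : ι → ℝ) : ℝ := (1 + φ ⬝ᵥ (P *ᵥ φ))⁻¹

/-- `P̄_0 = (α I)⁻¹`, `P̄_{k+1} = P̄_k - ā_k P̄_k φ̄_k φ̄_kᵀ P̄_k`. -/
def covMatrix (α : ℝ) (φ : ℕ → ι → ℝ) : ℕ → Matrix ι ι ℝ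
  | 0 => α⁻¹ • (1 : Matrix ι ι ℝ)
  | k + 1 =>
    covMatrix α φ k - gain (covMatrix α φ k) (φ k) •
      (covMatrix α φ k * vecMulVec (φ k) (φ k) * covMatrix α φ k)

/-- The estimates: `θ_{k+1} = θ_k + ā_k P̄_k φ̄_k (ȳ_{k+1} - φ̄_kᵀ θ_k)`, with regressors `φ`,
observed outputs `z` and initial value `θ₀`. -/
def estimate (α : ℝ) (θ₀ : ι → ℝ) (φ : ℕ → ι → ℝ) (z : ℕ → ℝ) : ℕ → ι → ℝ
  | 0 => θ₀
  | k + 1 =>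
    estimate α θ₀ φ z k +
      (gain (covMatrix α φ k) (φ k) * (z (k + 1) - φ k ⬝ᵥ estimate α θ₀ φ z k)) •
        (covMatrix α φ k *ᵥ φ k)

/-- Smallest eigenvalue of a symmetric matrix. -/
def lambdaMin (M : Matrix ι ι ℝ) : ℝ := sInf (spectrum ℝ M)

/-- `r_k = e + ∑_{t ≤ k} ‖φ_t‖²`. -/
def energy (φ : ℕ → ι → ℝ) (k : ℕ) : ℝ :=
  Real.exp 1 + ∑ t ∈ Finset.range (k + 1), euclNorm (φ t) ^ 2

/-- The information matrix `α I + ∑_{t < k} φ_t φ_tᵀ`. -/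
def infoMatrix (α : ℝ) (φ : ℕ → ι → ℝ) (k : ℕ) : Matrix ι ι ℝ :=
  α • (1 : Matrix ι ι ℝ) + ∑ t ∈ Finset.range k, vecMulVec (φ t) (φ t)

lemma infoMatrix_posDef {α : ℝ} (hα : 0 < α) (φ : ℕ → ι → ℝ) (k : ℕ) :
    (infoMatrix α φ k).PosDef := by
  unfold infoMatrix
  refine Matrix.PosDef.add_posSemidef (Matrix.PosDef.one.smul hα) ?_
  refine Matrix.posSemidef_sum _ fun t _ => ?_
  simpa using Matrix.posSemidef_vecMulVec_self_star (R := ℝ) (φ t)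

/-- The recursion for `P̄_k` agrees with its closed form `(P̄_0⁻¹ + ∑_{t<k} φ_t φ_tᵀ)⁻¹`. -/
lemma covMatrix_eq {α : ℝ} (hα : 0 < α) (φ : ℕ → ι → ℝ) (k : ℕ) :
    covMatrix α φ k = (infoMatrix α φ k)⁻¹ := by
  induction k with
  | zero =>
    symm
    apply Matrix.inv_eq_right_inv
    simp [infoMatrix, covMatrix, hα.ne']
  | succ k ih =>
    symm
    apply Matrix.inv_eq_right_inv
    have hpd := infoMatrix_posDef hα φ k
    have hu : IsUnit (infoMatrix α φ k).det := (Matrix.isUnit_iff_isUnit_det _).1 hpd.isUnit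
    have hMP : infoMatrix α φ k * covMatrix α φ k = 1 := by
      rw [ih]; exact Matrix.mul_nonsing_inv _ hu
    have hP : (covMatrix α φ k).PosDef := by rw [ih]; exact hpd.inv
    have hnn : 0 ≤ φ k ⬝ᵥ (covMatrix α φ k *ᵥ φ k) := by
      simpa using hP.posSemidef.dotProduct_mulVec_nonneg (φ k)
    have hstep : infoMatrix α φ (k + 1) = infoMatrix α φ k + vecMulVec (φ k) (φ k) := by
      simp [infoMatrix, Finset.sum_range_succ, add_assoc]
    rw [hstep, covMatrix]
    set P := covMatrix α φ k
    set M := infoMatrix α φ k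
    set V := vecMulVec (φ k) (φ k) with hV
    have hVPV : V * (P * V) = (φ k ⬝ᵥ (P *ᵥ φ k)) • V := by
      rw [hV, Matrix.mul_vecMulVec, Matrix.vecMulVec_mul_vecMulVec]
      ext i j
      simp [vecMulVec_apply]; ring
    have hg : gain P (φ k) * (1 + φ k ⬝ᵥ (P *ᵥ φ k)) = 1 :=
      inv_mul_cancel₀ (by positivity)
    have e1 : M * (P * V * P) = V * P := by
      rw [← Matrix.mul_assoc, ← Matrix.mul_assoc, hMP, Matrix.one_mul]
    have e2 : V * (P * V * P) = (φ k ⬝ᵥ (P *ᵥ φ k)) • (V * P) := by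
      rw [← Matrix.mul_assoc, hVPV, Matrix.smul_mul]
    have e3 : (M + V) * (P - gain P (φ k) • (P * V * P)) =
        1 + (1 - gain P (φ k) * (1 + φ k ⬝ᵥ (P *ᵥ φ k))) • (V * P) := by
      rw [Matrix.add_mul, Matrix.mul_sub, Matrix.mul_sub, Matrix.mul_smul, Matrix.mul_smul,
        e1, e2, hMP]
      module
    rw [e3, hg]; simp

end RLS

/-! ### Differential privacy -/

/-- `ε`-differential privacy under `δ`-adjacency of a random mechanism `M : X × Ω → Y`. -/
def IsDifferentiallyPrivate {Ω X Y : Type*} [MeasurableSpace Ω] [PseudoMetricSpace X]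
    [MeasurableSpace Y] (μ : Measure Ω) (ε δ : ℝ) (M : X → Ω → Y) : Prop :=
  ∀ x x' : X, dist x x' ≤ δ → ∀ D : Set Y, MeasurableSet D →
    μ {w | M x w ∈ D} ≤ ENNReal.ofReal (Real.exp ε) * μ {w | M x' w ∈ D}

/-- Sensitive data over a window of length `T`, with the `ℓ¹` distance. -/
abbrev Sensitive (T : ℕ) : Type := PiLp 1 (fun _ : Fin T => ℝ)

/-- Auxiliary recursion: the whole output path, computed up to time `k` (and zero afterwards). -/
def outputHist {p m : ℕ} {q : Fin m → ℕ} (θ : RegIndex p q → ℝ) (u : Fin m → ℕ → ℝ)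
    (ω : ℕ → ℝ) {T : ℕ} (x : Fin T → ℝ) : ℕ → ℕ → ℝ
  | 0 => fun _ => 0
  | k + 1 => Function.update (outputHist θ u ω x k) (k + 1)
      (if h : k < T then x ⟨k, h⟩ else θ ⬝ᵥ regressor q (outputHist θ u ω x k) u k + ω (k + 1))

/-- The output of the system when `y_1, …, y_T` are prescribed to be `x`: afterwards it follows
the system equation with inputs `u` and noise `ω`. -/
def outputFrom {p m : ℕ} {q : Fin m → ℕ} (θ : RegIndex p q → ℝ) (u : Fin m → ℕ → ℝ)
    (ω : ℕ → ℝ) {T : ℕ} (x : Fin T → ℝ) (k : ℕ) : ℝ := outputHist θ u ω x k k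

lemma outputHist_eq {p m : ℕ} {q : Fin m → ℕ} (θ : RegIndex p q → ℝ) (u : Fin m → ℕ → ℝ)
    (ω : ℕ → ℝ) {T : ℕ} (x : Fin T → ℝ) {t k : ℕ} (h : t ≤ k) :
    outputHist θ u ω x k t = outputFrom θ u ω x t := by
  induction k, h using Nat.le_induction with
  | base => rfl
  | succ k hk ih =>
    rw [outputHist, Function.update_of_ne (by omega), ih]

lemma outputFrom_zero {p m : ℕ} {q : Fin m → ℕ} (θ : RegIndex p q → ℝ) (u : Fin m → ℕ → ℝ)
    (ω : ℕ → ℝ) {T : ℕ} (x : Fin T → ℝ) : outputFrom θ u ω x 0 = 0 := rfl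

lemma outputFrom_of_lt {p m : ℕ} {q : Fin m → ℕ} (θ : RegIndex p q → ℝ) (u : Fin m → ℕ → ℝ)
    (ω : ℕ → ℝ) {T : ℕ} (x : Fin T → ℝ) {k : ℕ} (h : k < T) :
    outputFrom θ u ω x (k + 1) = x ⟨k, h⟩ := by
  simp [outputFrom, outputHist, h]

lemma outputFrom_of_le {p m : ℕ} {q : Fin m → ℕ} (θ : RegIndex p q → ℝ) (u : Fin m → ℕ → ℝ)
    (ω : ℕ → ℝ) {T : ℕ} (x : Fin T → ℝ) {k : ℕ} (h : T ≤ k) :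
    outputFrom θ u ω x (k + 1) =
      θ ⬝ᵥ regressor q (outputFrom θ u ω x) u k + ω (k + 1) := by
  have hreg : regressor (p := p) q (outputHist θ u ω x k) u k =
      regressor q (outputFrom θ u ω x) u k := by
    funext s
    cases s with
    | inl j =>
      simp only [regressor, lag]
      split_ifs
      · exact outputHist_eq θ u ω x (by omega)
      · rfl
    | inr ij => rfl
  simp [outputFrom, outputHist, not_lt.2 h, hreg]

/-- Without prescribed values, `outputFrom` is the output of the system. -/
lemma isOutput_outputFrom {p m : ℕ} {q : Fin m → ℕ} (θ : RegIndex p q → ℝ)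
    (u : Fin m → ℕ → ℝ) (ω : ℕ → ℝ) (x : Fin 0 → ℝ) :
    IsOutput θ u ω (outputFrom θ u ω x) :=
  ⟨rfl, fun _ => outputFrom_of_le θ u ω x (Nat.zero_le _)⟩

/-- The inputs, with those of participant `i` at times `0, …, T-1` prescribed to be `x`. -/
def prescribeInput {m : ℕ} (u : Fin m → ℕ → ℝ) (i : Fin m) {T : ℕ} (x : Fin T → ℝ) :
    Fin m → ℕ → ℝ :=
  fun j k => if h : j = i ∧ k < T then x ⟨k, h.2⟩ else u j k

/-- The mechanism of participant `0`: from its sensitive outputs `y_1, …, y_{T₁}` to the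
observed `ȳ_1, …, ȳ_{T₂}`. -/
def outputMechanism {Ω : Type*} {p m : ℕ} {q : Fin m → ℕ} (θ : RegIndex p q → ℝ)
    (u : Fin m → ℕ → Ω → ℝ) (ω : ℕ → Ω → ℝ) (η : ℕ → Ω → ℝ) (T₁ T₂ : ℕ)
    (x : Sensitive T₁) (w : Ω) : Fin T₂ → ℝ :=
  fun k => noisyOutput (outputFrom θ (fun j t => u j t w) (fun t => ω t w) (fun s => x s))
    (fun t => η t w) (k + 1)

/-- The mechanism of participant `i`: from its sensitive inputs `u_{i,0}, …, u_{i,T₁-1}` to the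
observed `ȳ_1, …, ȳ_{T₂}` and `ū_{i,0}, …, ū_{i,T₂-1}`. -/
def inputMechanism {Ω : Type*} {p m : ℕ} {q : Fin m → ℕ} (θ : RegIndex p q → ℝ)
    (u : Fin m → ℕ → Ω → ℝ) (ω : ℕ → Ω → ℝ) (η : ℕ → Ω → ℝ) (ξ : Fin m → ℕ → Ω → ℝ)
    (i : Fin m) (T₁ T₂ : ℕ) (x : Sensitive T₁) (w : Ω) : (Fin T₂ → ℝ) × (Fin T₂ → ℝ) :=
  (fun k => noisyOutput
      (outputFrom θ (prescribeInput (fun j t => u j t w) i (fun s => x s)) (fun t => ω t w)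
        (T := 0) Fin.elim0)
      (fun t => η t w) (k + 1),
    fun k => noisyInput (prescribeInput (fun j t => u j t w) i (fun s => x s))
      (fun j t => ξ j t w) i k)

/-! ### Assumptions on the random sequences -/

/-- The added noises `η_k` (`k ≥ 1`) and `ξ_{i,k}` (`k ≥ 0`) as one family. -/
def noiseFamily {Ω : Type*} {m : ℕ} (η : ℕ → Ω → ℝ) (ξ : Fin m → ℕ → Ω → ℝ) :
    ℕ ⊕ (Fin m × ℕ) → Ω → ℝ
  | Sum.inl k => η (k + 1)
  | Sum.inr ik => ξ ik.1 ik.2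

/-- All added noises are mutually independent, and they are jointly independent of the outputs,
inputs and system noises. -/
def IndependentNoises {Ω : Type*} [MeasurableSpace Ω] (μ : Measure Ω) {m : ℕ}
    (y : ℕ → Ω → ℝ) (u : Fin m → ℕ → Ω → ℝ) (ω : ℕ → Ω → ℝ) (η : ℕ → Ω → ℝ)
    (ξ : Fin m → ℕ → Ω → ℝ) : Prop :=
  iIndepFun (noiseFamily η ξ) μ ∧
    IndepFun (fun w s => noiseFamily η ξ s w)
      (fun w => ((fun k => y k w, fun i k => u i k w, fun k => ω (k + 1) w) :
        (ℕ → ℝ) × (Fin m → ℕ → ℝ) × (ℕ → ℝ))) μ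

/-- `(ω_k, ℱ_k)` is a martingale difference sequence with
`sup_k E(|ω_{k+1}|^β | ℱ_k) < ∞` almost surely. -/
def IsMartingaleDifference {Ω : Type*} [mΩ : MeasurableSpace Ω] (μ : Measure Ω)
    (ℱ : Filtration ℕ mΩ) (ω : ℕ → Ω → ℝ) (β : ℝ) : Prop :=
  (∀ k, Measurable[ℱ (k + 1)] (ω (k + 1))) ∧
  (∀ k, Integrable (ω (k + 1)) μ) ∧
  (∀ k, μ[ω (k + 1) | ℱ k] =ᵐ[μ] 0) ∧
  ∀ᵐ w ∂μ, ⨆ k, (μ⁻[fun w' => ENNReal.ofReal (|ω (k + 1) w'| ^ β) | ℱ k]) w < ∞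

end

end DPLS

/-! Privacy. Given the inputs and system noises, a mechanism releases a deterministic vector plus
independent Laplace noises. Shifting a Laplace law multiplies its density by at most
exp(shift/scale), so the privacy loss is at most the weighted ℓ¹ distance of the two noiseless
vectors (`laplace_mechanism`). Changing outputs perturbs the later ones by the free evolution of the
autoregression; changing inputs perturbs them by a forced evolution from rest. The bound on the
powers of the companion matrix makes both perturbations summable, with amplification `C₁` or `C₂`
(`sum_abs_le_of_free`, `sum_abs_le_of_forced`).

Estimation. The error is P_k applied to an initial term plus ∑ e_{t+1} φ_t, where e_{t+1} = ω_{t+1}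
+ η_{t+1} - θᵀζ_t and ζ_t is the regressor of the added noises (`estimate_sub`). Moreover ‖P x‖² ≤
xᵀPx / λ_min(P⁻¹), so everything reduces to quadratic forms of weighted sums.

For ω and η the form satisfies an exact recursion. Its cross terms are a martingale transform,
beaten by its own negative quadratic drift (`IsBoundedMDS.ae_exists_transform_le`); what remains is
∑ d_t w_{t+1}² with d_t the relative leverage. The d_t sum to O(log r) through log det P⁻¹, and the
weighted squares grow no faster up to a logarithmic power, not needed when β > 2. Excitation then
makes these terms vanish.

The noisy regressor need not be adapted to ℱ. Independence and Fubini allow the added noises to be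
frozen while treating ω, and the process to be frozen while treating η (`ae_hasNoiseBound`).

The term θᵀζ_t is correlated with φ_t and does not vanish. It is bounded by completing the square
(`quadForm_le_sum_sq`), Cauchy-Schwarz and the strong law, which gives the stated limsup. -/

namespace DPLS

noncomputable section

set_option linter.unusedSectionVars false

/-! ### Algebra of recursive least squares: quadratic forms, leverages, determinants -/

section LinearAlgebra

variable {ι : Type*} [Fintype ι] [DecidableEq ι]

lemma covMatrix_posDef {α : ℝ} (hα : 0 < α) (φ : ℕ → ι → ℝ) (k : ℕ) :
    (covMatrix α φ k).PosDef := by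
  rw [covMatrix_eq hα]
  exact (infoMatrix_posDef hα φ k).inv

lemma inv_covMatrix {α : ℝ} (hα : 0 < α) (φ : ℕ → ι → ℝ) (k : ℕ) :
    (covMatrix α φ k)⁻¹ = infoMatrix α φ k := by
  rw [covMatrix_eq hα, Matrix.nonsing_inv_nonsing_inv]
  exact (Matrix.isUnit_iff_isUnit_det _).1 (infoMatrix_posDef hα φ k).isUnit

lemma infoMatrix_mul_covMatrix {α : ℝ} (hα : 0 < α) (φ : ℕ → ι → ℝ) (k : ℕ) :
    infoMatrix α φ k * covMatrix α φ k = 1 := by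
  rw [covMatrix_eq hα]
  exact Matrix.mul_nonsing_inv _
    ((Matrix.isUnit_iff_isUnit_det _).1 (infoMatrix_posDef hα φ k).isUnit)

lemma covMatrix_mul_infoMatrix {α : ℝ} (hα : 0 < α) (φ : ℕ → ι → ℝ) (k : ℕ) :
    covMatrix α φ k * infoMatrix α φ k = 1 :=
  mul_eq_one_comm.1 (infoMatrix_mul_covMatrix hα φ k)

lemma infoMatrix_succ (α : ℝ) (φ : ℕ → ι → ℝ) (k : ℕ) :
    infoMatrix α φ (k + 1) = infoMatrix α φ k + vecMulVec (φ k) (φ k) := by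
  simp [infoMatrix, Finset.sum_range_succ, add_assoc]

/-- The quadratic form `φᵀ P φ` of the regressor at time `k`. -/
def leverage (α : ℝ) (φ : ℕ → ι → ℝ) (k : ℕ) : ℝ := φ k ⬝ᵥ (covMatrix α φ k *ᵥ φ k)

/-- `φᵀ P φ / (1 + φᵀ P φ)`. -/
def relLeverage (α : ℝ) (φ : ℕ → ι → ℝ) (k : ℕ) : ℝ :=
  gain (covMatrix α φ k) (φ k) * leverage α φ k

lemma leverage_nonneg {α : ℝ} (hα : 0 < α) (φ : ℕ → ι → ℝ) (k : ℕ) : 0 ≤ leverage α φ k := by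
  simpa [leverage] using (covMatrix_posDef hα φ k).posSemidef.dotProduct_mulVec_nonneg (φ k)

lemma gain_eq (α : ℝ) (φ : ℕ → ι → ℝ) (k : ℕ) :
    gain (covMatrix α φ k) (φ k) = (1 + leverage α φ k)⁻¹ := rfl

lemma gain_pos {α : ℝ} (hα : 0 < α) (φ : ℕ → ι → ℝ) (k : ℕ) :
    0 < gain (covMatrix α φ k) (φ k) := by
  rw [gain_eq]
  have := leverage_nonneg hα φ k
  positivity

lemma gain_le_one {α : ℝ} (hα : 0 < α) (φ : ℕ → ι → ℝ) (k : ℕ) :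
    gain (covMatrix α φ k) (φ k) ≤ 1 := by
  rw [gain_eq]
  exact inv_le_one_of_one_le₀ (by linarith [leverage_nonneg hα φ k])

lemma gain_add_relLeverage {α : ℝ} (hα : 0 < α) (φ : ℕ → ι → ℝ) (k : ℕ) :
    gain (covMatrix α φ k) (φ k) + relLeverage α φ k = 1 := by
  have := leverage_nonneg hα φ k
  rw [relLeverage, gain_eq]
  field_simp

lemma relLeverage_nonneg {α : ℝ} (hα : 0 < α) (φ : ℕ → ι → ℝ) (k : ℕ) :
    0 ≤ relLeverage α φ k :=
  mul_nonneg (gain_pos hα φ k).le (leverage_nonneg hα φ k)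

lemma relLeverage_le_one {α : ℝ} (hα : 0 < α) (φ : ℕ → ι → ℝ) (k : ℕ) :
    relLeverage α φ k ≤ 1 := by
  linarith [gain_add_relLeverage hα φ k, gain_pos hα φ k]

/-- The weighted sum `∑_{t < k} w_{t+1} φ_t`. -/
def noiseSum (φ : ℕ → ι → ℝ) (w : ℕ → ℝ) (k : ℕ) : ι → ℝ :=
  ∑ t ∈ Finset.range k, w (t + 1) • φ t

/-- The quadratic form `(v + M_k)ᵀ P_k (v + M_k)` of the weighted sum
`M_k = ∑_{t < k} w_{t+1} φ_t`. -/
def quadForm (α : ℝ) (φ : ℕ → ι → ℝ) (w : ℕ → ℝ) (v : ι → ℝ) (k : ℕ) : ℝ :=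
  (v + noiseSum φ w k) ⬝ᵥ (covMatrix α φ k *ᵥ (v + noiseSum φ w k))

/-- `φ_kᵀ P_k (v + M_k)`. -/
def crossForm (α : ℝ) (φ : ℕ → ι → ℝ) (w : ℕ → ℝ) (v : ι → ℝ) (k : ℕ) : ℝ :=
  φ k ⬝ᵥ (covMatrix α φ k *ᵥ (v + noiseSum φ w k))

lemma dotProduct_mulVec_comm_of_isHermitian {P : Matrix ι ι ℝ} (hP : P.IsHermitian)
    (x y : ι → ℝ) : x ⬝ᵥ (P *ᵥ y) = y ⬝ᵥ (P *ᵥ x) := by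
  have hT : Pᵀ = P := by rw [← conjTranspose_eq_transpose_of_trivial]; exact hP
  rw [dotProduct_mulVec, ← mulVec_transpose, hT, dotProduct_comm]

/-- The rank-one downdate of P subtracts a h², where a is the gain and h the cross form, and the new
summand contributes the terms in w. The relation a(1 + φᵀPφ) = 1 collapses the coefficients. -/
lemma quadForm_succ {α : ℝ} (hα : 0 < α) (φ : ℕ → ι → ℝ) (w : ℕ → ℝ) (v : ι → ℝ) (k : ℕ) :
    quadForm α φ w v (k + 1) = quadForm α φ w v k
      + 2 * (gain (covMatrix α φ k) (φ k) * crossForm α φ w v k * w (k + 1))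
      + relLeverage α φ k * w (k + 1) ^ 2
      - gain (covMatrix α φ k) (φ k) * crossForm α φ w v k ^ 2 := by
  have hH := (covMatrix_posDef hα φ k).isHermitian
  have hM : v + noiseSum φ w (k + 1) = (v + noiseSum φ w k) + w (k + 1) • φ k := by
    simp [noiseSum, Finset.sum_range_succ, add_assoc]
  have hsym : ∀ x, x ⬝ᵥ (covMatrix α φ k *ᵥ φ k) = φ k ⬝ᵥ (covMatrix α φ k *ᵥ x) := fun x =>
    dotProduct_mulVec_comm_of_isHermitian hH _ _
  have hform : ∀ x, x ⬝ᵥ (covMatrix α φ (k + 1) *ᵥ x) = x ⬝ᵥ (covMatrix α φ k *ᵥ x)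
      - gain (covMatrix α φ k) (φ k) * (φ k ⬝ᵥ (covMatrix α φ k *ᵥ x)) ^ 2 := by
    intro x
    rw [covMatrix, sub_mulVec, dotProduct_sub, smul_mulVec, dotProduct_smul,
      ← mulVec_mulVec, ← mulVec_mulVec, vecMulVec_mulVec, mulVec_smul]
    simp only [smul_eq_mul, dotProduct_smul, op_smul_eq_smul, hsym]
    ring
  have hc := gain_add_relLeverage hα φ k
  simp only [quadForm, hform, hM, crossForm]
  simp only [mulVec_add, mulVec_smul, dotProduct_add, add_dotProduct, dotProduct_smul,
    smul_dotProduct, smul_eq_mul]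
  have h1 := hsym (noiseSum φ w k)
  have h2 := hsym v
  rw [h1, h2]
  have hl : φ k ⬝ᵥ (covMatrix α φ k *ᵥ φ k) = leverage α φ k := rfl
  rw [hl]
  rw [relLeverage] at *
  generalize gain (covMatrix α φ k) (φ k) = a at *
  generalize leverage α φ k = c at *
  generalize w (k + 1) = s
  -- The only relation needed; the two sides differ by a multiple of it.
  have hac : a * c = 1 - a := by linarith
  generalize φ k ⬝ᵥ (covMatrix α φ k *ᵥ v) = h₁
  generalize φ k ⬝ᵥ (covMatrix α φ k *ᵥ noiseSum φ w k) = h₂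
  linear_combination (-(2 * s * (h₁ + h₂)) - s ^ 2 * c) * hac

lemma quadForm_zero {α : ℝ} (φ : ℕ → ι → ℝ) (w : ℕ → ℝ) (v : ι → ℝ) :
    quadForm α φ w v 0 = α⁻¹ * (v ⬝ᵥ v) := by
  simp [quadForm, noiseSum, covMatrix, smul_mulVec]

lemma quadForm_nonneg {α : ℝ} (hα : 0 < α) (φ : ℕ → ι → ℝ) (w : ℕ → ℝ) (v : ι → ℝ) (k : ℕ) :
    0 ≤ quadForm α φ w v k := by
  simpa [quadForm] using
    (covMatrix_posDef hα φ k).posSemidef.dotProduct_mulVec_nonneg (v + noiseSum φ w k)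

/-- Completing the square, one step adds w² - a(h - w)² ≤ w². No probability is involved, so this
also serves noise correlated with the regressors. -/
lemma quadForm_le_sum_sq {α : ℝ} (hα : 0 < α) (φ : ℕ → ι → ℝ) (w : ℕ → ℝ) (v : ι → ℝ) (k : ℕ) :
    quadForm α φ w v k ≤ α⁻¹ * (v ⬝ᵥ v) + ∑ t ∈ Finset.range k, w (t + 1) ^ 2 := by
  induction k with
  | zero => simp [quadForm_zero]
  | succ k ih =>
    rw [quadForm_succ hα, Finset.sum_range_succ]
    have h1 := gain_add_relLeverage hα φ k
    have h2 : relLeverage α φ k = 1 - gain (covMatrix α φ k) (φ k) := by linarith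
    rw [h2]
    nlinarith [mul_nonneg (gain_pos hα φ k).le (sq_nonneg (crossForm α φ w v k - w (k + 1)))]

/-- Keeps the cross terms for a martingale argument. Since a ≤ 1, the drift -a h² is at most -(a
h)², the square of the very weight in front of w. -/
lemma quadForm_le_sum {α : ℝ} (hα : 0 < α) (φ : ℕ → ι → ℝ) (w : ℕ → ℝ) (k : ℕ) :
    quadForm α φ w 0 k ≤
      2 * (∑ t ∈ Finset.range k,
        gain (covMatrix α φ t) (φ t) * crossForm α φ w 0 t * w (t + 1))
      - ∑ t ∈ Finset.range k, (gain (covMatrix α φ t) (φ t) * crossForm α φ w 0 t) ^ 2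
      + ∑ t ∈ Finset.range k, relLeverage α φ t * w (t + 1) ^ 2 := by
  induction k with
  | zero => simp [quadForm_zero]
  | succ k ih =>
    rw [quadForm_succ hα, Finset.sum_range_succ, Finset.sum_range_succ, Finset.sum_range_succ]
    have h1 := gain_le_one hα φ k
    have h2 := gain_pos hα φ k
    have h3 : (gain (covMatrix α φ k) (φ k) * crossForm α φ w 0 k) ^ 2 ≤
        gain (covMatrix α φ k) (φ k) * crossForm α φ w 0 k ^ 2 := by
      rw [mul_pow]
      exact mul_le_mul_of_nonneg_right (by nlinarith) (sq_nonneg _)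
    linarith

/-- The normal equations of the recursive least squares estimate. -/
lemma infoMatrix_mulVec_estimate_sub {α : ℝ} (hα : 0 < α) (θ₀ θ : ι → ℝ) (φ : ℕ → ι → ℝ)
    (z : ℕ → ℝ) (e : ℕ → ℝ) (he : ∀ t, e (t + 1) = z (t + 1) - φ t ⬝ᵥ θ) (k : ℕ) :
    infoMatrix α φ k *ᵥ (estimate α θ₀ φ z k - θ) = α • (θ₀ - θ) + noiseSum φ e k := by
  induction k with
  | zero => simp [infoMatrix, noiseSum, estimate, smul_mulVec]
  | succ k ih =>
    have hns : noiseSum φ e (k + 1) = noiseSum φ e k + e (k + 1) • φ k := by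
      simp [noiseSum, Finset.sum_range_succ]
    have hv : ∀ x : ι → ℝ, vecMulVec (φ k) (φ k) *ᵥ x = (φ k ⬝ᵥ x) • φ k := by
      intro x
      rw [vecMulVec_mulVec, op_smul_eq_smul]
    -- The updated information matrix sends the correction direction P_k φ_k to a multiple of φ_k,
    -- which the gain normalizes to φ_k itself.
    have hP : infoMatrix α φ (k + 1) *ᵥ (covMatrix α φ k *ᵥ φ k) =
        (1 + leverage α φ k) • φ k := by
      rw [infoMatrix_succ, add_mulVec, mulVec_mulVec, infoMatrix_mul_covMatrix hα, hv, one_mulVec,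
        add_smul, one_smul]
      rfl
    have hg : gain (covMatrix α φ k) (φ k) * (1 + leverage α φ k) = 1 := by
      have := leverage_nonneg hα φ k
      rw [gain_eq]
      exact inv_mul_cancel₀ (by positivity)
    rw [hns, ← add_assoc, ← ih, estimate, add_sub_right_comm, mulVec_add, mulVec_smul, hP,
      smul_smul, infoMatrix_succ, add_mulVec, hv, add_assoc, ← add_smul, he]
    congr 2
    rw [dotProduct_sub]
    linear_combination (z (k + 1) - φ k ⬝ᵥ estimate α θ₀ φ z k) * hg

lemma estimate_sub {α : ℝ} (hα : 0 < α) (θ₀ θ : ι → ℝ) (φ : ℕ → ι → ℝ)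
    (z : ℕ → ℝ) (e : ℕ → ℝ) (he : ∀ t, e (t + 1) = z (t + 1) - φ t ⬝ᵥ θ) (k : ℕ) :
    estimate α θ₀ φ z k - θ = covMatrix α φ k *ᵥ (α • (θ₀ - θ) + noiseSum φ e k) := by
  rw [← infoMatrix_mulVec_estimate_sub hα θ₀ θ φ z e he, mulVec_mulVec,
    covMatrix_mul_infoMatrix hα, one_mulVec]

lemma euclNorm_sq (x : ι → ℝ) : euclNorm x ^ 2 = x ⬝ᵥ x := by
  rw [euclNorm, EuclideanSpace.real_norm_sq_eq]
  simp [dotProduct, sq]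

lemma euclNorm_nonneg (x : ι → ℝ) : 0 ≤ euclNorm x := norm_nonneg _

lemma euclNorm_add_le (x y : ι → ℝ) : euclNorm (x + y) ≤ euclNorm x + euclNorm y := by
  simpa [euclNorm] using norm_add_le (WithLp.toLp 2 x) (WithLp.toLp 2 y)

/-- Subtracting the least eigenvalue times the identity leaves a nonnegative spectrum. -/
lemma lambdaMin_mul_le {H : Matrix ι ι ℝ} (hH : H.IsHermitian) (x : ι → ℝ) :
    lambdaMin H * (x ⬝ᵥ x) ≤ x ⬝ᵥ (H *ᵥ x) := by
  have hbdd : BddBelow (spectrum ℝ H) := by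
    rw [hH.spectrum_real_eq_range_eigenvalues]
    exact (Set.finite_range _).bddBelow
  have hps : (H - lambdaMin H • (1 : Matrix ι ι ℝ)).PosSemidef := by
    rw [posSemidef_iff_isHermitian_and_spectrum_nonneg]
    refine ⟨hH.sub (by simp [IsHermitian]), fun r hr => ?_⟩
    have : lambdaMin H + r ∈ spectrum ℝ H := by
      rw [add_comm, spectrum.add_mem_iff, Algebra.algebraMap_eq_smul_one, neg_add_eq_sub]
      exact hr
    have := csInf_le hbdd this
    rw [← lambdaMin] at this
    simpa using this
  have := hps.dotProduct_mulVec_nonneg x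
  simp only [sub_mulVec, smul_mulVec, one_mulVec, dotProduct_sub, dotProduct_smul, smul_eq_mul,
    star_trivial] at this
  linarith

lemma lambdaMin_smul {H : Matrix ι ι ℝ} {c : ℝ} (hc : 0 < c) :
    lambdaMin (c • H) = c * lambdaMin H := by
  have := spectrum.unit_smul_eq_smul (R := ℝ) H (Units.mk0 c hc.ne')
  rw [lambdaMin, lambdaMin, ← smul_eq_mul, ← Real.sInf_smul_of_nonneg hc.le]
  congr 1

/-- For v = P x one has vᵀ P⁻¹ v = xᵀ P x, while the left side is at least λ_min(P⁻¹) ‖v‖². -/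
lemma euclNorm_covMatrix_mulVec_le {α : ℝ} (hα : 0 < α) (φ : ℕ → ι → ℝ) (k : ℕ) (x : ι → ℝ)
    (hl : 0 < lambdaMin (infoMatrix α φ k)) :
    euclNorm (covMatrix α φ k *ᵥ x) ≤
      Real.sqrt ((x ⬝ᵥ (covMatrix α φ k *ᵥ x)) / lambdaMin (infoMatrix α φ k)) := by
  apply Real.le_sqrt_of_sq_le
  rw [euclNorm_sq, le_div_iff₀ hl, mul_comm]
  refine (lambdaMin_mul_le (infoMatrix_posDef hα φ k).isHermitian _).trans ?_
  rw [mulVec_mulVec, infoMatrix_mul_covMatrix hα, one_mulVec, dotProduct_comm]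

lemma det_infoMatrix_succ {α : ℝ} (hα : 0 < α) (φ : ℕ → ι → ℝ) (k : ℕ) :
    (infoMatrix α φ (k + 1)).det = (infoMatrix α φ k).det * (1 + leverage α φ k) := by
  have hu : IsUnit (infoMatrix α φ k) := (infoMatrix_posDef hα φ k).isUnit
  have := det_add_replicateCol_mul_replicateRow (ι := Unit)
    ((Matrix.isUnit_iff_isUnit_det _).1 hu) (φ k) (φ k)
  rw [infoMatrix_succ, vecMulVec_eq Unit, this, ← covMatrix_eq hα]
  congr 1
  rw [Matrix.mul_assoc, ← replicateCol_mulVec]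
  simp [leverage, replicateRow_mul_replicateCol_apply]

/-- The ratio of consecutive determinants is 1 + φᵀPφ, and 1 - 1/x ≤ log x. -/
lemma relLeverage_le_log {α : ℝ} (hα : 0 < α) (φ : ℕ → ι → ℝ) (k : ℕ) :
    relLeverage α φ k ≤
      Real.log (infoMatrix α φ (k + 1)).det - Real.log (infoMatrix α φ k).det := by
  have h0 := leverage_nonneg hα φ k
  rw [det_infoMatrix_succ hα, Real.log_mul (infoMatrix_posDef hα φ k).det_pos.ne' (by positivity)]
  have := Real.one_sub_inv_le_log_of_pos (show 0 < 1 + leverage α φ k by positivity)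
  have h2 : relLeverage α φ k = 1 - (1 + leverage α φ k)⁻¹ := by
    have := gain_add_relLeverage hα φ k
    rw [gain_eq] at this
    linarith
  linarith

/-- Each eigenvalue is at most the trace. Crude, but only the logarithm of the determinant matters.
-/
lemma det_le_trace_pow {H : Matrix ι ι ℝ} (hH : H.PosSemidef) :
    H.det ≤ H.trace ^ Fintype.card ι := by
  have h1 := hH.isHermitian.det_eq_prod_eigenvalues
  have h2 := hH.isHermitian.trace_eq_sum_eigenvalues
  simp only [RCLike.ofReal_real_eq_id, id] at h1 h2
  rw [h1, h2, ← Finset.card_univ, ← Finset.prod_const]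
  refine Finset.prod_le_prod (fun i _ => hH.eigenvalues_nonneg i) fun i _ => ?_
  exact Finset.single_le_sum (f := hH.isHermitian.eigenvalues)
    (fun j _ => hH.eigenvalues_nonneg j) (Finset.mem_univ i)

lemma trace_infoMatrix_succ (α : ℝ) (φ : ℕ → ι → ℝ) (k : ℕ) :
    (infoMatrix α φ (k + 1)).trace = α * Fintype.card ι + (energy φ k - Real.exp 1) := by
  simp [infoMatrix, energy, trace_sum, trace_vecMulVec, euclNorm_sq]

lemma exp_one_le_energy (φ : ℕ → ι → ℝ) (k : ℕ) : Real.exp 1 ≤ energy φ k := by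
  have : 0 ≤ ∑ t ∈ Finset.range (k + 1), euclNorm (φ t) ^ 2 :=
    Finset.sum_nonneg fun t _ => sq_nonneg _
  rw [energy]
  linarith

lemma one_le_log_energy (φ : ℕ → ι → ℝ) (k : ℕ) : 1 ≤ Real.log (energy φ k) := by
  rw [Real.le_log_iff_exp_le ((Real.exp_pos 1).trans_le (exp_one_le_energy φ k))]
  exact exp_one_le_energy φ k

/-- `1 + ∑_{t < k} φᵀPφ / (1 + φᵀPφ)`. -/
def leverageSum (α : ℝ) (φ : ℕ → ι → ℝ) (k : ℕ) : ℝ :=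
  1 + ∑ t ∈ Finset.range k, relLeverage α φ t

lemma leverageSum_succ (α : ℝ) (φ : ℕ → ι → ℝ) (k : ℕ) :
    leverageSum α φ (k + 1) = leverageSum α φ k + relLeverage α φ k := by
  simp [leverageSum, Finset.sum_range_succ, add_assoc]

lemma one_le_leverageSum {α : ℝ} (hα : 0 < α) (φ : ℕ → ι → ℝ) (k : ℕ) :
    1 ≤ leverageSum α φ k := by
  have : 0 ≤ ∑ t ∈ Finset.range k, relLeverage α φ t :=
    Finset.sum_nonneg fun t _ => relLeverage_nonneg hα φ t
  rw [leverageSum]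
  linarith

/-- The sum of the relative leverages grows at most like the logarithm of the energy. -/
lemma exists_leverageSum_le {α : ℝ} (hα : 0 < α) :
    ∃ C : ℝ, 1 ≤ C ∧ ∀ (φ : ℕ → ι → ℝ) (k : ℕ),
      leverageSum α φ (k + 1) ≤ C * Real.log (energy φ k) := by
  set d : ℝ := (Fintype.card ι : ℝ) with hd_def
  have hd : (0 : ℝ) ≤ d := Nat.cast_nonneg _
  -- `A` absorbs the initial log-determinant d log α, and `B` the growth of log det; both may be
  -- multiplied by log energy because it is at least 1.
  set A : ℝ := 1 + |d * Real.log α|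
  set B : ℝ := d * (1 + Real.log (1 + α * d))
  have hlog0 : 0 ≤ Real.log (1 + α * d) := Real.log_nonneg (by nlinarith)
  have hB : 0 ≤ B := by positivity
  have hA : 1 ≤ A := le_add_of_nonneg_right (abs_nonneg _)
  refine ⟨A + B, by linarith, fun φ k => ?_⟩
  have htel : ∀ n, ∑ t ∈ Finset.range n, relLeverage α φ t ≤
      Real.log (infoMatrix α φ n).det - Real.log (infoMatrix α φ 0).det := by
    intro n
    rw [← Finset.sum_range_sub (fun n => Real.log (infoMatrix α φ n).det)]
    exact Finset.sum_le_sum fun t _ => relLeverage_le_log hα φ t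
  have h0 : Real.log (infoMatrix α φ 0).det = d * Real.log α := by
    simp [infoMatrix, d]
  have hE := exp_one_le_energy φ k
  have hE1 : 1 ≤ energy φ k := (Real.one_le_exp zero_le_one).trans hE
  have hl := one_le_log_energy φ k
  have hdet : Real.log (infoMatrix α φ (k + 1)).det ≤ B * Real.log (energy φ k) := by
    have htr : (infoMatrix α φ (k + 1)).trace ≤ (1 + α * d) * energy φ k := by
      rw [trace_infoMatrix_succ]
      have : 0 ≤ α * d := by positivity
      nlinarith [Real.exp_pos 1]
    have htr0 : 0 ≤ (infoMatrix α φ (k + 1)).trace :=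
      (infoMatrix_posDef hα φ (k + 1)).posSemidef.trace_nonneg
    calc Real.log (infoMatrix α φ (k + 1)).det
        ≤ Real.log (((1 + α * d) * energy φ k) ^ Fintype.card ι) := by
          refine Real.log_le_log (infoMatrix_posDef hα φ (k + 1)).det_pos ?_
          refine (det_le_trace_pow (infoMatrix_posDef hα φ (k + 1)).posSemidef).trans ?_
          exact pow_le_pow_left₀ htr0 htr _
      _ = d * (Real.log (1 + α * d) + Real.log (energy φ k)) := by
          rw [Real.log_pow, Real.log_mul (by positivity) (by positivity)]
      _ ≤ B * Real.log (energy φ k) := by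
          simp only [B]
          rw [mul_assoc]
          refine mul_le_mul_of_nonneg_left ?_ hd
          nlinarith
  have h1 := htel (k + 1)
  rw [h0] at h1
  have h2 := neg_abs_le (d * Real.log α)
  have h3 : A ≤ A * Real.log (energy φ k) := le_mul_of_one_le_right (by linarith) hl
  rw [leverageSum]
  simp only [A] at h3 ⊢
  linarith

end LinearAlgebra

/-! ### Integral comparison and summation by parts -/

section RealSequences

lemma sum_sub_mul_le {x : ℕ → ℝ} {f F : ℝ → ℝ} {a K : ℝ} (hx : Monotone x) (ha : a ≤ x 0)
    (hF : ∀ s t, a ≤ s → s ≤ t → (t - s) * f t ≤ F t - F s) (hK : ∀ t, a ≤ t → F t ≤ K) (n : ℕ) :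
    ∑ k ∈ Finset.range n, (x (k + 1) - x k) * f (x (k + 1)) ≤ K - F (x 0) := by
  have hax : ∀ k, a ≤ x k := fun k => ha.trans (hx (Nat.zero_le k))
  calc _ ≤ ∑ k ∈ Finset.range n, (F (x (k + 1)) - F (x k)) :=
        Finset.sum_le_sum fun k _ => hF _ _ (hax k) (hx (Nat.le_succ k))
    _ = F (x n) - F (x 0) := Finset.sum_range_sub (fun k => F (x k)) n
    _ ≤ _ := by linarith [hK _ (hax n)]

/-- Mean value inequality: on [s, t] the derivative is at least its value at the right end, by
antitonicity. -/
lemma sub_mul_le_of_hasDerivAt {F f : ℝ → ℝ} {a : ℝ} (hF : ∀ t, a ≤ t → HasDerivAt F (f t) t)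
    (hf : ∀ s t, a ≤ s → s ≤ t → f t ≤ f s) (s t : ℝ) (hs : a ≤ s) (hst : s ≤ t) :
    (t - s) * f t ≤ F t - F s := by
  have := (convex_Icc s t).mul_sub_le_image_sub_of_le_deriv (f := F) (C := f t)
    (fun r hr => (hF r (hs.trans hr.1)).continuousAt.continuousWithinAt)
    (fun r hr => by
      rw [interior_Icc] at hr
      exact (hF r (hs.trans hr.1.le)).differentiableAt.differentiableWithinAt)
    (fun r hr => by
      rw [interior_Icc] at hr
      rw [(hF r (hs.trans hr.1.le)).deriv]
      exact hf r t (hs.trans hr.1.le) hr.2.le)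
    s ⟨le_rfl, hst⟩ t ⟨hst, le_rfl⟩ hst
  linarith

/-- A right-endpoint Riemann sum of a decreasing function lies below its integral over [1, ∞). -/
lemma sum_sub_mul_rpow_neg_le {x : ℕ → ℝ} (hx : Monotone x) (h0 : x 0 = 1) {s : ℝ} (hs : 1 < s)
    (n : ℕ) :
    ∑ k ∈ Finset.range n, (x (k + 1) - x k) * x (k + 1) ^ (-s) ≤ 1 / (s - 1) := by
  have h := sum_sub_mul_le (f := fun t => t ^ (-s)) (F := fun t => -(t ^ (1 - s) / (s - 1)))
    (a := 1) (K := 0) hx h0.ge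
    (sub_mul_le_of_hasDerivAt (fun t ht => by
        have := ((Real.hasDerivAt_rpow_const (x := t) (p := 1 - s) (Or.inl (by linarith))).div_const
          (s - 1)).neg
        refine this.congr_deriv ?_
        rw [show 1 - s - 1 = -s by ring]
        field_simp [(by linarith : s - 1 ≠ 0)]
        ring)
      (fun r t hr hrt => Real.rpow_le_rpow_of_nonpos (by linarith) hrt (by linarith)))
    (fun t ht => by
      have : 0 ≤ t ^ (1 - s) := Real.rpow_nonneg (by linarith) _
      have h2 : 0 ≤ t ^ (1 - s) / (s - 1) := div_nonneg this (by linarith)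
      linarith) n
  simpa [h0] using h

/-- The function `(e + x) log(e + x)^κ`. -/
def logScale (κ x : ℝ) : ℝ := (Real.exp 1 + x) * Real.log (Real.exp 1 + x) ^ κ

lemma one_le_log_exp_add {x : ℝ} (hx : 0 ≤ x) : 1 ≤ Real.log (Real.exp 1 + x) := by
  rw [Real.le_log_iff_exp_le (by positivity)]
  linarith

lemma logScale_pos {κ x : ℝ} (hx : 0 ≤ x) : 0 < logScale κ x :=
  mul_pos (by positivity) (Real.rpow_pos_of_pos (by linarith [one_le_log_exp_add hx]) _)

lemma logScale_mono {κ x y : ℝ} (hκ : 0 ≤ κ) (hx : 0 ≤ x) (hxy : x ≤ y) :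
    logScale κ x ≤ logScale κ y := by
  have h1 := one_le_log_exp_add hx
  have h2 : Real.log (Real.exp 1 + x) ≤ Real.log (Real.exp 1 + y) :=
    Real.log_le_log (by positivity) (by linarith)
  exact mul_le_mul (by linarith) (Real.rpow_le_rpow (by linarith) h2 hκ)
    (Real.rpow_nonneg (by linarith) _) (by have := Real.exp_pos 1; linarith)

/-- Here -log(e + t)^(1-κ)/(κ-1) is an antiderivative of 1/`logScale`, and κ > 1 makes it bounded.
-/
lemma sum_sub_div_logScale_le {x : ℕ → ℝ} (hx : Monotone x) (h0 : 0 ≤ x 0) {κ : ℝ} (hκ : 1 < κ)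
    (n : ℕ) :
    ∑ k ∈ Finset.range n, (x (k + 1) - x k) * (logScale κ (x (k + 1)))⁻¹ ≤ 1 / (κ - 1) := by
  have h := sum_sub_mul_le (f := fun t => (logScale κ t)⁻¹)
    (F := fun t => -(Real.log (Real.exp 1 + t) ^ (1 - κ) / (κ - 1))) (a := 0) (K := 0) hx h0
    (sub_mul_le_of_hasDerivAt (fun t ht => by
        have hl := one_le_log_exp_add ht
        have hp : Real.exp 1 + t ≠ 0 := by positivity
        have h1 : HasDerivAt (fun t => Real.log (Real.exp 1 + t)) (1 / (Real.exp 1 + t)) t :=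
          ((hasDerivAt_id t).const_add (Real.exp 1)).log hp
        have := ((h1.rpow_const (p := 1 - κ) (Or.inl (by linarith))).div_const (κ - 1)).neg
        refine this.congr_deriv ?_
        rw [logScale, show 1 - κ - 1 = -κ by ring, Real.rpow_neg (by linarith)]
        have h2 : Real.log (Real.exp 1 + t) ^ κ ≠ 0 :=
          (Real.rpow_pos_of_pos (by linarith) _).ne'
        have h3 : κ - 1 ≠ 0 := by linarith
        field_simp
        ring)
      (fun r t hr hrt => inv_anti₀ (logScale_pos hr) (logScale_mono (by linarith) hr hrt)))
    (fun t ht => by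
      have : 0 ≤ Real.log (Real.exp 1 + t) ^ (1 - κ) / (κ - 1) :=
        div_nonneg (Real.rpow_nonneg (by linarith [one_le_log_exp_add ht]) _) (by linarith)
      linarith) n
  refine h.trans ?_
  rw [zero_sub, neg_neg]
  refine div_le_div_of_nonneg_right ?_ (by linarith)
  exact Real.rpow_le_one_of_one_le_of_nonpos (one_le_log_exp_add h0) (by linarith)

/-- Summation by parts: a sum weighted by a monotone sequence. -/
lemma abs_sum_mul_le {b x : ℕ → ℝ} {K : ℝ} (hb : Monotone b) (hb0 : 0 ≤ b 0)
    (hK : ∀ n, |∑ k ∈ Finset.range n, x k| ≤ K) (n : ℕ) :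
    |∑ k ∈ Finset.range n, b (k + 1) * x k| ≤ 2 * K * b n := by
  -- Abel summation; the increments of `b` are nonnegative and telescope, so each of the two parts
  -- costs K b_n.
  have hid : ∀ n, ∑ k ∈ Finset.range n, b (k + 1) * x k = b n * ∑ k ∈ Finset.range n, x k
      - ∑ k ∈ Finset.range n, (b (k + 1) - b k) * ∑ j ∈ Finset.range k, x j := by
    intro n
    induction n with
    | zero => simp
    | succ n ih =>
      rw [Finset.sum_range_succ, ih, Finset.sum_range_succ x,
        Finset.sum_range_succ (fun k => (b (k + 1) - b k) * _)]
      ring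
  have hbn : ∀ n, 0 ≤ b n := fun n => hb0.trans (hb (Nat.zero_le n))
  have hK0 : 0 ≤ K := (abs_nonneg _).trans (hK 0)
  have h1 : |b n * ∑ k ∈ Finset.range n, x k| ≤ b n * K := by
    rw [abs_mul, abs_of_nonneg (hbn n)]
    exact mul_le_mul_of_nonneg_left (hK n) (hbn n)
  have h2 : |∑ k ∈ Finset.range n, (b (k + 1) - b k) * ∑ j ∈ Finset.range k, x j| ≤ b n * K := by
    calc _ ≤ ∑ k ∈ Finset.range n, |(b (k + 1) - b k) * ∑ j ∈ Finset.range k, x j| :=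
          Finset.abs_sum_le_sum_abs _ _
      _ ≤ ∑ k ∈ Finset.range n, (b (k + 1) - b k) * K := by
          refine Finset.sum_le_sum fun k _ => ?_
          have : 0 ≤ b (k + 1) - b k := sub_nonneg.2 (hb (Nat.le_succ k))
          rw [abs_mul, abs_of_nonneg this]
          exact mul_le_mul_of_nonneg_left (hK k) this
      _ = (b n - b 0) * K := by rw [← Finset.sum_mul, Finset.sum_range_sub]
      _ ≤ b n * K := mul_le_mul_of_nonneg_right (by linarith) hK0
  rw [hid]
  calc _ ≤ _ := abs_sub _ _
    _ ≤ 2 * K * b n := by linarith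

end RealSequences

/-! ### Martingale differences with bounded conditional moments -/

section Martingale

variable {Ω : Type*} [mΩ : MeasurableSpace Ω] {μ : Measure Ω} [IsProbabilityMeasure μ]
  {ℱ : Filtration ℕ mΩ}

/-- A martingale with bounded second moments has bounded paths. -/
lemma ae_exists_abs_sum_le {X : ℕ → Ω → ℝ} (hmeas : ∀ k, Measurable[ℱ (k + 1)] (X k))
    (hL2 : ∀ k, MemLp (X k) 2 μ) (hcond : ∀ k, μ[X k | ℱ k] =ᵐ[μ] 0) {K : ℝ}
    (hK : ∀ n, ∑ k ∈ Finset.range n, ∫ x, X k x ^ 2 ∂μ ≤ K) :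
    ∀ᵐ x ∂μ, ∃ C : ℝ, ∀ n, |∑ k ∈ Finset.range n, X k x| ≤ C := by
  set S : ℕ → Ω → ℝ := fun n => ∑ k ∈ Finset.range n, X k with hS
  have hSsucc : ∀ n, S (n + 1) = S n + X n := fun n => Finset.sum_range_succ _ _
  have hSmeas : ∀ n, StronglyMeasurable[ℱ n] (S n) := by
    intro n
    refine Finset.stronglyMeasurable_sum _ fun k hk => ?_
    exact ((hmeas k).mono (ℱ.mono (Finset.mem_range.1 hk)) le_rfl).stronglyMeasurable
  have hS2 : ∀ n, MemLp (S n) 2 μ := fun n => memLp_finsetSum' _ fun k _ => hL2 k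
  have hmart : Martingale S ℱ μ := by
    refine martingale_of_condExp_sub_eq_zero_nat hSmeas
      (fun n => (hS2 n).integrable one_le_two) fun n => ?_
    rw [hSsucc, add_sub_cancel_left]
    exact hcond n
  -- Conditioning on ℱ n pulls out S n and kills the increment, so second moments add up.
  have horth : ∀ n, ∫ x, S n x * X n x ∂μ = 0 := by
    intro n
    have hint : Integrable (S n * X n) μ := (hS2 n).integrable_mul (hL2 n)
    have h := condExp_mul_of_stronglyMeasurable_left (hSmeas n) hint
      ((hL2 n).integrable one_le_two)
    have h2 := integral_condExp (ℱ.le n) (f := S n * X n) (μ := μ)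
    have h3 : μ[S n * X n | ℱ n] =ᵐ[μ] 0 := by
      filter_upwards [h, hcond n] with x hx hx'
      simp [hx, hx']
    rw [integral_congr_ae h3] at h2
    simpa using h2.symm
  have hsq : ∀ n, ∫ x, S n x ^ 2 ∂μ = ∑ k ∈ Finset.range n, ∫ x, X k x ^ 2 ∂μ := by
    intro n
    induction n with
    | zero => simp [hS]
    | succ n ih =>
      rw [Finset.sum_range_succ, ← ih, hSsucc]
      have e : ∀ x, (S n + X n) x ^ 2 = S n x ^ 2 + 2 * (S n x * X n x) + X n x ^ 2 := by
        intro x; simp only [Pi.add_apply]; ring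
      have hint : Integrable (fun x => S n x * X n x) μ := (hS2 n).integrable_mul (hL2 n)
      simp_rw [e]
      have hint2 : Integrable (fun x => S n x ^ 2 + 2 * (S n x * X n x)) μ :=
        (hS2 n).integrable_sq.add (hint.const_mul 2)
      rw [integral_add hint2 (hL2 n).integrable_sq, integral_add (hS2 n).integrable_sq
        (hint.const_mul 2), integral_const_mul, horth]
      simp
  -- Martingale convergence only asks for a bound in L¹, obtained from |S| ≤ S² + 1.
  have hbdd : ∀ n, eLpNorm (S n) 1 μ ≤ (Real.toNNReal (K + 1) : ℝ≥0∞) := by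
    intro n
    have hint1 : Integrable (S n) μ := (hS2 n).integrable one_le_two
    rw [eLpNorm_one_eq_lintegral_enorm, ← ofReal_integral_norm_eq_lintegral_enorm hint1]
    refine ENNReal.ofReal_le_ofReal ?_
    calc ∫ x, ‖S n x‖ ∂μ ≤ ∫ x, (S n x ^ 2 + 1) ∂μ := by
          refine integral_mono hint1.norm ((hS2 n).integrable_sq.add (integrable_const _)) ?_
          intro x
          simp only [Real.norm_eq_abs]
          nlinarith [sq_nonneg (|S n x| - 1), sq_abs (S n x), abs_nonneg (S n x)]
      _ = ∫ x, S n x ^ 2 ∂μ + 1 := by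
          rw [integral_add (hS2 n).integrable_sq (integrable_const _)]
          simp
      _ ≤ K + 1 := by rw [hsq]; linarith [hK n]
  filter_upwards [hmart.submartingale.ae_tendsto_limitProcess hbdd] with x hx
  obtain ⟨C, hC⟩ := (hx.abs).bddAbove_range
  refine ⟨C, fun n => ?_⟩
  have := hC ⟨n, rfl⟩
  simpa [hS] using this

/-- Integrable martingale differences whose conditional moments of order `β` are bounded
by `N`. -/
structure IsBoundedMDS (μ : Measure Ω) (ℱ : Filtration ℕ mΩ) (w : ℕ → Ω → ℝ) (β N : ℝ) :
    Prop where
  measurable : ∀ k, Measurable[ℱ (k + 1)] (w (k + 1))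
  integrable : ∀ k, Integrable (w (k + 1)) μ
  condExp_eq : ∀ k, μ[w (k + 1) | ℱ k] =ᵐ[μ] 0
  moment_le : ∀ k A, MeasurableSet[ℱ k] A →
    ∫⁻ x in A, ENNReal.ofReal (|w (k + 1) x| ^ β) ∂μ ≤ ENNReal.ofReal N * μ A

variable {w : ℕ → Ω → ℝ} {β N : ℝ}

/-- The moment bound on ℱ_k-sets is an inequality between measures restricted to ℱ_k; integrating
`g` against both sides requires no integrability. -/
lemma IsBoundedMDS.lintegral_mul_le (h : IsBoundedMDS μ ℱ w β N) (k : ℕ) {g : Ω → ℝ≥0∞}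
    (hg : Measurable[ℱ k] g) :
    ∫⁻ x, g x * ENNReal.ofReal (|w (k + 1) x| ^ β) ∂μ ≤ ENNReal.ofReal N * ∫⁻ x, g x ∂μ := by
  have hwm : Measurable (w (k + 1)) := (h.measurable k).mono (ℱ.le _) le_rfl
  have hfm : Measurable fun x => ENNReal.ofReal (|w (k + 1) x| ^ β) := by fun_prop
  set ν := μ.withDensity fun x => ENNReal.ofReal (|w (k + 1) x| ^ β)
  have hle : ν.trim (ℱ.le k) ≤ (ENNReal.ofReal N • μ).trim (ℱ.le k) := by
    refine Measure.le_iff.2 fun A hA => ?_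
    rw [trim_measurableSet_eq _ hA, trim_measurableSet_eq _ hA, withDensity_apply _ (ℱ.le k _ hA)]
    simpa using h.moment_le k A hA
  have h1 : ∫⁻ x, g x ∂ν = ∫⁻ x, g x * ENNReal.ofReal (|w (k + 1) x| ^ β) ∂μ := by
    rw [lintegral_withDensity_eq_lintegral_mul _ hfm (hg.mono (ℱ.le k) le_rfl)]
    simp [mul_comm]
  rw [← h1, ← lintegral_trim (ℱ.le k) hg]
  refine (lintegral_mono' hle le_rfl).trans ?_
  rw [lintegral_trim (ℱ.le k) hg, lintegral_smul_measure, smul_eq_mul]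

lemma IsBoundedMDS.mono_exponent (h : IsBoundedMDS μ ℱ w β N) (hN : 0 ≤ N) {β' : ℝ} (h0 : 0 ≤ β')
    (hβ : β' ≤ β) : IsBoundedMDS μ ℱ w β' (N + 1) where
  measurable := h.measurable
  integrable := h.integrable
  condExp_eq := h.condExp_eq
  moment_le k A hA := by
    have hwm : Measurable (w (k + 1)) := (h.measurable k).mono (ℱ.le _) le_rfl
    calc ∫⁻ x in A, ENNReal.ofReal (|w (k + 1) x| ^ β') ∂μ
        ≤ ∫⁻ x in A, (ENNReal.ofReal (|w (k + 1) x| ^ β) + 1) ∂μ := by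
          refine lintegral_mono fun x => ?_
          rw [← ENNReal.ofReal_one, ← ENNReal.ofReal_add (by positivity) zero_le_one]
          refine ENNReal.ofReal_le_ofReal ?_
          rcases le_total 1 |w (k + 1) x| with h1 | h1
          · linarith [Real.rpow_le_rpow_of_exponent_le h1 hβ]
          · have := Real.rpow_le_one (abs_nonneg _) h1 h0
            have h2 : 0 ≤ |w (k + 1) x| ^ β := by positivity
            linarith
      _ = ∫⁻ x in A, ENNReal.ofReal (|w (k + 1) x| ^ β) ∂μ + μ A := by
          rw [lintegral_add_right _ measurable_const]
          simp
      _ ≤ ENNReal.ofReal (N + 1) * μ A := by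
          rw [ENNReal.ofReal_add hN zero_le_one, add_mul, ENNReal.ofReal_one, one_mul]
          exact add_le_add_left (h.moment_le k A hA) _

lemma IsBoundedMDS.lintegral_mul_sq_le (h : IsBoundedMDS μ ℱ w 2 N) (k : ℕ) {g : Ω → ℝ≥0∞}
    (hg : Measurable[ℱ k] g) :
    ∫⁻ x, g x * ENNReal.ofReal (w (k + 1) x ^ 2) ∂μ ≤ ENNReal.ofReal N * ∫⁻ x, g x ∂μ := by
  simpa using h.lintegral_mul_le k hg

lemma IsBoundedMDS.memLp (h : IsBoundedMDS μ ℱ w 2 N) (k : ℕ) : MemLp (w (k + 1)) 2 μ := by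
  have hwm : Measurable (w (k + 1)) := (h.measurable k).mono (ℱ.le _) le_rfl
  rw [memLp_two_iff_integrable_sq hwm.aestronglyMeasurable]
  refine ⟨by fun_prop, ?_⟩
  rw [hasFiniteIntegral_iff_ofReal (ae_of_all _ fun x => sq_nonneg _)]
  have := h.lintegral_mul_sq_le k (g := fun _ => 1) measurable_const
  simp only [one_mul, lintegral_one, measure_univ, mul_one] at this
  exact this.trans_lt ENNReal.ofReal_lt_top

/-- Nonnegative random variables whose expectations are summable are summable. -/
lemma ae_exists_sum_le {Y : ℕ → Ω → ℝ} (hY : ∀ k, Measurable (Y k)) (h0 : ∀ k x, 0 ≤ Y k x)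
    {K : ℝ≥0∞} (hK : K ≠ ∞)
    (hle : ∀ n, ∑ k ∈ Finset.range n, ∫⁻ x, ENNReal.ofReal (Y k x) ∂μ ≤ K) :
    ∀ᵐ x ∂μ, ∃ C : ℝ, ∀ n, ∑ k ∈ Finset.range n, Y k x ≤ C := by
  have h1 : ∫⁻ x, ∑' k, ENNReal.ofReal (Y k x) ∂μ ≠ ∞ := by
    rw [lintegral_tsum fun k => ((hY k).ennreal_ofReal).aemeasurable]
    refine ne_top_of_le_ne_top hK ?_
    rw [ENNReal.tsum_eq_iSup_nat]
    exact iSup_le hle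
  filter_upwards [ae_lt_top (by fun_prop) h1] with x hx
  refine ⟨(∑' k, ENNReal.ofReal (Y k x)).toReal, fun n => ?_⟩
  rw [← ENNReal.ofReal_le_iff_le_toReal hx.ne, ENNReal.ofReal_sum_of_nonneg fun k _ => h0 k x]
  exact ENNReal.sum_le_tsum _

lemma sum_lintegral_ofReal_le {c : ℕ → Ω → ℝ} (hc : ∀ k, Measurable (c k)) (h0 : ∀ k x, 0 ≤ c k x)
    {K : ℝ} (hK : ∀ n x, ∑ k ∈ Finset.range n, c k x ≤ K) (n : ℕ) :
    ∑ k ∈ Finset.range n, ∫⁻ x, ENNReal.ofReal (c k x) ∂μ ≤ ENNReal.ofReal K := by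
  rw [← lintegral_finsetSum _ fun k _ => (hc k).ennreal_ofReal]
  calc _ ≤ ∫⁻ _, ENNReal.ofReal K ∂μ := by
        refine lintegral_mono fun x => ?_
        rw [← ENNReal.ofReal_sum_of_nonneg fun k _ => h0 k x]
        exact ENNReal.ofReal_le_ofReal (hK n x)
    _ = _ := by simp

/-- A martingale transform is dominated by its own quadratic weight. -/
lemma IsBoundedMDS.ae_exists_transform_le (h : IsBoundedMDS μ ℱ w 2 N) (hN : 0 ≤ N)
    {g : ℕ → Ω → ℝ} (hg : ∀ k, Measurable[ℱ k] (g k)) :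
    ∀ᵐ x ∂μ, ∃ C : ℝ, ∀ n, 2 * ∑ k ∈ Finset.range n, g k x * w (k + 1) x
      - ∑ k ∈ Finset.range n, g k x ^ 2 ≤ C := by
  set G : ℕ → Ω → ℝ := fun n x => 1 + ∑ k ∈ Finset.range n, g k x ^ 2 with hG
  have hGsucc : ∀ n x, G (n + 1) x = G n x + g n x ^ 2 := fun n x => by
    simp [hG, Finset.sum_range_succ, add_assoc]
  have hGmono : ∀ x, Monotone fun n => G n x := fun x =>
    monotone_nat_of_le_succ fun n => by rw [hGsucc]; linarith [sq_nonneg (g n x)]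
  have hG0 : ∀ x, G 0 x = 1 := fun x => by simp [hG]
  have hG1 : ∀ n x, 1 ≤ G n x := fun n x => by rw [← hG0 x]; exact hGmono x (Nat.zero_le n)
  have hgm : ∀ j k, j ≤ k → Measurable[ℱ k] (g j) := fun j k hjk =>
    (hg j).mono (ℱ.mono hjk) le_rfl
  have hGm : ∀ k, Measurable[ℱ k] (G (k + 1)) := by
    intro k
    refine measurable_const.add (Finset.measurable_sum _ fun j hj => ?_)
    exact (hgm j k (by simpa [Nat.lt_succ_iff] using hj)).pow_const 2
  -- The exponent lies above 1/2, so the normalized weights g/b are square summable, and below 1, so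
  -- the resulting bound of order G^(3/4) is dominated by the drift -G. Using G at time k + 1 keeps
  -- the weights predictable, since it involves g only up to index k.
  set b : ℕ → Ω → ℝ := fun n x => G n x ^ (3 / 4 : ℝ) with hb
  have hbpos : ∀ n x, 0 < b n x := fun n x => Real.rpow_pos_of_pos (by linarith [hG1 n x]) _
  set a : ℕ → Ω → ℝ := fun k x => g k x / b (k + 1) x with ha
  have ham : ∀ k, Measurable[ℱ k] (a k) := fun k => (hg k).div ((hGm k).pow_const _)
  have hasq : ∀ k x, a k x ^ 2 = (G (k + 1) x - G k x) * G (k + 1) x ^ (-(3 / 2) : ℝ) := by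
    intro k x
    have : b (k + 1) x ^ 2 = G (k + 1) x ^ (3 / 2 : ℝ) := by
      rw [hb, ← Real.rpow_natCast, ← Real.rpow_mul (by linarith [hG1 (k + 1) x])]
      norm_num
    rw [ha, div_pow, this, hGsucc, add_sub_cancel_left, Real.rpow_neg, div_eq_mul_inv]
    linarith [hG1 k x, sq_nonneg (g k x)]
  have hasum : ∀ n x, ∑ k ∈ Finset.range n, a k x ^ 2 ≤ 2 := by
    intro n x
    simp_rw [hasq]
    have := sum_sub_mul_rpow_neg_le (hGmono x) (hG0 x) (s := 3 / 2) (by norm_num) n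
    norm_num at this ⊢
    exact this
  have habs : ∀ k x, |a k x| ≤ 2 := by
    intro k x
    have h1 : a k x ^ 2 ≤ 2 :=
      (Finset.single_le_sum (f := fun k => a k x ^ 2) (fun _ _ => sq_nonneg _)
        (Finset.self_mem_range_succ k)).trans (hasum (k + 1) x)
    nlinarith [sq_abs (a k x), abs_nonneg (a k x)]
  have hwm : ∀ k, Measurable (w (k + 1)) := fun k => (h.measurable k).mono (ℱ.le _) le_rfl
  have ham' : ∀ k, Measurable (a k) := fun k => (ham k).mono (ℱ.le k) le_rfl
  have hX2 : ∀ k, MemLp (fun x => a k x * w (k + 1) x) 2 μ := fun k =>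
    (h.memLp k).of_le_mul (c := 2) ((ham' k).mul (hwm k)).aestronglyMeasurable
      (ae_of_all _ fun x => by
        rw [norm_mul]
        exact mul_le_mul_of_nonneg_right (habs k x) (norm_nonneg _))
  have hbound := ae_exists_abs_sum_le (ℱ := ℱ) (μ := μ) (X := fun k x => a k x * w (k + 1) x)
    (K := N * 2)
    (fun k => ((ham k).mono (ℱ.mono (Nat.le_succ k)) le_rfl).mul (h.measurable k)) hX2
    (fun k => by
      have h1 := condExp_mul_of_stronglyMeasurable_left (ham k).stronglyMeasurable
        ((hX2 k).integrable one_le_two) (h.integrable k)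
      refine h1.trans ?_
      filter_upwards [h.condExp_eq k] with x hx
      simp [hx])
    (fun n => by
      have h1 : ∀ k, ENNReal.ofReal (∫ x, (a k x * w (k + 1) x) ^ 2 ∂μ) ≤
          ENNReal.ofReal N * ∫⁻ x, ENNReal.ofReal (a k x ^ 2) ∂μ := by
        intro k
        rw [ofReal_integral_eq_lintegral_ofReal (hX2 k).integrable_sq
          (ae_of_all _ fun x => sq_nonneg _)]
        simp_rw [mul_pow]
        simp_rw [fun x => ENNReal.ofReal_mul (q := w (k + 1) x ^ 2) (sq_nonneg (a k x))]
        exact h.lintegral_mul_sq_le k ((ham k).pow_const 2).ennreal_ofReal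
      rw [← ENNReal.ofReal_le_ofReal_iff (by positivity),
        ENNReal.ofReal_sum_of_nonneg fun k _ => integral_nonneg fun x => sq_nonneg _]
      refine (Finset.sum_le_sum fun k _ => h1 k).trans ?_
      rw [← Finset.mul_sum, ENNReal.ofReal_mul hN]
      exact mul_le_mul_right (sum_lintegral_ofReal_le (fun k => (ham' k).pow_const 2)
        (fun k x => sq_nonneg _) (fun n x => hasum n x) n) _)
  filter_upwards [hbound] with x ⟨C, hC⟩
  have hC0 : 0 ≤ C := (abs_nonneg _).trans (hC 0)
  -- With t = G^(1/4), summation by parts bounds the expression by 4C t³ - t⁴ + 1, and 4C t³ ≤ t⁴ +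
  -- (4C)⁴ whichever of t and 4C is larger.
  refine ⟨(4 * C) ^ 4 + 1, fun n => ?_⟩
  have h1 := abs_sum_mul_le (b := fun n => b n x) (x := fun k => a k x * w (k + 1) x)
    (fun i j hij => Real.rpow_le_rpow (by linarith [hG1 i x]) (hGmono x hij) (by norm_num))
    (hbpos 0 x).le hC n
  have h2 : ∀ k, b (k + 1) x * (a k x * w (k + 1) x) = g k x * w (k + 1) x := by
    intro k
    rw [← mul_assoc, ha]
    congr 1
    exact mul_div_cancel₀ _ (hbpos _ _).ne'
  simp_rw [h2] at h1
  have h3 : ∑ k ∈ Finset.range n, g k x ^ 2 = G n x - 1 := by simp [hG]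
  rw [h3]
  have h4 := (le_abs_self _).trans h1
  set t := G n x ^ (1 / 4 : ℝ) with ht
  have ht0 : 0 ≤ t := Real.rpow_nonneg (by linarith [hG1 n x]) _
  have hbt : b n x = t ^ 3 := by
    rw [ht, ← Real.rpow_natCast, ← Real.rpow_mul (by linarith [hG1 n x])]
    norm_num [hb]
  have hGt : G n x = t ^ 4 := by
    rw [ht, ← Real.rpow_natCast, ← Real.rpow_mul (by linarith [hG1 n x])]
    norm_num
  simp only [hbt] at h4
  rw [hGt]
  have h5 : 4 * C * t ^ 3 ≤ t ^ 4 + (4 * C) ^ 4 := by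
    rcases le_total (4 * C) t with h6 | h6
    · nlinarith [pow_nonneg ht0 3, pow_nonneg (by positivity : 0 ≤ 4 * C) 4]
    · have : t ^ 3 ≤ (4 * C) ^ 3 := pow_le_pow_left₀ ht0 h6 3
      nlinarith [pow_nonneg ht0 4]
  linarith

end Martingale

/-! ### Measurability of the least squares quantities -/

section LeastSquaresMeasurability

variable {X ι : Type*} [Fintype ι] [DecidableEq ι] {mX : MeasurableSpace X}

lemma measurable_dotProduct {f g : X → ι → ℝ} (hf : Measurable f) (hg : Measurable g) :
    Measurable fun x => f x ⬝ᵥ g x := by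
  simp only [dotProduct]
  exact Finset.measurable_sum _ fun i _ =>
    ((measurable_pi_apply i).comp hf).mul ((measurable_pi_apply i).comp hg)

lemma measurable_mulVec {M : X → Matrix ι ι ℝ} {g : X → ι → ℝ}
    (hM : ∀ i j, Measurable fun x => M x i j) (hg : Measurable g) :
    Measurable fun x => M x *ᵥ g x :=
  measurable_pi_lambda _ fun i => measurable_dotProduct (measurable_pi_lambda _ (hM i)) hg

lemma measurable_matrix_mul {M M' : X → Matrix ι ι ℝ} (hM : ∀ i j, Measurable fun x => M x i j)
    (hM' : ∀ i j, Measurable fun x => M' x i j) (i j : ι) :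
    Measurable fun x => (M x * M' x) i j := by
  simp only [mul_apply]
  exact Finset.measurable_sum _ fun l _ => (hM i l).mul (hM' l j)

lemma measurable_gain {M : X → Matrix ι ι ℝ} {g : X → ι → ℝ}
    (hM : ∀ i j, Measurable fun x => M x i j) (hg : Measurable g) :
    Measurable fun x => gain (M x) (g x) :=
  ((measurable_dotProduct hg (measurable_mulVec hM hg)).const_add 1).inv

variable {φ : ℕ → X → ι → ℝ} {w : ℕ → X → ℝ} {α : ℝ}

lemma measurable_covMatrix {k : ℕ} (hφ : ∀ t < k, Measurable (φ t)) (i j : ι) :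
    Measurable fun x => covMatrix α (fun t => φ t x) k i j := by
  induction k generalizing i j with
  | zero => exact measurable_const
  | succ k ih =>
    have h := ih fun t ht => hφ t (by omega)
    have hk := hφ k (by omega)
    have hV : ∀ i j, Measurable fun x => vecMulVec (φ k x) (φ k x) i j := fun i j =>
      ((measurable_pi_apply i).comp hk).mul ((measurable_pi_apply j).comp hk)
    simp only [covMatrix, Matrix.sub_apply, Matrix.smul_apply, smul_eq_mul]
    exact (h i j).sub ((measurable_gain h hk).mul
      (measurable_matrix_mul (measurable_matrix_mul h hV) h i j))

lemma measurable_relLeverage {k : ℕ} (hφ : ∀ t ≤ k, Measurable (φ t)) :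
    Measurable fun x => relLeverage α (fun t => φ t x) k := by
  have h := fun i j => measurable_covMatrix (α := α) (φ := φ) (k := k)
    (fun t ht => hφ t ht.le) i j
  exact (measurable_gain h (hφ k le_rfl)).mul
    (measurable_dotProduct (hφ k le_rfl) (measurable_mulVec h (hφ k le_rfl)))

lemma measurable_noiseSum {k : ℕ} (hφ : ∀ t < k, Measurable (φ t))
    (hw : ∀ t < k, Measurable (w (t + 1))) :
    Measurable fun x => noiseSum (fun t => φ t x) (fun t => w t x) k := by
  simp only [noiseSum]
  exact Finset.measurable_sum _ fun t ht =>
    (hw t (Finset.mem_range.1 ht)).smul (hφ t (Finset.mem_range.1 ht))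

lemma measurable_crossForm {k : ℕ} (hφ : ∀ t ≤ k, Measurable (φ t))
    (hw : ∀ t < k, Measurable (w (t + 1))) (v : ι → ℝ) :
    Measurable fun x => crossForm α (fun t => φ t x) (fun t => w t x) v k :=
  measurable_dotProduct (hφ k le_rfl) (measurable_mulVec
    (measurable_covMatrix fun t ht => hφ t ht.le)
    ((measurable_noiseSum (fun t ht => hφ t ht.le) hw).const_add v))

lemma measurable_quadForm {k : ℕ} (hφ : ∀ t < k, Measurable (φ t))
    (hw : ∀ t < k, Measurable (w (t + 1))) (v : ι → ℝ) :
    Measurable fun x => quadForm α (fun t => φ t x) (fun t => w t x) v k := by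
  have h := (measurable_noiseSum hφ hw).const_add v
  exact measurable_dotProduct h (measurable_mulVec (measurable_covMatrix hφ) h)

lemma measurable_leverageSum {k : ℕ} (hφ : ∀ t < k, Measurable (φ t)) :
    Measurable fun x => leverageSum α (fun t => φ t x) k :=
  measurable_const.add (Finset.measurable_sum _ fun _ ht =>
    measurable_relLeverage fun s hs => hφ s (hs.trans_lt (Finset.mem_range.1 ht)))

end LeastSquaresMeasurability

/-! ### Growth of weighted sums of squared noise -/

section WeightedSquares

variable {Ω : Type*} [mΩ : MeasurableSpace Ω] {μ : Measure Ω} [IsProbabilityMeasure μ]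
  {ℱ : Filtration ℕ mΩ} {w : ℕ → Ω → ℝ} {β N : ℝ}

lemma IsBoundedMDS.measurable' (h : IsBoundedMDS μ ℱ w β N) (k : ℕ) : Measurable (w (k + 1)) :=
  (h.measurable k).mono (ℱ.le _) le_rfl

/-- Weights `d_k` in `[0, 1]` that are predictable, with `D_n = 1 + ∑_{k < n} d_k`. -/
structure IsPredictableWeight (ℱ : Filtration ℕ mΩ) (d D : ℕ → Ω → ℝ) : Prop where
  measurable : ∀ k, Measurable[ℱ k] (d k)
  nonneg : ∀ k x, 0 ≤ d k x
  le_one : ∀ k x, d k x ≤ 1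
  zero : ∀ x, D 0 x = 1
  succ : ∀ k x, D (k + 1) x = D k x + d k x

variable {d D : ℕ → Ω → ℝ}

lemma IsPredictableWeight.mono (h : IsPredictableWeight ℱ d D) (x : Ω) :
    Monotone fun n => D n x :=
  monotone_nat_of_le_succ fun n => by rw [h.succ]; linarith [h.nonneg n x]

lemma IsPredictableWeight.one_le (h : IsPredictableWeight ℱ d D) (n : ℕ) (x : Ω) :
    1 ≤ D n x := by
  rw [← h.zero x]; exact h.mono x (Nat.zero_le n)

lemma IsPredictableWeight.measurable_succ (h : IsPredictableWeight ℱ d D) (k : ℕ) :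
    Measurable[ℱ k] (D (k + 1)) := by
  have hD : ∀ n x, D n x = 1 + ∑ j ∈ Finset.range n, d j x := by
    intro n x
    induction n with
    | zero => simp [h.zero]
    | succ n ih => rw [h.succ, ih, Finset.sum_range_succ, add_assoc]
  have : D (k + 1) = fun x => 1 + ∑ j ∈ Finset.range (k + 1), d j x := funext (hD (k + 1))
  rw [this]
  refine measurable_const.add (Finset.measurable_sum _ fun j hj => ?_)
  exact (h.measurable j).mono (ℱ.mono (by simpa [Nat.lt_succ_iff] using hj)) le_rfl

/-- Dividing d_k by `logScale` of D_{k+1} makes the weights summable, so the normalized sum has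
finite expectation and is almost surely bounded. Monotonicity of the scale then restores the factor
at time n. -/
lemma IsBoundedMDS.ae_exists_sum_sq_le_logScale (h : IsBoundedMDS μ ℱ w 2 N)
    (hd : IsPredictableWeight ℱ d D) {κ : ℝ} (hκ : 1 < κ) :
    ∀ᵐ x ∂μ, ∃ C : ℝ, ∀ n, ∑ k ∈ Finset.range n, d k x * w (k + 1) x ^ 2 ≤
      C * logScale κ (D n x) := by
  have hD0 : ∀ n x, 0 ≤ D n x := fun n x => zero_le_one.trans (hd.one_le n x)
  set c : ℕ → Ω → ℝ := fun k x => d k x * (logScale κ (D (k + 1) x))⁻¹ with hc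
  have hc0 : ∀ k x, 0 ≤ c k x := fun k x =>
    mul_nonneg (hd.nonneg k x) (inv_nonneg.2 (logScale_pos (hD0 _ _)).le)
  have hcm : ∀ k, Measurable[ℱ k] (c k) := by
    intro k
    have hD := hd.measurable_succ k
    refine (hd.measurable k).mul (Measurable.inv ?_)
    exact (hD.const_add _).mul ((hD.const_add _).log.pow_const _)
  have hcm' : ∀ k, Measurable (c k) := fun k => (hcm k).mono (ℱ.le k) le_rfl
  have hcs : ∀ n x, ∑ k ∈ Finset.range n, c k x ≤ 1 / (κ - 1) := by
    intro n x
    have := sum_sub_div_logScale_le (hd.mono x) (hD0 0 x) hκ n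
    simpa [hc, hd.succ] using this
  have hae := ae_exists_sum_le (μ := μ) (Y := fun k x => c k x * w (k + 1) x ^ 2)
    (K := ENNReal.ofReal N * ENNReal.ofReal (1 / (κ - 1)))
    (fun k => (hcm' k).mul ((h.measurable' k).pow_const 2))
    (fun k x => mul_nonneg (hc0 k x) (sq_nonneg _)) (by finiteness) (fun n => by
      refine le_trans (Finset.sum_le_sum fun k _ => ?_) ((Finset.mul_sum _ _ _).symm.le.trans
        (mul_le_mul_right (sum_lintegral_ofReal_le (μ := μ) hcm' hc0 hcs n) _))
      simp_rw [fun x => ENNReal.ofReal_mul (q := w (k + 1) x ^ 2) (hc0 k x)]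
      exact h.lintegral_mul_sq_le k (hcm k).ennreal_ofReal)
  filter_upwards [hae] with x ⟨C, hC⟩
  refine ⟨C, fun n => ?_⟩
  rw [mul_comm]
  refine le_trans ?_ (mul_le_mul_of_nonneg_left (hC n) (logScale_pos (hD0 n x)).le)
  rw [Finset.mul_sum]
  refine Finset.sum_le_sum fun k hk => ?_
  have hle : logScale κ (D (k + 1) x) ≤ logScale κ (D n x) :=
    logScale_mono (by linarith) (hD0 _ _) (hd.mono x (Finset.mem_range.1 hk))
  have hp := logScale_pos (κ := κ) (hD0 (k + 1) x)
  have h1 : d k x = logScale κ (D (k + 1) x) * c k x := by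
    simp only [hc]; field_simp
  calc d k x * w (k + 1) x ^ 2 = logScale κ (D (k + 1) x) * (c k x * w (k + 1) x ^ 2) := by
        rw [h1]; ring
    _ ≤ _ := mul_le_mul_of_nonneg_right hle (mul_nonneg (hc0 k x) (sq_nonneg _))

/-- The conditional variance is at most the conditional second moment. -/
lemma integral_sub_condExp_sq_le {m : MeasurableSpace Ω} (hm : m ≤ mΩ) {U : Ω → ℝ}
    (hU : MemLp U 2 μ) : ∫ x, (U x - (μ[U | m]) x) ^ 2 ∂μ ≤ ∫ x, U x ^ 2 ∂μ := by
  have hint : Integrable ((U - μ[U | m]) ^ 2) μ :=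
    (hU.sub (hU.condExp (m := m) one_le_two)).integrable_sq
  have h1 := setIntegral_condVar (hm := hm) hint MeasurableSet.univ
  rw [setIntegral_univ, setIntegral_univ] at h1
  have h2 : ∫ x, (Var[U; μ | m]) x ∂μ ≤ ∫ x, (μ[U ^ 2 | m]) x ∂μ :=
    integral_mono_ae integrable_condVar integrable_condExp (condVar_ae_le_condExp_sq hm hU)
  rw [integral_condExp hm] at h2
  simpa using h1.symm.le.trans h2

/-- Both sides are ℱ_k-measurable, so it suffices to compare integrals over ℱ_k-sets. -/
lemma IsBoundedMDS.condExp_le (h : IsBoundedMDS μ ℱ w 2 N) (hN : 0 ≤ N) (k : ℕ) {U ρ : Ω → ℝ}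
    (hρ : Measurable[ℱ k] ρ) (hρ0 : ∀ x, 0 ≤ ρ x) (hρ1 : ∀ x, ρ x ≤ 1) (hU : Integrable U μ)
    (hU0 : ∀ x, 0 ≤ U x) (hle : ∀ x, U x ≤ ρ x * w (k + 1) x ^ 2) :
    μ[U | ℱ k] ≤ᵐ[μ] fun x => N * ρ x := by
  have hρi : Integrable ρ μ := Integrable.of_bound
    (hρ.mono (ℱ.le k) le_rfl).aestronglyMeasurable 1
    (ae_of_all _ fun x => by rw [Real.norm_of_nonneg (hρ0 x)]; exact hρ1 x)
  have hNρ : StronglyMeasurable[ℱ k] fun x => N * ρ x := (hρ.const_mul N).stronglyMeasurable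
  refine ae_le_of_ae_le_trim (hm := ℱ.le k) ?_
  refine ae_le_of_forall_setIntegral_le (integrable_condExp.trim _ stronglyMeasurable_condExp)
    ((hρi.const_mul N).trim _ hNρ) fun A hA _ => ?_
  rw [← setIntegral_trim (ℱ.le k) stronglyMeasurable_condExp hA,
    ← setIntegral_trim (ℱ.le k) hNρ hA, setIntegral_condExp (ℱ.le k) hU hA]
  have hA' := ℱ.le k _ hA
  rw [← ENNReal.ofReal_le_ofReal_iff
    (integral_nonneg fun x => mul_nonneg hN (hρ0 x)),
    ofReal_integral_eq_lintegral_ofReal hU.integrableOn (ae_of_all _ hU0),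
    ofReal_integral_eq_lintegral_ofReal (hρi.const_mul N).integrableOn
      (ae_of_all _ fun x => mul_nonneg hN (hρ0 x))]
  have h1 := h.lintegral_mul_sq_le k (g := A.indicator fun x => ENNReal.ofReal (ρ x))
    (hρ.ennreal_ofReal.indicator hA)
  calc ∫⁻ x in A, ENNReal.ofReal (U x) ∂μ
      ≤ ∫⁻ x in A, ENNReal.ofReal (ρ x) * ENNReal.ofReal (w (k + 1) x ^ 2) ∂μ := by
        refine lintegral_mono fun x => ?_
        rw [← ENNReal.ofReal_mul (hρ0 x)]
        exact ENNReal.ofReal_le_ofReal (hle x)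
    _ = ∫⁻ x, A.indicator (fun x => ENNReal.ofReal (ρ x)) x
          * ENNReal.ofReal (w (k + 1) x ^ 2) ∂μ := by
        rw [← lintegral_indicator hA']
        refine lintegral_congr fun x => ?_
        by_cases hx : x ∈ A <;> simp [hx]
    _ ≤ _ := h1
    _ = _ := by
        rw [lintegral_indicator hA']
        simp_rw [ENNReal.ofReal_mul hN]
        rw [lintegral_const_mul' _ _ ENNReal.ofReal_ne_top]

/-- The moments beyond order two remove the logarithm. The normalized terms Z = d w²/D_{k+1} are cut
at level 1: the overshoots are summable, the centered truncations form an L²-bounded martingale, and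
the compensators are of order d/D. Multiplying back by the monotone D gives three contributions of
order D_n. -/
lemma IsBoundedMDS.ae_exists_sum_sq_le (h : IsBoundedMDS μ ℱ w β N) (hN : 0 ≤ N) (hβ : 2 < β)
    (hβ4 : β ≤ 4) (hd : IsPredictableWeight ℱ d D) :
    ∀ᵐ x ∂μ, ∃ C : ℝ, ∀ n, ∑ k ∈ Finset.range n, d k x * w (k + 1) x ^ 2 ≤ C * D n x := by
  have h2 : IsBoundedMDS μ ℱ w 2 (N + 1) := h.mono_exponent hN zero_le_two hβ.le
  have hDpos : ∀ n x, 0 < D n x := fun n x => zero_lt_one.trans_le (hd.one_le n x)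
  -- Chosen so that Z^s = ρ^s |w|^β. Convergence of ∑ ρ^s needs s > 1; controlling truncated squares
  -- by Z^s needs s ≤ 2.
  set s := β / 2 with hs
  have hs1 : 1 < s := by rw [hs]; linarith
  have hs2 : s ≤ 2 := by rw [hs]; linarith
  set ρ : ℕ → Ω → ℝ := fun k x => d k x / D (k + 1) x with hρ
  have hρ0 : ∀ k x, 0 ≤ ρ k x := fun k x => div_nonneg (hd.nonneg k x) (hDpos _ x).le
  have hρ1 : ∀ k x, ρ k x ≤ 1 := fun k x =>
    div_le_one_of_le₀ ((hd.le_one k x).trans (hd.one_le _ x)) (hDpos _ x).le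
  have hρm : ∀ k, Measurable[ℱ k] (ρ k) := fun k => (hd.measurable k).div (hd.measurable_succ k)
  have hρsm : ∀ k, Measurable[ℱ k] fun x => ρ k x ^ s := fun k => (hρm k).pow_const _
  have hρs : ∀ n x, ∑ k ∈ Finset.range n, ρ k x ^ s ≤ 1 / (s - 1) := by
    intro n x
    refine le_trans (Finset.sum_le_sum fun k _ => ?_)
      (sum_sub_mul_rpow_neg_le (hd.mono x) (hd.zero x) hs1 n)
    simp only [hρ]
    rw [Real.div_rpow (hd.nonneg k x) (hDpos _ x).le, Real.rpow_neg (hDpos _ x).le,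
      div_eq_mul_inv, hd.succ, add_sub_cancel_left]
    refine mul_le_mul_of_nonneg_right ?_ (inv_nonneg.2 (Real.rpow_nonneg
      (by linarith [hd.nonneg k x, hDpos k x]) _))
    calc d k x ^ s ≤ d k x ^ (1 : ℝ) :=
          Real.rpow_le_rpow_of_exponent_ge' (hd.nonneg k x) (hd.le_one k x) zero_le_one hs1.le
      _ = d k x := Real.rpow_one _
  set Z : ℕ → Ω → ℝ := fun k x => ρ k x * w (k + 1) x ^ 2 with hZ
  have hZ0 : ∀ k x, 0 ≤ Z k x := fun k x => mul_nonneg (hρ0 k x) (sq_nonneg _)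
  have hZs : ∀ k x, Z k x ^ s = ρ k x ^ s * |w (k + 1) x| ^ β := by
    intro k x
    simp only [hZ]
    rw [Real.mul_rpow (hρ0 k x) (sq_nonneg _), ← sq_abs, ← Real.rpow_natCast,
      ← Real.rpow_mul (abs_nonneg _), hs]
    congr 2
    push_cast
    ring
  have hZm : ∀ k, Measurable (Z k) := fun k =>
    ((hρm k).mono (ℱ.le k) le_rfl).mul ((h.measurable' k).pow_const 2)
  have hZsum : ∀ n, ∑ k ∈ Finset.range n, ∫⁻ x, ENNReal.ofReal (Z k x ^ s) ∂μ ≤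
      ENNReal.ofReal (N * (1 / (s - 1))) := by
    intro n
    rw [ENNReal.ofReal_mul hN]
    refine le_trans (Finset.sum_le_sum fun k _ => ?_) ((Finset.mul_sum _ _ _).symm.le.trans
      (mul_le_mul_right (sum_lintegral_ofReal_le (μ := μ) (c := fun k x => ρ k x ^ s)
        (fun k => (hρsm k).mono (ℱ.le k) le_rfl)
        (fun k x => Real.rpow_nonneg (hρ0 k x) _) hρs n) _))
    simp_rw [hZs, fun x => ENNReal.ofReal_mul (q := |w (k + 1) x| ^ β)
      (Real.rpow_nonneg (hρ0 k x) s)]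
    exact h.lintegral_mul_le k (hρsm k).ennreal_ofReal
  -- One quantity z^s controls both the square of the truncation and the overshoot, so the single
  -- bound `hZsum` serves twice.
  have hsmall : ∀ z : ℝ, 0 ≤ z → min z 1 ^ 2 ≤ z ^ s ∧ max (z - 1) 0 ≤ z ^ s := by
    intro z hz
    rcases le_total z 1 with h1 | h1
    · refine ⟨?_, ?_⟩
      · rw [min_eq_left h1, ← Real.rpow_natCast]
        exact Real.rpow_le_rpow_of_exponent_ge' hz h1 (by linarith) (by exact_mod_cast hs2)
      · rw [max_eq_right (by linarith)]
        exact Real.rpow_nonneg hz _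
    · have h3 : z ≤ z ^ s := by
        simpa using Real.rpow_le_rpow_of_exponent_le h1 hs1.le
      refine ⟨?_, ?_⟩
      · rw [min_eq_right h1]
        linarith
      · rw [max_eq_left (by linarith)]
        linarith
  set U : ℕ → Ω → ℝ := fun k x => min (Z k x) 1 with hU
  have hUm : ∀ k, Measurable[ℱ (k + 1)] (U k) := fun k =>
    ((((hρm k).mono (ℱ.mono (Nat.le_succ k)) le_rfl).mul
      ((h.measurable k).pow_const 2)).min measurable_const)
  have hU0 : ∀ k x, 0 ≤ U k x := fun k x => le_min (hZ0 k x) zero_le_one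
  have hU2 : ∀ k, MemLp (U k) 2 μ := fun k => MemLp.of_bound
    ((hUm k).mono (ℱ.le _) le_rfl).aestronglyMeasurable 1
    (ae_of_all _ fun x => by rw [Real.norm_of_nonneg (hU0 k x)]; exact min_le_right _ _)
  have hUi : ∀ k, Integrable (U k) μ := fun k => (hU2 k).integrable one_le_two
  have hbig := ae_exists_sum_le (μ := μ) (Y := fun k x => max (Z k x - 1) 0)
    (K := ENNReal.ofReal (N * (1 / (s - 1))))
    (fun k => ((hZm k).sub_const 1).max measurable_const) (fun k x => le_max_right _ _)
    ENNReal.ofReal_ne_top (fun n => (Finset.sum_le_sum fun k _ => lintegral_mono fun x =>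
      ENNReal.ofReal_le_ofReal (hsmall _ (hZ0 k x)).2).trans (hZsum n))
  have hcen := ae_exists_abs_sum_le (μ := μ) (ℱ := ℱ) (X := fun k => U k - μ[U k | ℱ k])
    (K := N * (1 / (s - 1)))
    (fun k => (hUm k).sub (stronglyMeasurable_condExp.measurable.mono (ℱ.mono (Nat.le_succ k))
      le_rfl))
    (fun k => (hU2 k).sub ((hU2 k).condExp one_le_two))
    (fun k => by
      refine (condExp_sub (hUi k) integrable_condExp _).trans ?_
      rw [condExp_of_stronglyMeasurable (ℱ.le k) stronglyMeasurable_condExp integrable_condExp,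
        sub_self])
    (fun n => by
      rw [← ENNReal.ofReal_le_ofReal_iff (mul_nonneg hN (by
          rw [one_div]; exact inv_nonneg.2 (by linarith))),
        ENNReal.ofReal_sum_of_nonneg fun k _ => integral_nonneg fun x => sq_nonneg _]
      refine (Finset.sum_le_sum fun k _ => ?_).trans (hZsum n)
      refine (ENNReal.ofReal_le_ofReal (integral_sub_condExp_sq_le (ℱ.le k) (hU2 k))).trans ?_
      rw [ofReal_integral_eq_lintegral_ofReal (hU2 k).integrable_sq
        (ae_of_all _ fun x => sq_nonneg _)]
      exact lintegral_mono fun x => ENNReal.ofReal_le_ofReal (hsmall _ (hZ0 k x)).1)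
  have hcond : ∀ᵐ x ∂μ, ∀ k, (μ[U k | ℱ k]) x ≤ (N + 1) * ρ k x := ae_all_iff.2 fun k =>
    h2.condExp_le (by linarith) k (hρm k) (hρ0 k) (hρ1 k) (hUi k) (hU0 k)
      fun x => min_le_left _ _
  filter_upwards [hbig, hcen, hcond] with x ⟨C₁, hC₁⟩ ⟨C₂, hC₂⟩ hc
  refine ⟨C₁ + 2 * C₂ + (N + 1), fun n => ?_⟩
  -- Overshoot, martingale part and compensator, in this order; the factor D_{k+1} undoes the
  -- normalization.
  have hsplit : ∀ k, d k x * w (k + 1) x ^ 2 =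
      D (k + 1) x * max (Z k x - 1) 0 + D (k + 1) x * (U k - μ[U k | ℱ k]) x
        + D (k + 1) x * (μ[U k | ℱ k]) x := by
    intro k
    have h3 : max (Z k x - 1) 0 + U k x = Z k x := by
      simp only [hU]
      rcases le_total (Z k x) 1 with h1 | h1
      · rw [min_eq_left h1, max_eq_right (by linarith)]; ring
      · rw [min_eq_right h1, max_eq_left (by linarith)]; ring
    have h4 : D (k + 1) x * Z k x = d k x * w (k + 1) x ^ 2 := by
      simp only [hZ, hρ]
      have := (hDpos (k + 1) x).ne'
      field_simp
    rw [← h4, Pi.sub_apply]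
    linear_combination -(D (k + 1) x) * h3
  simp_rw [hsplit]
  rw [Finset.sum_add_distrib, Finset.sum_add_distrib, add_mul, add_mul]
  refine add_le_add (add_le_add ?_ ?_) ?_
  · rw [mul_comm C₁]
    refine le_trans ?_ (mul_le_mul_of_nonneg_left (hC₁ n) (hDpos n x).le)
    rw [Finset.mul_sum]
    exact Finset.sum_le_sum fun k hk => mul_le_mul_of_nonneg_right
      (hd.mono x (Finset.mem_range.1 hk)) (le_max_right _ _)
  · exact (le_abs_self _).trans (abs_sum_mul_le (b := fun n => D n x) (hd.mono x)
      (hDpos 0 x).le hC₂ n)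
  · calc _ ≤ ∑ k ∈ Finset.range n, (N + 1) * (D (k + 1) x - D k x) := by
          refine Finset.sum_le_sum fun k _ => ?_
          refine (mul_le_mul_of_nonneg_left (hc k) (hDpos _ x).le).trans_eq ?_
          simp only [hρ, hd.succ]
          have : D k x + d k x ≠ 0 := by rw [← hd.succ]; exact (hDpos _ x).ne'
          field_simp
          ring
      _ = (N + 1) * (D n x - D 0 x) := by
          rw [← Finset.mul_sum, Finset.sum_range_sub fun k => D k x]
      _ ≤ (N + 1) * D n x := mul_le_mul_of_nonneg_left (by rw [hd.zero]; linarith) (by linarith)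

end WeightedSquares

/-! ### Almost sure growth of self-normalized noise sums -/

section LeastSquaresBound

/-- The growth rate of the self-normalized noise sum: linear when moments of order larger than
two are available, and linear up to a power of the logarithm otherwise. -/
def growthScale (β κ x : ℝ) : ℝ := if 2 < β then x else logScale κ x

lemma one_le_growthScale {β κ x : ℝ} (hκ : 0 ≤ κ) (hx : 1 ≤ x) : 1 ≤ growthScale β κ x := by
  unfold growthScale
  split_ifs
  · exact hx
  · have h1 := one_le_log_exp_add (zero_le_one.trans hx)
    exact one_le_mul_of_one_le_of_one_le (by linarith [Real.exp_pos 1]) (Real.one_le_rpow h1 hκ)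

lemma measurable_growthScale (β κ : ℝ) : Measurable (growthScale β κ) := by
  unfold growthScale
  split_ifs
  · exact measurable_id
  · exact (measurable_id.const_add _).mul ((measurable_id.const_add _).log.pow_const _)

/-- A constant factor inside the logarithm costs only a constant factor outside, so the bound on the
leverage sum passes through the scale. -/
lemma logScale_mul_le {κ C l : ℝ} (hκ : 0 ≤ κ) (hC : 1 ≤ C) (hl : 1 ≤ l) :
    logScale κ (C * l) ≤
      (C + Real.exp 1) * (1 + Real.log C) ^ κ * (l * Real.log (Real.exp 1 + l) ^ κ) := by
  have h1 := one_le_log_exp_add (zero_le_one.trans hl)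
  have hlC := Real.log_nonneg hC
  have he := Real.exp_pos 1
  have hlog : Real.log (Real.exp 1 + C * l) ≤ (1 + Real.log C) * Real.log (Real.exp 1 + l) := by
    calc Real.log (Real.exp 1 + C * l) ≤ Real.log (C * (Real.exp 1 + l)) :=
          Real.log_le_log (by positivity) (by nlinarith)
      _ = Real.log C + Real.log (Real.exp 1 + l) := Real.log_mul (by positivity) (by positivity)
      _ ≤ _ := by nlinarith
  have hlog0 : 1 ≤ Real.log (Real.exp 1 + C * l) := one_le_log_exp_add (by positivity)
  calc logScale κ (C * l)
      ≤ ((C + Real.exp 1) * l) * ((1 + Real.log C) * Real.log (Real.exp 1 + l)) ^ κ :=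
        mul_le_mul (by nlinarith) (Real.rpow_le_rpow (by linarith) hlog hκ)
          (Real.rpow_nonneg (by linarith) _) (by positivity)
    _ = _ := by
        rw [Real.mul_rpow (by linarith) (by linarith)]
        ring

variable {ι : Type*} [Fintype ι] [DecidableEq ι]

lemma exists_growthScale_leverageSum_le {α κ β : ℝ} (hα : 0 < α) (hκ : 0 ≤ κ) :
    ∃ C : ℝ, ∀ (φ : ℕ → ι → ℝ) (k : ℕ), growthScale β κ (leverageSum α φ (k + 1)) ≤
      C * if 2 < β then Real.log (energy φ k) else
        Real.log (energy φ k) * Real.log (Real.exp 1 + Real.log (energy φ k)) ^ κ := by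
  obtain ⟨C, hC, h⟩ := exists_leverageSum_le (ι := ι) hα
  by_cases hβ : 2 < β
  · refine ⟨C, fun φ k => ?_⟩
    simpa [growthScale, hβ] using h φ k
  · refine ⟨(C + Real.exp 1) * (1 + Real.log C) ^ κ, fun φ k => ?_⟩
    simp only [growthScale, hβ, if_false]
    exact (logScale_mono hκ (zero_le_one.trans (one_le_leverageSum hα φ _)) (h φ k)).trans
      (logScale_mul_le hκ hC (one_le_log_energy φ k))

variable {Ω : Type*} [mΩ : MeasurableSpace Ω] {μ : Measure Ω} [IsProbabilityMeasure μ]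
  {ℱ : Filtration ℕ mΩ} {w : ℕ → Ω → ℝ} {β N κ α : ℝ} {φ : ℕ → Ω → ι → ℝ}

/-- Combines `quadForm_le_sum` with the two almost sure bounds: the transform with g = gain times
cross form is dominated by its drift, and the relative leverages are predictable weights in [0, 1].
-/
theorem IsBoundedMDS.ae_exists_quadForm_le (h : IsBoundedMDS μ ℱ w β N) (hN : 0 ≤ N)
    (hβ : 2 ≤ β) (hκ : 1 < κ) (hα : 0 < α) (hφ : ∀ k, Measurable[ℱ k] (φ k)) :
    ∀ᵐ x ∂μ, ∃ C : ℝ, ∀ n, quadForm α (fun t => φ t x) (fun t => w t x) 0 n ≤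
      C * growthScale β κ (leverageSum α (fun t => φ t x) n) := by
  have h2 : IsBoundedMDS μ ℱ w 2 (N + 1) := h.mono_exponent hN zero_le_two hβ
  have hφm : ∀ k, ∀ t ≤ k, Measurable[ℱ k] (φ t) := fun k t ht =>
    (hφ t).mono (ℱ.mono ht) le_rfl
  have hwm : ∀ k, ∀ t < k, Measurable[ℱ k] (w (t + 1)) := fun k t ht =>
    (h.measurable t).mono (ℱ.mono ht) le_rfl
  have hd : IsPredictableWeight ℱ (fun k x => relLeverage α (fun t => φ t x) k)
      (fun k x => leverageSum α (fun t => φ t x) k) :=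
    { measurable := fun k => measurable_relLeverage (hφm k)
      nonneg := fun k x => relLeverage_nonneg hα _ k
      le_one := fun k x => relLeverage_le_one hα _ k
      zero := fun x => by simp [leverageSum]
      succ := fun k x => leverageSum_succ α _ k }
  have hsq : ∀ᵐ x ∂μ, ∃ C : ℝ, ∀ n, ∑ k ∈ Finset.range n,
      relLeverage α (fun t => φ t x) k * w (k + 1) x ^ 2 ≤
        C * growthScale β κ (leverageSum α (fun t => φ t x) n) := by
    by_cases hβ2 : 2 < β
    · simp only [growthScale, hβ2, if_true]
      -- The truncation argument works for exponents in (2, 4]; larger moments are first lowered to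
      -- 4.
      exact (h.mono_exponent hN (β' := min β 4) (by positivity)
        (min_le_left _ _)).ae_exists_sum_sq_le (by linarith) (lt_min hβ2 (by norm_num)) (min_le_right _ _) hd
    · simp only [growthScale, hβ2, if_false]
      exact h2.ae_exists_sum_sq_le_logScale hd hκ
  have htr := h2.ae_exists_transform_le (by linarith)
    (g := fun k x => gain (covMatrix α (fun t => φ t x) k) (φ k x)
      * crossForm α (fun t => φ t x) (fun t => w t x) 0 k)
    (fun k => (measurable_gain (measurable_covMatrix fun t ht => hφm k t ht.le) (hφ k)).mul
      (measurable_crossForm (hφm k) (hwm k) 0))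
  filter_upwards [hsq, htr] with x ⟨C₁, h₁⟩ ⟨C₂, h₂⟩
  refine ⟨C₁ + |C₂|, fun n => ?_⟩
  have h3 := quadForm_le_sum hα (fun t => φ t x) (fun t => w t x) n
  have h4 := one_le_growthScale (β := β) (zero_le_one.trans hκ.le)
    (one_le_leverageSum hα (fun t => φ t x) n)
  have h5 := h₁ n
  have h6 := h₂ n
  have h7 : C₂ ≤ |C₂| * growthScale β κ (leverageSum α (fun t => φ t x) n) :=
    (le_abs_self _).trans (le_mul_of_one_le_right (abs_nonneg _) h4)
  rw [add_mul]
  linarith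

/-- Truncating a martingale difference sequence when its conditional moments exceed a level. -/
lemma IsMartingaleDifference.isBoundedMDS_indicator
    (h : IsMartingaleDifference μ ℱ w β) (hβ : 0 < β) (N : ℕ) :
    IsBoundedMDS μ ℱ (fun k => Set.indicator {x | ∀ j < k,
      (μ⁻[fun x => ENNReal.ofReal (|w (j + 1) x| ^ β) | ℱ j]) x ≤ N} (w k)) β N := by
  obtain ⟨hm, hi, hc, -⟩ := h
  set V : ℕ → Ω → ℝ≥0∞ := fun j => μ⁻[fun x => ENNReal.ofReal (|w (j + 1) x| ^ β) | ℱ j] with hV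
  -- Attached to w_{k+1}, the truncating event involves conditional moments only up to index k. It
  -- is therefore predictable and preserves the martingale difference property.
  have hB : ∀ k, MeasurableSet[ℱ k] {x | ∀ j < k + 1, V j x ≤ N} := by
    intro k
    have : {x | ∀ j < k + 1, V j x ≤ N} = ⋂ j ∈ Finset.range (k + 1), {x | V j x ≤ N} := by
      ext x; simp
    rw [this]
    refine Finset.measurableSet_biInter _ fun j hj => ?_
    refine ℱ.mono (show j ≤ k by simpa [Nat.lt_succ_iff] using hj) _ ?_
    exact measurableSet_le (measurable_condLExp _ _ _) measurable_const
  refine ⟨fun k => (hm k).indicator (ℱ.mono (Nat.le_succ k) _ (hB k)),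
    fun k => (hi k).indicator (ℱ.le k _ (hB k)), fun k => ?_, fun k A hA => ?_⟩
  · refine (condExp_indicator (hi k) (hB k)).trans ?_
    filter_upwards [hc k] with x hx
    by_cases hxB : x ∈ {x | ∀ j < k + 1, V j x ≤ N} <;> simp [Set.indicator, hx]
  · have hAB : MeasurableSet[ℱ k] (A ∩ {x | ∀ j < k + 1, V j x ≤ N}) := hA.inter (hB k)
    calc ∫⁻ x in A, ENNReal.ofReal
          (|Set.indicator {x | ∀ j < k + 1, V j x ≤ N} (w (k + 1)) x| ^ β) ∂μ
        = ∫⁻ x in A, Set.indicator {x | ∀ j < k + 1, V j x ≤ N}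
            (fun x => ENNReal.ofReal (|w (k + 1) x| ^ β)) x ∂μ := by
          refine lintegral_congr fun x => ?_
          by_cases hxB : x ∈ {x | ∀ j < k + 1, V j x ≤ N}
          · simp only [Set.indicator_of_mem hxB]
          · simp only [Set.indicator_of_notMem hxB]
            simp [hβ.ne']
      _ = ∫⁻ x in A ∩ {x | ∀ j < k + 1, V j x ≤ N},
            ENNReal.ofReal (|w (k + 1) x| ^ β) ∂μ := by
          rw [setLIntegral_indicator (ℱ.le k _ (hB k)), Set.inter_comm]
      _ = ∫⁻ x in A ∩ {x | ∀ j < k + 1, V j x ≤ N}, V k x ∂μ :=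
          (setLIntegral_condLExp (ℱ.le k) μ _ hAB).symm
      _ ≤ ∫⁻ _ in A ∩ {x | ∀ j < k + 1, V j x ≤ N}, (N : ℝ≥0∞) ∂μ :=
          setLIntegral_mono' (ℱ.le k _ hAB) fun x hx => hx.2 k (Nat.lt_succ_self k)
      _ ≤ ENNReal.ofReal N * μ A := by
          rw [setLIntegral_const, ENNReal.ofReal_natCast]
          gcongr
          exact Set.inter_subset_left

/-- Localization: almost every path has all its conditional moments below some integer N, and along
that path the noise truncated at N is the noise itself. -/
theorem IsMartingaleDifference.ae_exists_quadForm_le (h : IsMartingaleDifference μ ℱ w β)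
    (hβ : 2 ≤ β) (hκ : 1 < κ) (hα : 0 < α) (hφ : ∀ k, Measurable[ℱ k] (φ k)) :
    ∀ᵐ x ∂μ, ∃ C : ℝ, ∀ n, quadForm α (fun t => φ t x) (fun t => w t x) 0 n ≤
      C * growthScale β κ (leverageSum α (fun t => φ t x) n) := by
  have hN : ∀ᵐ x ∂μ, ∀ N : ℕ, _ := ae_all_iff.2 fun N : ℕ =>
    (h.isBoundedMDS_indicator (by linarith) N).ae_exists_quadForm_le N.cast_nonneg hβ hκ hα hφ
  filter_upwards [hN, h.2.2.2] with x hx hV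
  obtain ⟨N, hN⟩ := ENNReal.exists_nat_gt hV.ne
  have hmem : ∀ k, x ∈ {x | ∀ j < k,
      (μ⁻[fun x => ENNReal.ofReal (|w (j + 1) x| ^ β) | ℱ j]) x ≤ N} := fun k j _ =>
    (le_iSup (fun j => (μ⁻[fun x => ENNReal.ofReal (|w (j + 1) x| ^ β) | ℱ j]) x) j).trans hN.le
  obtain ⟨C, hC⟩ := hx N
  have he : (fun t => Set.indicator {x | ∀ j < t,
      (μ⁻[fun x => ENNReal.ofReal (|w (j + 1) x| ^ β) | ℱ j]) x ≤ N} (w t) x) = fun t => w t x :=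
    funext fun t => Set.indicator_of_mem (hmem t) _
  refine ⟨C, fun n => ?_⟩
  have := hC n
  rwa [he] at this

end LeastSquaresBound

/-! ### Moments and shifts of the Laplace law -/

section Laplace

variable {b : ℝ}

/-- The density of the Laplace law. -/
def laplaceDensity (b x : ℝ) : ℝ := 1 / (2 * b) * Real.exp (-|x| / b)

lemma laplaceDensity_pos (hb : 0 < b) (x : ℝ) : 0 < laplaceDensity b x := by
  unfold laplaceDensity; positivity

lemma measurable_laplaceDensity (b : ℝ) : Measurable (laplaceDensity b) := by
  unfold laplaceDensity; fun_prop

lemma laplaceMeasure_eq (b : ℝ) :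
    laplaceMeasure b = volume.withDensity fun x => ENNReal.ofReal (laplaceDensity b x) := rfl

lemma integral_laplaceMeasure (hb : 0 < b) (f : ℝ → ℝ) :
    ∫ x, f x ∂(laplaceMeasure b) = ∫ x, laplaceDensity b x * f x := by
  rw [laplaceMeasure_eq, integral_withDensity_eq_integral_toReal_smul
    (measurable_laplaceDensity b).ennreal_ofReal (ae_of_all _ fun x => ENNReal.ofReal_lt_top)]
  simp [ENNReal.toReal_ofReal (laplaceDensity_pos hb _).le]

lemma integral_abs_pow_laplaceMeasure (hb : 0 < b) (n : ℕ) :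
    ∫ x, |x| ^ n ∂(laplaceMeasure b) = n.factorial * b ^ n := by
  rw [integral_laplaceMeasure hb]
  have h1 : ∀ x : ℝ, laplaceDensity b x * |x| ^ n =
      (fun y => 1 / (2 * b) * (y ^ n * Real.exp (-(b⁻¹ * y)))) |x| := by
    intro x
    simp only [laplaceDensity]
    rw [show -|x| / b = -(b⁻¹ * |x|) by ring]
    ring
  simp_rw [h1]
  rw [integral_comp_abs (f := fun y => 1 / (2 * b) * (y ^ n * Real.exp (-(b⁻¹ * y)))),
    integral_const_mul]
  have h2 := Real.integral_rpow_mul_exp_neg_mul_Ioi (a := n + 1) (r := b⁻¹) (by positivity)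
    (inv_pos.2 hb)
  simp only [add_sub_cancel_right, Real.rpow_natCast] at h2
  rw [h2, Real.Gamma_nat_eq_factorial, one_div b⁻¹, inv_inv,
    show ((n : ℝ) + 1) = ((n + 1 : ℕ) : ℝ) by push_cast; ring, Real.rpow_natCast, pow_succ]
  field_simp

lemma integrable_abs_pow_laplaceMeasure (hb : 0 < b) (n : ℕ) :
    Integrable (fun x => |x| ^ n) (laplaceMeasure b) := by
  apply Integrable.of_integral_ne_zero
  rw [integral_abs_pow_laplaceMeasure hb]
  positivity

lemma integrable_id_laplaceMeasure (hb : 0 < b) : Integrable (fun x => x) (laplaceMeasure b) := by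
  refine (integrable_abs_pow_laplaceMeasure hb 1).mono' measurable_id.aestronglyMeasurable
    (ae_of_all _ fun x => ?_)
  simp

lemma integral_id_laplaceMeasure (hb : 0 < b) : ∫ x, x ∂(laplaceMeasure b) = 0 := by
  rw [integral_laplaceMeasure hb]
  -- The integrand is odd, so the integral equals its own opposite.
  have h := integral_neg_eq_self (μ := volume) (fun x => laplaceDensity b x * x)
  simp only [laplaceDensity, abs_neg, mul_neg, integral_neg] at h ⊢
  linarith

/-- The densities of the two shifted laws compare pointwise, by the triangle inequality in the
exponent. -/
lemma laplaceMeasure_map_add_le (hb : 0 < b) (v v' : ℝ) :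
    (laplaceMeasure b).map (v + ·) ≤
      ENNReal.ofReal (Real.exp (|v - v'| / b)) • (laplaceMeasure b).map (v' + ·) := by
  have hshift : ∀ (v : ℝ) (s : Set ℝ), MeasurableSet s → (laplaceMeasure b).map (v + ·) s =
      ∫⁻ y in s, ENNReal.ofReal (laplaceDensity b (y - v)) := by
    intro v s hs
    rw [Measure.map_apply (measurable_const_add v) hs, laplaceMeasure_eq,
      withDensity_apply _ (measurable_const_add v hs),
      ← lintegral_indicator (measurable_const_add v hs), ← lintegral_indicator hs,
      ← lintegral_add_left_eq_self
        (s.indicator fun y => ENNReal.ofReal (laplaceDensity b (y - v))) v]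
    refine lintegral_congr fun x => ?_
    simp only [Set.indicator, add_sub_cancel_left]
    rfl
  refine Measure.le_iff.2 fun s hs => ?_
  rw [Measure.smul_apply, hshift v s hs, hshift v' s hs, smul_eq_mul,
    ← lintegral_const_mul' _ _ ENNReal.ofReal_ne_top]
  refine lintegral_mono fun y => ?_
  rw [← ENNReal.ofReal_mul (Real.exp_pos _).le]
  refine ENNReal.ofReal_le_ofReal ?_
  unfold laplaceDensity
  rw [mul_left_comm, ← Real.exp_add, ← add_div]
  refine mul_le_mul_of_nonneg_left (Real.exp_le_exp.2 (div_le_div_of_nonneg_right ?_ hb.le))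
    (by positivity)
  have := abs_sub_abs_le_abs_sub (y - v') (y - v)
  rw [show y - v' - (y - v) = v - v' by ring] at this
  linarith

end Laplace

/-! ### Products of Laplace laws and the Laplace mechanism -/

section Product

variable {J : Type*} [Fintype J]

/-- The product outer measure is the largest one bounded on every set by the product of the measures
of its projections. Hence a comparison on boxes extends to all measurable sets. -/
lemma measure_pi_le {X : J → Type*} [∀ i, MeasurableSpace (X i)] {μ ν : ∀ i, Measure (X i)}
    [∀ i, SigmaFinite (μ i)] [∀ i, SigmaFinite (ν i)] {c : J → ℝ≥0∞} (h0 : ∀ i, c i ≠ 0)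
    (hc : ∀ i, c i ≠ ∞) (h : ∀ i, μ i ≤ c i • ν i) :
    Measure.pi μ ≤ (∏ i, c i) • Measure.pi ν := by
  have hp0 : ∏ i, c i ≠ 0 := Finset.prod_ne_zero_iff.2 fun i _ => h0 i
  have hpt : ∏ i, c i ≠ ∞ := ENNReal.prod_ne_top fun i _ => hc i
  have key : ((∏ i, c i)⁻¹ • Measure.pi μ).toOuterMeasure ≤
      OuterMeasure.pi fun i => (ν i).toOuterMeasure := by
    refine OuterMeasure.le_boundedBy.2 fun s => ?_
    show (∏ i, c i)⁻¹ * Measure.pi μ s ≤ ∏ i, ν i (Function.eval i '' s)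
    rw [ENNReal.inv_mul_le_iff hp0 hpt, ← Finset.prod_mul_distrib]
    calc Measure.pi μ s ≤ Measure.pi μ (Set.univ.pi fun i => Function.eval i '' s) :=
          measure_mono (Set.subset_pi_eval_image _ _)
      _ = ∏ i, μ i (Function.eval i '' s) := Measure.pi_pi _ _
      _ ≤ _ := Finset.prod_le_prod' fun i _ => by simpa using h i (Function.eval i '' s)
  refine Measure.le_iff.2 fun s hs => ?_
  have hν : Measure.pi ν s = OuterMeasure.pi (fun i => (ν i).toOuterMeasure) s := by
    rw [Measure.pi, toMeasure_apply _ _ hs]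
  rw [Measure.smul_apply, smul_eq_mul, ← ENNReal.inv_mul_le_iff hp0 hpt, hν]
  exact key s

lemma pi_laplaceMeasure_shift_le {c : J → ℝ} (hc : ∀ j, 0 < c j)
    [∀ j, IsProbabilityMeasure (laplaceMeasure (c j))] (v v' : J → ℝ) {D : Set (J → ℝ)}
    (hD : MeasurableSet D) :
    Measure.pi (fun j => laplaceMeasure (c j)) {n | v + n ∈ D} ≤
      ENNReal.ofReal (Real.exp (∑ j, |v j - v' j| / c j)) *
        Measure.pi (fun j => laplaceMeasure (c j)) {n | v' + n ∈ D} := by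
  have hmap : ∀ v : J → ℝ, Measure.pi (fun j => laplaceMeasure (c j)) {n | v + n ∈ D} =
      Measure.pi (fun j => (laplaceMeasure (c j)).map (v j + ·)) D := by
    intro v
    have hprob : ∀ j, IsProbabilityMeasure ((laplaceMeasure (c j)).map (v j + ·)) := fun j =>
      Measure.isProbabilityMeasure_map (measurable_const_add _).aemeasurable
    rw [← Measure.pi_map_pi (fun j => (measurable_const_add (v j)).aemeasurable),
      Measure.map_apply (by fun_prop) hD]
    rfl
  have hprob : ∀ v : J → ℝ, ∀ j, IsProbabilityMeasure ((laplaceMeasure (c j)).map (v j + ·)) :=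
    fun v j => Measure.isProbabilityMeasure_map (measurable_const_add _).aemeasurable
  have := hprob v
  have := hprob v'
  rw [hmap, hmap, Real.exp_sum, ENNReal.ofReal_prod_of_nonneg fun j _ => (Real.exp_pos _).le]
  exact measure_pi_le (fun j => (ENNReal.ofReal_pos.2 (Real.exp_pos _)).ne')
    (fun j => ENNReal.ofReal_ne_top) (fun j => laplaceMeasure_map_add_le (hc j) _ _) D

/-- The Laplace mechanism applied to independent random data. -/
lemma laplace_mechanism {Ω X : Type*} [MeasurableSpace Ω] {μ : Measure Ω}
    [IsProbabilityMeasure μ] [MeasurableSpace X] {c : J → ℝ} (hc : ∀ j, 0 < c j)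
    {n : J → Ω → ℝ} (hn : ∀ j, Measurable (n j)) (hlaw : ∀ j, μ.map (n j) = laplaceMeasure (c j))
    (hind : iIndepFun n μ) {ξ : Ω → X} (hξ : Measurable ξ)
    (hindξ : IndepFun (fun w j => n j w) ξ μ) {f f' : X → J → ℝ} (hf : Measurable f)
    (hf' : Measurable f') {ε : ℝ} (hε : ∀ x, ∑ j, |f x j - f' x j| / c j ≤ ε)
    {D : Set (J → ℝ)} (hD : MeasurableSet D) :
    μ {w | (fun j => f (ξ w) j + n j w) ∈ D} ≤
      ENNReal.ofReal (Real.exp ε) * μ {w | (fun j => f' (ξ w) j + n j w) ∈ D} := by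
  have hprob : ∀ j, IsProbabilityMeasure (laplaceMeasure (c j)) := fun j => by
    rw [← hlaw]; exact Measure.isProbabilityMeasure_map (hn j).aemeasurable
  have hnm : Measurable fun w j => n j w := measurable_pi_lambda _ hn
  have hpi : μ.map (fun w j => n j w) = Measure.pi fun j => laplaceMeasure (c j) := by
    rw [(iIndepFun_iff_map_fun_eq_pi_map fun j => (hn j).aemeasurable).1 hind]
    simp_rw [hlaw]
  have hjoint : μ.map (fun w => (ξ w, fun j => n j w)) =
      (μ.map ξ).prod (Measure.pi fun j => laplaceMeasure (c j)) := by
    rw [← hpi]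
    exact (indepFun_iff_map_prod_eq_prod_map_map hξ.aemeasurable hnm.aemeasurable).1 hindξ.symm
  have hprobX : IsProbabilityMeasure (μ.map ξ) := Measure.isProbabilityMeasure_map hξ.aemeasurable
  -- Fubini conditions on the data `ξ`: given them the mechanism is a deterministic shift of product
  -- Laplace noise, and the shift bound integrates.
  have hcalc : ∀ f : X → J → ℝ, Measurable f → μ {w | (fun j => f (ξ w) j + n j w) ∈ D} =
      ∫⁻ x, Measure.pi (fun j => laplaceMeasure (c j)) {m | f x + m ∈ D} ∂(μ.map ξ) := by
    intro f hf
    have hS : MeasurableSet {z : X × (J → ℝ) | f z.1 + z.2 ∈ D} :=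
      ((hf.comp measurable_fst).add measurable_snd) hD
    have h1 : μ {w | (fun j => f (ξ w) j + n j w) ∈ D} =
        μ.map (fun w => (ξ w, fun j => n j w)) {z : X × (J → ℝ) | f z.1 + z.2 ∈ D} := by
      rw [Measure.map_apply (hξ.prodMk hnm) hS]
      rfl
    rw [h1, hjoint, Measure.prod_apply hS]
    rfl
  rw [hcalc f hf, hcalc f' hf', ← lintegral_const_mul' _ _ ENNReal.ofReal_ne_top]
  refine lintegral_mono fun x => (pi_laplaceMeasure_shift_le hc (f x) (f' x) hD).trans ?_
  gcongr
  exact hε x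

end Product

/-! ### ℓ¹ sensitivity of a stable autoregression -/

section Sensitivity

/-- The state `(x_{k+1-p}, …, x_k)` of an autoregression. -/
def arState (p : ℕ) (x : ℕ → ℝ) (k : ℕ) : Fin p → ℝ := fun r => lag x k r.rev

lemma lag_succ_succ (x : ℕ → ℝ) (k j : ℕ) : lag x (k + 1) (j + 1) = lag x k j := by
  simp [lag]

lemma companionMatrix_mulVec_arState {p : ℕ} (a : Fin p → ℝ) (x : ℕ → ℝ) (k : ℕ) (r : Fin p) :
    (companionMatrix a *ᵥ arState p x k) r =
      if (r : ℕ) + 1 = p then ∑ j : Fin p, a j * lag x k j else arState p x (k + 1) r := by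
  simp only [mulVec, dotProduct, companionMatrix, of_apply]
  split_ifs with h
  -- The last row and the state both run from the oldest lag to the newest; reversing restores the
  -- order a_1, …, a_p.
  · rw [← Equiv.sum_comp Fin.revPerm]
    simp [arState]
  · have hr : (r : ℕ) + 1 < p := by omega
    rw [Finset.sum_eq_single ⟨r + 1, hr⟩]
    · simp only [arState, if_true, one_mul]
      have h1 : (r.rev : ℕ) = ((⟨r + 1, hr⟩ : Fin p).rev : ℕ) + 1 := by
        simp only [Fin.val_rev]
        omega
      rw [h1, lag_succ_succ]
    · intro j _ hj
      rw [if_neg, zero_mul]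
      intro h2
      exact hj (Fin.ext h2)
    · simp

/-- The last unit vector. -/
def lastUnit (p : ℕ) (r : Fin p) : ℝ := if (r : ℕ) + 1 = p then 1 else 0

lemma arState_succ {p : ℕ} (a : Fin p → ℝ) (x v : ℕ → ℝ) (k : ℕ)
    (hx : x (k + 1) = ∑ j : Fin p, a j * lag x k j + v k) :
    arState p x (k + 1) = companionMatrix a *ᵥ arState p x k +
      v k • lastUnit p := by
  funext r
  rw [Pi.add_apply, companionMatrix_mulVec_arState, Pi.smul_apply, lastUnit]
  split_ifs with h
  · have : (r.rev : ℕ) = 0 := by simp only [Fin.val_rev]; omega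
    have hl : lag x (k + 1) 0 = x (k + 1) := by simp [lag]
    rw [arState, this, hl, hx, smul_eq_mul, mul_one]
  · simp

lemma abs_apply_le_euclNorm {ι : Type*} [Fintype ι] (x : ι → ℝ) (i : ι) : |x i| ≤ euclNorm x := by
  simpa [euclNorm] using PiLp.norm_apply_le (p := 2) (WithLp.toLp 2 x) i

lemma euclNorm_mulVec_le {ι : Type*} [Fintype ι] [DecidableEq ι] (M : Matrix ι ι ℝ) (x : ι → ℝ) :
    euclNorm (M *ᵥ x) ≤ matNorm M * euclNorm x := by
  simpa [euclNorm, matNorm] using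
    (Matrix.toEuclideanCLM (n := ι) (𝕜 := ℝ) M).le_opNorm (WithLp.toLp 2 x)

lemma euclNorm_le_of_abs_le {p : ℕ} (x : Fin p → ℝ) {S : ℝ} (hS : 0 ≤ S) (h : ∀ i, |x i| ≤ S) :
    euclNorm x ≤ Real.sqrt p * S := by
  rw [euclNorm, EuclideanSpace.norm_eq, ← Real.sqrt_sq hS, ← Real.sqrt_mul (by positivity)]
  refine Real.sqrt_le_sqrt ?_
  calc ∑ i, ‖x i‖ ^ 2 ≤ ∑ _i : Fin p, S ^ 2 :=
        Finset.sum_le_sum fun i _ => pow_le_pow_left₀ (norm_nonneg _) (h i) 2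
    _ = p * S ^ 2 := by simp

variable {p : ℕ} {a : Fin p → ℝ} {c₀ lam : ℝ}

lemma sum_geometric_succ_le (hlam : lam ∈ Set.Ioo (0 : ℝ) 1) (n : ℕ) :
    ∑ l ∈ Finset.range n, lam ^ (l + 1) ≤ lam / (1 - lam) := by
  have h1 : 0 < 1 - lam := by linarith [hlam.2]
  simp_rw [pow_succ]
  rw [← Finset.sum_mul, geom_sum_eq hlam.2.ne, le_div_iff₀ h1]
  have h2 : (lam ^ n - 1) / (lam - 1) * lam * (1 - lam) = (1 - lam ^ n) * lam := by
    have : lam - 1 ≠ 0 := by linarith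
    field_simp
    ring
  rw [h2]
  nlinarith [pow_pos hlam.1 n, hlam.1]

lemma one_le_C₁ (hc₀ : 0 < c₀) (hlam : lam ∈ Set.Ioo (0 : ℝ) 1) : 1 ≤ C₁ p c₀ lam := by
  have h1 : 0 < 1 - lam := by linarith [hlam.2]
  have h2 := hlam.1
  rw [C₁]
  have : 0 ≤ Real.sqrt p * c₀ * lam / (1 - lam) := by positivity
  linarith

/-- Free evolution of a stable autoregression: the total variation of the path is controlled by
that of the first `T` values. -/
lemma sum_abs_le_of_free (hc₀ : 0 < c₀) (hlam : lam ∈ Set.Ioo (0 : ℝ) 1)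
    (hA : ∀ k : ℕ, matNorm (companionMatrix a ^ k) ≤ c₀ * lam ^ k) {x : ℕ → ℝ} (h0 : x 0 = 0)
    {T : ℕ} (hx : ∀ k, T ≤ k → x (k + 1) = ∑ j : Fin p, a j * lag x k j) (n : ℕ) :
    ∑ k ∈ Finset.range (T + n), |x (k + 1)| ≤
      C₁ p c₀ lam * ∑ k ∈ Finset.range T, |x (k + 1)| := by
  set S := ∑ k ∈ Finset.range T, |x (k + 1)| with hS
  have hS0 : 0 ≤ S := Finset.sum_nonneg fun _ _ => abs_nonneg _
  have hstate : ∀ l, arState p x (T + l) = (companionMatrix a ^ l) *ᵥ arState p x T := by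
    intro l
    induction l with
    | zero => simp
    | succ l ih =>
      rw [← add_assoc, arState_succ a x 0 (T + l) (by simpa using hx (T + l) (by omega)), ih,
        mulVec_mulVec, ← pow_succ', Pi.zero_apply, zero_smul, add_zero]
  -- Each coordinate of the state at time T is zero or one of the first T values, hence at most `S`;
  -- passing to the Euclidean norm costs √p.
  have hinit : euclNorm (arState p x T) ≤ Real.sqrt p * S := by
    refine euclNorm_le_of_abs_le _ hS0 fun r => ?_
    simp only [arState, lag]
    split_ifs with h
    · rcases Nat.eq_zero_or_pos (T - r.rev) with h2 | h2
      · rw [h2, h0, abs_zero]; exact hS0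
      · obtain ⟨s, hs⟩ := Nat.exists_eq_add_of_le' h2
        rw [hs]
        exact Finset.single_le_sum (f := fun k => |x (k + 1)|) (fun _ _ => abs_nonneg _)
          (Finset.mem_range.2 (by omega))
    · rw [abs_zero]; exact hS0
  have htail : ∀ l, |x (T + l + 1)| ≤ Real.sqrt p * c₀ * S * lam ^ (l + 1) := by
    intro l
    rcases Nat.eq_zero_or_pos p with hp | hp
    · subst hp
      simp [hx (T + l) (by omega)]
    · have h1 : x (T + l + 1) = arState p x (T + (l + 1)) ⟨p - 1, by omega⟩ := by
        have : p - (p - 1 + 1) = 0 := by omega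
        simp [arState, lag, Fin.val_rev, this, add_assoc]
      rw [h1, hstate]
      refine (abs_apply_le_euclNorm _ _).trans ((euclNorm_mulVec_le _ _).trans ?_)
      calc _ ≤ c₀ * lam ^ (l + 1) * (Real.sqrt p * S) :=
            mul_le_mul (hA _) hinit (norm_nonneg _) (by have := hlam.1; positivity)
        _ = _ := by ring
  rw [Finset.sum_range_add, C₁, add_mul, one_mul]
  refine add_le_add le_rfl ?_
  calc _ ≤ ∑ l ∈ Finset.range n, Real.sqrt p * c₀ * S * lam ^ (l + 1) :=
        Finset.sum_le_sum fun l _ => htail l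
    _ = Real.sqrt p * c₀ * S * ∑ l ∈ Finset.range n, lam ^ (l + 1) := (Finset.mul_sum _ _ _).symm
    _ ≤ Real.sqrt p * c₀ * S * (lam / (1 - lam)) :=
        mul_le_mul_of_nonneg_left (sum_geometric_succ_le hlam n) (by positivity)
    _ = _ := by ring

/-- Forced evolution of a stable autoregression from rest. -/
lemma sum_abs_le_of_forced (hc₀ : 0 < c₀) (hlam : lam ∈ Set.Ioo (0 : ℝ) 1)
    (hA : ∀ k : ℕ, matNorm (companionMatrix a ^ k) ≤ c₀ * lam ^ k) {x v : ℕ → ℝ} (h0 : x 0 = 0)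
    (hx : ∀ k, x (k + 1) = ∑ j : Fin p, a j * lag x k j + v k) (n : ℕ) :
    ∑ k ∈ Finset.range n, |x (k + 1)| ≤ C₁ p c₀ lam * ∑ k ∈ Finset.range n, |v k| := by
  rcases Nat.eq_zero_or_pos p with hp | hp
  · subst hp
    simp [hx, C₁]
  set e : Fin p → ℝ := lastUnit p with he
  set last : Fin p := ⟨p - 1, by omega⟩ with hlast
  have hel : e last = 1 := by simp only [he, lastUnit, hlast]; rw [if_pos (by omega)]
  have henorm : euclNorm e ≤ 1 := by
    have : e = Pi.single last 1 := by
      funext r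
      by_cases hr : r = last
      · subst hr; simp [hel]
      · rw [Pi.single_eq_of_ne hr]
        have : ¬ ((r : ℕ) + 1 = p) := fun h => hr (Fin.ext (by simp [hlast]; omega))
        simp [he, lastUnit, this]
    rw [this, euclNorm]
    simp
  -- Variation of constants from the zero state.
  have hstate : ∀ k, arState p x k =
      ∑ s ∈ Finset.range k, v s • (companionMatrix a ^ (k - 1 - s)) *ᵥ e := by
    intro k
    induction k with
    | zero =>
      funext r
      simp only [arState, lag]
      split_ifs with h
      · simp [h0]
      · rfl
    | succ k ih =>
      rw [arState_succ a x v k (hx k), ih, Finset.sum_range_succ, mulVec_sum]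
      congr 1
      · refine Finset.sum_congr rfl fun s hs => ?_
        have hs' := Finset.mem_range.1 hs
        rw [mulVec_smul, mulVec_mulVec, ← pow_succ']
        congr 3
        omega
      · simp [he]
  set h : ℕ → ℝ := fun l => |((companionMatrix a ^ l) *ᵥ e) last| with hh
  have hh0 : h 0 = 1 := by simp [hh, hel]
  have hhl : ∀ l, h (l + 1) ≤ c₀ * lam ^ (l + 1) := by
    intro l
    refine (abs_apply_le_euclNorm _ _).trans ((euclNorm_mulVec_le _ _).trans ?_)
    calc _ ≤ c₀ * lam ^ (l + 1) * 1 :=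
          mul_le_mul (hA _) henorm (norm_nonneg _) (by have := hlam.1; positivity)
      _ = _ := mul_one _
  have hp1 : 1 ≤ Real.sqrt p := Real.one_le_sqrt.2 (by exact_mod_cast hp)
  -- The impulse response starts with exactly 1 and then decays geometrically. Its tail has no
  -- factor √p; √p ≥ 1 is inserted to reach `C₁`.
  have hhsum : ∀ n, ∑ l ∈ Finset.range n, h l ≤ C₁ p c₀ lam := by
    intro n
    rcases n with _ | n
    · simpa using zero_le_one.trans (one_le_C₁ hc₀ hlam)
    rw [Finset.sum_range_succ', hh0, C₁, add_comm]
    refine add_le_add le_rfl ?_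
    have h1 : 0 < 1 - lam := by linarith [hlam.2]
    have h2 := hlam.1
    calc ∑ l ∈ Finset.range n, h (l + 1) ≤ ∑ l ∈ Finset.range n, c₀ * lam ^ (l + 1) :=
          Finset.sum_le_sum fun l _ => hhl l
      _ = c₀ * ∑ l ∈ Finset.range n, lam ^ (l + 1) := by rw [Finset.mul_sum]
      _ ≤ c₀ * (lam / (1 - lam)) :=
          mul_le_mul_of_nonneg_left (sum_geometric_succ_le hlam n) hc₀.le
      _ ≤ Real.sqrt p * (c₀ * (lam / (1 - lam))) := le_mul_of_one_le_left (by positivity) hp1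
      _ = _ := by ring
  have hbound : ∀ k, |x (k + 1)| ≤ ∑ s ∈ Finset.range (k + 1), |v s| * h (k - s) := by
    intro k
    have h1 : x (k + 1) = arState p x (k + 1) last := by
      have : p - (p - 1 + 1) = 0 := by omega
      simp [arState, lag, Fin.val_rev, hlast, this]
    rw [h1, hstate, Finset.sum_apply]
    refine (Finset.abs_sum_le_sum_abs _ _).trans (Finset.sum_le_sum fun s _ => ?_)
    simp [abs_mul, hh]
  calc ∑ k ∈ Finset.range n, |x (k + 1)|
      ≤ ∑ k ∈ Finset.range n, ∑ s ∈ Finset.range (k + 1), |v s| * h (k - s) :=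
        Finset.sum_le_sum fun k _ => hbound k
    -- Young's inequality for a convolution: exchange the sums with l = k - s, then bound each inner
    -- sum by the ℓ¹ norm of the impulse response.
    _ = ∑ s ∈ Finset.range n, ∑ l ∈ Finset.range (n - s), |v s| * h l := by
        simp_rw [Finset.range_eq_Ico]
        rw [Finset.sum_sigma', Finset.sum_sigma']
        refine Finset.sum_bij' (fun z _ => ⟨z.2, z.1 - z.2⟩) (fun z _ => ⟨z.1 + z.2, z.1⟩)
          ?_ ?_ ?_ ?_ ?_
        · intro z hz; simp at hz ⊢; omega
        · intro z hz; simp at hz ⊢; omega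
        · rintro ⟨z1, z2⟩ hz
          simp only [Finset.mem_sigma, Finset.mem_Ico] at hz
          simp only [Sigma.mk.injEq, heq_eq_eq, and_true]
          omega
        · rintro ⟨z1, z2⟩ hz
          simp
        · intro z hz; rfl
    _ = ∑ s ∈ Finset.range n, |v s| * ∑ l ∈ Finset.range (n - s), h l := by
        simp_rw [Finset.mul_sum]
    _ ≤ ∑ s ∈ Finset.range n, |v s| * C₁ p c₀ lam :=
        Finset.sum_le_sum fun s _ => mul_le_mul_of_nonneg_left (hhsum _) (abs_nonneg _)
    _ = _ := by rw [← Finset.sum_mul, mul_comm]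

end Sensitivity

/-! ### Delayed signals, regressors and their measurability -/

section Signals

lemma lag_sub (x x' : ℕ → ℝ) (k j : ℕ) :
    lag x k j - lag x' k j = lag (fun t => x t - x' t) k j := by
  unfold lag
  split_ifs <;> simp

/-- Delaying a signal does not increase the sums of a nonnegative function of it. -/
lemma sum_lag_le {f : ℝ → ℝ} (hf0 : f 0 = 0) (hf : ∀ x, 0 ≤ f x) (x : ℕ → ℝ) (j n : ℕ) :
    ∑ k ∈ Finset.range n, f (lag x k j) ≤ ∑ k ∈ Finset.range n, f (x k) := by
  have hzero : ∀ k < j, f (lag x k j) = 0 := fun k hk => by simp [lag, not_le.2 hk, hf0]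
  rcases le_total j n with h | h
  · obtain ⟨l, rfl⟩ := Nat.exists_eq_add_of_le h
    rw [Finset.sum_range_add, Finset.sum_eq_zero fun k hk => hzero k (Finset.mem_range.1 hk),
      zero_add]
    have : ∀ k, lag x (j + k) j = x k := fun k => by simp [lag]
    simp_rw [this]
    exact Finset.sum_le_sum_of_subset_of_nonneg (Finset.range_mono (by omega))
      fun k _ _ => hf _
  · rw [Finset.sum_eq_zero fun k hk => hzero k ((Finset.mem_range.1 hk).trans_le h)]
    exact Finset.sum_nonneg fun k _ => hf _

variable {p m : ℕ} {q : Fin m → ℕ}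

lemma dotProduct_regressor (θ : RegIndex p q → ℝ) (y : ℕ → ℝ) (u : Fin m → ℕ → ℝ) (k : ℕ) :
    θ ⬝ᵥ regressor q y u k = ∑ j : Fin p, arCoeff θ j * lag y k j +
      ∑ i, ∑ j : Fin (q i), inCoeff θ i j * lag (u i) k j := by
  rw [dotProduct, Fintype.sum_sum_type, Fintype.sum_sigma]
  rfl

variable {X : Type*} {mX : MeasurableSpace X}

lemma measurable_lag {x : ℕ → X → ℝ} {k : ℕ} (hx : ∀ t ≤ k, Measurable (x t)) (j : ℕ) :
    Measurable fun z => lag (fun t => x t z) k j := by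
  unfold lag
  split_ifs
  exacts [hx _ (Nat.sub_le _ _), measurable_const]

lemma measurable_regressor {y : ℕ → X → ℝ} {u : Fin m → ℕ → X → ℝ} {k : ℕ}
    (hy : ∀ t ≤ k, Measurable (y t)) (hu : ∀ i, ∀ t ≤ k, Measurable (u i t)) :
    Measurable fun z => (regressor q (fun t => y t z) (fun i t => u i t z) k :
      RegIndex p q → ℝ) := by
  refine measurable_pi_lambda _ fun s => ?_
  cases s with
  | inl j => exact measurable_lag hy j
  | inr ij => exact measurable_lag (hu ij.1) ij.2

lemma measurable_outputHist (θ : RegIndex p q → ℝ) {u : Fin m → ℕ → X → ℝ} {ω : ℕ → X → ℝ}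
    (hu : ∀ i t, Measurable (u i t)) (hω : ∀ k, Measurable (ω (k + 1))) {T : ℕ} (x : Fin T → ℝ)
    (k t : ℕ) :
    Measurable fun z => outputHist θ (fun i t => u i t z) (fun t => ω t z) x k t := by
  induction k generalizing t with
  | zero => exact measurable_const
  | succ k ih =>
    rcases eq_or_ne t (k + 1) with rfl | h
    · simp only [outputHist, Function.update_self]
      split_ifs with hk
      · exact measurable_const
      · exact (measurable_dotProduct measurable_const
          (measurable_regressor (y := fun t z => outputHist θ (fun i t => u i t z)
            (fun t => ω t z) x k t) (fun t _ => ih t) fun i t _ => hu i t)).add (hω k)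
    · simp only [outputHist, Function.update_of_ne h]
      exact ih t

/-- The value ω_0 never enters. This permits reading a noise path that stores only ω_{k+1} through
the index t - 1, which is wrong at time 0 alone. -/
lemma outputHist_congr (θ : RegIndex p q → ℝ) (u : Fin m → ℕ → ℝ) {ω ω' : ℕ → ℝ}
    (h : ∀ k, ω (k + 1) = ω' (k + 1)) {T : ℕ} (x : Fin T → ℝ) (k : ℕ) :
    outputHist θ u ω x k = outputHist θ u ω' x k := by
  induction k with
  | zero => rfl
  | succ k ih => simp only [outputHist, ih, h]

end Signals

/-! ### Differential privacy of the two mechanisms -/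

section Privacy

variable {Ω : Type*} [mΩ : MeasurableSpace Ω] {μ : Measure Ω} [IsProbabilityMeasure μ]
  {p m : ℕ} {q : Fin m → ℕ} {θ : RegIndex p q → ℝ} {u : Fin m → ℕ → Ω → ℝ} {ω y η : ℕ → Ω → ℝ}
  {ξ : Fin m → ℕ → Ω → ℝ} {b₀ : ℝ} {b : Fin m → ℝ} {ε δ c₀ lam : ℝ}

/-- The law of the process of outputs, inputs and system noises lives on this space. -/
abbrev ProcessSpace (m : ℕ) : Type := (ℕ → ℝ) × (Fin m → ℕ → ℝ) × (ℕ → ℝ)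

lemma measurable_process (hy : ∀ k, Measurable (y k)) (hu : ∀ i k, Measurable (u i k))
    (hω : ∀ k, Measurable (ω (k + 1))) :
    Measurable fun w => ((fun k => y k w, fun i k => u i k w, fun k => ω (k + 1) w) :
      ProcessSpace m) :=
  (measurable_pi_lambda _ hy).prodMk ((measurable_pi_lambda _ fun i =>
    measurable_pi_lambda _ (hu i)).prodMk (measurable_pi_lambda _ hω))

lemma measurable_output (hy : ∀ w, IsOutput θ (fun i k => u i k w) (fun k => ω k w) fun k => y k w)
    (hu : ∀ i k, Measurable (u i k)) (hω : ∀ k, Measurable (ω (k + 1))) (k : ℕ) :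
    Measurable (y k) := by
  induction k using Nat.strong_induction_on with
  | _ k ih =>
    rcases k with _ | k
    · have : y 0 = fun _ => 0 := funext fun w => (hy w).1
      rw [this]; exact measurable_const
    · have : y (k + 1) = fun w => θ ⬝ᵥ regressor q (fun t => y t w) (fun i t => u i t w) k
          + ω (k + 1) w := funext fun w => (hy w).2 k
      rw [this]
      exact (measurable_dotProduct measurable_const (measurable_regressor
        (fun t ht => ih t (by omega)) fun i t _ => hu i t)).add (hω k)

lemma measurable_noiseFamily (hη : ∀ k, Measurable (η (k + 1))) (hξ : ∀ i k, Measurable (ξ i k))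
    (s : ℕ ⊕ (Fin m × ℕ)) : Measurable (noiseFamily η ξ s) := by
  cases s with
  | inl k => exact hη k
  | inr ik => exact hξ ik.1 ik.2

/-- The scale parameters of the family of noises. -/
def noiseScale (b₀ : ℝ) (b : Fin m → ℝ) : ℕ ⊕ (Fin m × ℕ) → ℝ :=
  Sum.elim (fun _ => b₀) fun ik => b ik.1

/-- The Laplace mechanism for the noises of the system. -/
lemma IndependentNoises.mechanism_le (hindep : IndependentNoises μ y u ω η ξ)
    (hy : ∀ k, Measurable (y k)) (hu : ∀ i k, Measurable (u i k))
    (hω : ∀ k, Measurable (ω (k + 1))) (hb₀ : 0 < b₀) (hb : ∀ i, 0 < b i)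
    (hη : ∀ k, Measurable (η (k + 1))) (hξ : ∀ i k, Measurable (ξ i k))
    (hη_law : ∀ k, μ.map (η (k + 1)) = laplaceMeasure b₀)
    (hξ_law : ∀ i k, μ.map (ξ i k) = laplaceMeasure (b i)) {J : Type*} [Fintype J]
    {s : J → ℕ ⊕ (Fin m × ℕ)} (hs : s.Injective) {f f' : ProcessSpace m → J → ℝ}
    (hf : Measurable f) (hf' : Measurable f')
    (hε : ∀ x, ∑ j, |f x j - f' x j| / noiseScale b₀ b (s j) ≤ ε)
    {D : Set (J → ℝ)} (hD : MeasurableSet D) :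
    μ {w | (fun j => f (fun k => y k w, fun i k => u i k w, fun k => ω (k + 1) w) j
        + noiseFamily η ξ (s j) w) ∈ D} ≤ ENNReal.ofReal (Real.exp ε) *
      μ {w | (fun j => f' (fun k => y k w, fun i k => u i k w, fun k => ω (k + 1) w) j
        + noiseFamily η ξ (s j) w) ∈ D} := by
  refine laplace_mechanism (c := fun j => noiseScale b₀ b (s j)) (fun j => ?_)
    (fun j => measurable_noiseFamily hη hξ (s j)) (fun j => ?_) (hindep.1.precomp hs)
    (measurable_process hy hu hω) ?_ hf hf' hε hD
  · rcases s j with k | ik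
    exacts [hb₀, hb _]
  · rcases s j with k | ik
    exacts [hη_law k, hξ_law _ _]
  · exact hindep.2.comp (φ := fun n j => n (s j)) (ψ := id)
      (measurable_pi_lambda _ fun j => measurable_pi_apply (s j)) measurable_id

lemma dist_sensitive {T : ℕ} (x x' : Sensitive T) : dist x x' = ∑ s, |x s - x' s| := by
  rw [PiLp.dist_eq_of_L1]
  rfl

/-- After time T the common inputs and noise cancel, so the difference of the two paths evolves
freely. -/
lemma sum_abs_outputFrom_sub_le (u : Fin m → ℕ → ℝ) (ω : ℕ → ℝ) (hc₀ : 0 < c₀)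
    (hlam : lam ∈ Set.Ioo (0 : ℝ) 1)
    (hA : ∀ k : ℕ, matNorm (companionMatrix (arCoeff θ) ^ k) ≤ c₀ * lam ^ k) {T : ℕ}
    (x x' : Fin T → ℝ) (n : ℕ) :
    ∑ k ∈ Finset.range (T + n), |outputFrom θ u ω x (k + 1) - outputFrom θ u ω x' (k + 1)| ≤
      C₁ p c₀ lam * ∑ s, |x s - x' s| := by
  refine (sum_abs_le_of_free hc₀ hlam hA
    (x := fun k => outputFrom θ u ω x k - outputFrom θ u ω x' k) (T := T)
    (by simp [outputFrom_zero]) (fun k hk => ?_) n).trans_eq ?_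
  · simp only [outputFrom_of_le _ _ _ _ hk, dotProduct_regressor, ← lag_sub, mul_sub,
      Finset.sum_sub_distrib]
    ring
  · congr 1
    rw [Finset.sum_range]
    exact Finset.sum_congr rfl fun s _ => by
      rw [outputFrom_of_lt _ _ _ _ s.2, outputFrom_of_lt _ _ _ _ s.2]

lemma sum_abs_prescribeInput_sub (u : Fin m → ℕ → ℝ) (i : Fin m) {T : ℕ} (x x' : Fin T → ℝ)
    (n : ℕ) :
    ∑ k ∈ Finset.range (T + n), |prescribeInput u i x i k - prescribeInput u i x' i k| =
      ∑ s, |x s - x' s| := by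
  rw [Finset.sum_range_add, Finset.sum_eq_zero (s := Finset.range n), add_zero, Finset.sum_range]
  · exact Finset.sum_congr rfl fun s _ => by simp [prescribeInput]
  · intro k _
    simp [prescribeInput]

/-- The difference starts from rest and is driven only by the input difference of participant `i`.
Delays do not increase ℓ¹ norms, so the forcing costs ∑|b_{i,j}| and the autoregression costs `C₁`.
-/
lemma sum_abs_outputFrom_prescribeInput_sub_le (u : Fin m → ℕ → ℝ) (ω : ℕ → ℝ) (hc₀ : 0 < c₀)
    (hlam : lam ∈ Set.Ioo (0 : ℝ) 1)
    (hA : ∀ k : ℕ, matNorm (companionMatrix (arCoeff θ) ^ k) ≤ c₀ * lam ^ k) (i : Fin m) {T : ℕ}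
    (x x' : Fin T → ℝ) (n : ℕ) (e : Fin 0 → ℝ) :
    ∑ k ∈ Finset.range (T + n), |outputFrom θ (prescribeInput u i x) ω e (k + 1)
        - outputFrom θ (prescribeInput u i x') ω e (k + 1)| ≤
      C₂ θ c₀ lam i * ∑ s, |x s - x' s| := by
  set d : ℕ → ℝ := fun k => prescribeInput u i x i k - prescribeInput u i x' i k with hd
  have hne : ∀ j, j ≠ i → prescribeInput u i x j = prescribeInput u i x' j := by
    intro j hj
    funext k
    simp [prescribeInput, hj]
  refine (sum_abs_le_of_forced hc₀ hlam hA
    (x := fun k => outputFrom θ (prescribeInput u i x) ω e k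
      - outputFrom θ (prescribeInput u i x') ω e k)
    (v := fun k => ∑ j : Fin (q i), inCoeff θ i j * lag d k j)
    (by simp [outputFrom_zero]) (fun k => ?_) (T + n)).trans ?_
  · simp only [outputFrom_of_le _ _ _ _ (Nat.zero_le k), dotProduct_regressor]
    have h1 : ∑ l, ∑ j : Fin (q l), inCoeff θ l j * lag (prescribeInput u i x l) k j
        - ∑ l, ∑ j : Fin (q l), inCoeff θ l j * lag (prescribeInput u i x' l) k j
        = ∑ j : Fin (q i), inCoeff θ i j * lag d k j := by
      rw [← Finset.sum_sub_distrib, Finset.sum_eq_single i]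
      · simp only [hd, ← lag_sub, mul_sub, Finset.sum_sub_distrib]
      · intro l _ hl
        rw [hne l hl, sub_self]
      · simp
    rw [← h1]
    simp only [← lag_sub, mul_sub, Finset.sum_sub_distrib]
    ring
  · rw [C₂, mul_assoc]
    refine mul_le_mul_of_nonneg_left ?_ (zero_le_one.trans (one_le_C₁ hc₀ hlam))
    rw [← sum_abs_prescribeInput_sub u i x x' n, Finset.sum_mul]
    calc ∑ k ∈ Finset.range (T + n), |∑ j : Fin (q i), inCoeff θ i j * lag d k j|
        ≤ ∑ k ∈ Finset.range (T + n), ∑ j : Fin (q i), |inCoeff θ i j| * |lag d k j| := by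
          refine Finset.sum_le_sum fun k _ => (Finset.abs_sum_le_sum_abs _ _).trans_eq ?_
          simp_rw [abs_mul]
      _ = ∑ j : Fin (q i), |inCoeff θ i j| * ∑ k ∈ Finset.range (T + n), |lag d k j| := by
          rw [Finset.sum_comm]
          simp_rw [Finset.mul_sum]
      _ ≤ _ := Finset.sum_le_sum fun j _ => mul_le_mul_of_nonneg_left
          (sum_lag_le abs_zero abs_nonneg d j _) (abs_nonneg _)

/-- All released coordinates carry noise of scale b₀, so the loss is at most the ℓ¹ sensitivity C₁δ
over b₀. -/
theorem isDifferentiallyPrivate_outputMechanism (hindep : IndependentNoises μ y u ω η ξ)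
    (hy : ∀ k, Measurable (y k)) (hu : ∀ i k, Measurable (u i k))
    (hω : ∀ k, Measurable (ω (k + 1))) (hb₀ : 0 < b₀) (hb : ∀ i, 0 < b i)
    (hη : ∀ k, Measurable (η (k + 1))) (hξ : ∀ i k, Measurable (ξ i k))
    (hη_law : ∀ k, μ.map (η (k + 1)) = laplaceMeasure b₀)
    (hξ_law : ∀ i k, μ.map (ξ i k) = laplaceMeasure (b i)) (hc₀ : 0 < c₀)
    (hlam : lam ∈ Set.Ioo (0 : ℝ) 1)
    (hA : ∀ k : ℕ, matNorm (companionMatrix (arCoeff θ) ^ k) ≤ c₀ * lam ^ k)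
    (hlevel₀ : C₁ p c₀ lam / b₀ * δ ≤ ε) {T₁ T₂ : ℕ} (hT : T₁ ≤ T₂) :
    IsDifferentiallyPrivate μ ε δ (outputMechanism θ u ω η T₁ T₂) := by
  intro x x' hxx D hD
  obtain ⟨n, rfl⟩ := Nat.exists_eq_add_of_le hT
  set f : Sensitive T₁ → ProcessSpace m → Fin (T₁ + n) → ℝ := fun x z k =>
    outputFrom θ z.2.1 (fun t => z.2.2 (t - 1)) (fun s => x s) (k + 1) with hf
  have hfm : ∀ x, Measurable (f x) := fun x => measurable_pi_lambda _ fun k =>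
    measurable_outputHist θ (u := fun i t (z : ProcessSpace m) => z.2.1 i t)
      (ω := fun t (z : ProcessSpace m) => z.2.2 (t - 1)) (fun i t => by fun_prop)
      (fun k => by fun_prop) _ _ _
  have hmech : ∀ x w, outputMechanism θ u ω η T₁ (T₁ + n) x w = fun k : Fin (T₁ + n) =>
      f x (fun k => y k w, fun i k => u i k w, fun k => ω (k + 1) w) k
        + noiseFamily η ξ (Sum.inl (k : ℕ)) w := by
    intro x w
    funext k
    simp only [outputMechanism, noisyOutput, noiseFamily, hf, Nat.add_eq_zero_iff, one_ne_zero,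
      and_false, if_false, outputFrom]
    rw [outputHist_congr θ _ (ω := fun t => ω t w) (ω' := fun t => ω (t - 1 + 1) w)]
    simp
  simp_rw [hmech]
  refine hindep.mechanism_le hy hu hω hb₀ hb hη hξ hη_law hξ_law
    (s := fun k : Fin (T₁ + n) => Sum.inl (k : ℕ))
    (fun i j h => Fin.ext (Sum.inl_injective h)) (hfm x) (hfm x') (fun z => ?_) hD
  refine le_trans ?_ hlevel₀
  simp only [noiseScale, Sum.elim_inl, ← Finset.sum_div]
  rw [div_mul_eq_mul_div]
  refine div_le_div_of_nonneg_right ?_ hb₀.le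
  rw [← Finset.sum_range (f := fun k => |outputFrom θ z.2.1 (fun t => z.2.2 (t - 1))
    (fun s => x s) (k + 1) - outputFrom θ z.2.1 (fun t => z.2.2 (t - 1)) (fun s => x' s) (k + 1)|)]
  refine (sum_abs_outputFrom_sub_le z.2.1 _ hc₀ hlam hA _ _ n).trans ?_
  rw [← dist_sensitive]
  exact mul_le_mul_of_nonneg_left hxx (zero_le_one.trans (one_le_C₁ hc₀ hlam))

/-- Two channels leak: the outputs, with sensitivity C₂δ against scale b₀, and the inputs
themselves, with sensitivity δ against b_i. The noises used are distinct, so the losses add. -/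
theorem isDifferentiallyPrivate_inputMechanism (hindep : IndependentNoises μ y u ω η ξ)
    (hy : ∀ k, Measurable (y k)) (hu : ∀ i k, Measurable (u i k))
    (hω : ∀ k, Measurable (ω (k + 1))) (hb₀ : 0 < b₀) (hb : ∀ i, 0 < b i)
    (hη : ∀ k, Measurable (η (k + 1))) (hξ : ∀ i k, Measurable (ξ i k))
    (hη_law : ∀ k, μ.map (η (k + 1)) = laplaceMeasure b₀)
    (hξ_law : ∀ i k, μ.map (ξ i k) = laplaceMeasure (b i)) (hc₀ : 0 < c₀)
    (hlam : lam ∈ Set.Ioo (0 : ℝ) 1)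
    (hA : ∀ k : ℕ, matNorm (companionMatrix (arCoeff θ) ^ k) ≤ c₀ * lam ^ k) (i : Fin m)
    (hlevel : (C₂ θ c₀ lam i / b₀ + 1 / b i) * δ ≤ ε) {T₁ T₂ : ℕ} (hT : T₁ ≤ T₂) :
    IsDifferentiallyPrivate μ ε δ (inputMechanism θ u ω η ξ i T₁ T₂) := by
  intro x x' hxx D hD
  obtain ⟨n, rfl⟩ := Nat.exists_eq_add_of_le hT
  set f : Sensitive T₁ → ProcessSpace m → Fin (T₁ + n) ⊕ Fin (T₁ + n) → ℝ := fun x z =>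
    Sum.elim (fun k => outputFrom θ (prescribeInput z.2.1 i fun s => x s)
      (fun t => z.2.2 (t - 1)) (T := 0) Fin.elim0 (k + 1))
      (fun k => prescribeInput z.2.1 i (fun s => x s) i k) with hf
  have hpm : ∀ (x : Sensitive T₁) j t, Measurable fun z : ProcessSpace m =>
      prescribeInput z.2.1 i (fun s => x s) j t := by
    intro x j t
    unfold prescribeInput
    split_ifs <;> fun_prop
  have hfm : ∀ x, Measurable (f x) := by
    intro x
    refine measurable_pi_lambda _ fun k => ?_
    rcases k with k | k
    · exact measurable_outputHist θ
        (u := fun j t (z : ProcessSpace m) => prescribeInput z.2.1 i (fun s => x s) j t)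
        (ω := fun t (z : ProcessSpace m) => z.2.2 (t - 1)) (hpm x)
        (fun k => by fun_prop) _ _ _
    · exact hpm x i k
  set s : Fin (T₁ + n) ⊕ Fin (T₁ + n) → ℕ ⊕ (Fin m × ℕ) :=
    Sum.map (fun k => (k : ℕ)) (fun k => (i, (k : ℕ))) with hs
  have hsi : s.Injective := Sum.map_injective.2
    ⟨Fin.val_injective, fun k l h => Fin.ext (congrArg Prod.snd h)⟩
  -- Repackages one noisy vector, indexed by both channels, into the released pair.
  set g : (Fin (T₁ + n) ⊕ Fin (T₁ + n) → ℝ) → (Fin (T₁ + n) → ℝ) × (Fin (T₁ + n) → ℝ) :=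
    fun v => (fun k => v (Sum.inl k), fun k => v (Sum.inr k)) with hg
  have hgm : Measurable g := by fun_prop
  have hmech : ∀ x w, inputMechanism θ u ω η ξ i T₁ (T₁ + n) x w = g fun k =>
      f x (fun k => y k w, fun i k => u i k w, fun k => ω (k + 1) w) k
        + noiseFamily η ξ (s k) w := by
    intro x w
    refine Prod.ext (funext fun k => ?_) (funext fun k => ?_)
    · simp only [inputMechanism, noisyOutput, noiseFamily, hf, hg, hs, Nat.add_eq_zero_iff,
        one_ne_zero, and_false, if_false, outputFrom, Sum.elim_inl, Sum.map_inl]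
      rw [outputHist_congr θ _ (ω := fun t => ω t w) (ω' := fun t => ω (t - 1 + 1) w)]
      simp
    · rfl
  simp_rw [hmech]
  refine hindep.mechanism_le hy hu hω hb₀ hb hη hξ hη_law hξ_law hsi (hfm x) (hfm x')
    (fun z => ?_) (hgm hD)
  refine le_trans ?_ hlevel
  have hbi := hb i
  rw [Fintype.sum_sum_type, add_mul]
  simp only [noiseScale, hs, hf, Sum.elim_inl, Sum.elim_inr, Sum.map_inl, Sum.map_inr,
    ← Finset.sum_div]
  rw [div_mul_eq_mul_div, div_mul_eq_mul_div, one_mul]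
  refine add_le_add (div_le_div_of_nonneg_right ?_ hb₀.le) (div_le_div_of_nonneg_right ?_ hbi.le)
  · rw [← Finset.sum_range (f := fun k => |outputFrom θ (prescribeInput z.2.1 i fun s => x s)
      (fun t => z.2.2 (t - 1)) (T := 0) Fin.elim0 (k + 1) - outputFrom θ
      (prescribeInput z.2.1 i fun s => x' s) (fun t => z.2.2 (t - 1)) (T := 0) Fin.elim0 (k + 1)|)]
    refine (sum_abs_outputFrom_prescribeInput_sub_le z.2.1 _ hc₀ hlam hA i _ _ n _).trans ?_
    rw [← dist_sensitive]
    refine mul_le_mul_of_nonneg_left hxx (mul_nonneg (zero_le_one.trans (one_le_C₁ hc₀ hlam)) ?_)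
    exact Finset.sum_nonneg fun _ _ => abs_nonneg _
  · rw [← Finset.sum_range (f := fun k => |prescribeInput z.2.1 i (fun s => x s) i k
      - prescribeInput z.2.1 i (fun s => x' s) i k|), sum_abs_prescribeInput_sub,
      ← dist_sensitive]
    exact hxx

end Privacy

/-! ### Freezing one of two independent variables -/

section Independence

variable {Ω A B : Type*} [mΩ : MeasurableSpace Ω] {μ : Measure Ω} [IsProbabilityMeasure μ]
  [MeasurableSpace A] [MeasurableSpace B] {X : Ω → A} {N : Ω → B} {E : Set (A × B)}

/-- An event in two independent variables is almost sure if it is so with the first one frozen. -/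
lemma ae_mem_of_indepFun_left (hX : Measurable X) (hN : Measurable N) (h : IndepFun X N μ)
    (hE : MeasurableSet E) (hx : ∀ x, ∀ᵐ w ∂μ, (x, N w) ∈ E) : ∀ᵐ w ∂μ, (X w, N w) ∈ E := by
  have hpN : IsProbabilityMeasure (μ.map N) := Measure.isProbabilityMeasure_map hN.aemeasurable
  have hpX : IsProbabilityMeasure (μ.map X) := Measure.isProbabilityMeasure_map hX.aemeasurable
  have hprod := (indepFun_iff_map_prod_eq_prod_map_map hX.aemeasurable hN.aemeasurable).1 h
  rw [← ae_map_iff (p := fun z => z ∈ E) (hX.prodMk hN).aemeasurable hE, hprod]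
  refine (Measure.measure_prod_null hE.compl).2 (ae_of_all _ fun x => ?_)
  have := hx x
  rw [← ae_map_iff (p := fun n => (x, n) ∈ E) hN.aemeasurable (measurable_prodMk_left hE)] at this
  exact this

/-- An event in two independent variables is almost sure if it is so with the second one frozen. -/
lemma ae_mem_of_indepFun_right (hX : Measurable X) (hN : Measurable N) (h : IndepFun X N μ)
    (hE : MeasurableSet E) (hn : ∀ n, ∀ᵐ w ∂μ, (X w, n) ∈ E) : ∀ᵐ w ∂μ, (X w, N w) ∈ E :=
  ae_mem_of_indepFun_left (E := Prod.swap ⁻¹' E) hN hX h.symm (measurable_swap hE) hn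

end Independence

/-! ### The added noises: filtration, martingale property, law of large numbers -/

section Noise

variable {Ω : Type*} [mΩ : MeasurableSpace Ω] {μ : Measure Ω} [IsProbabilityMeasure μ] {m : ℕ}
  {η : ℕ → Ω → ℝ} {ξ : Fin m → ℕ → Ω → ℝ} {b₀ : ℝ}

/-- The time at which a member of the family of noises is added. -/
def noiseTime : ℕ ⊕ (Fin m × ℕ) → ℕ
  | Sum.inl k => k + 1
  | Sum.inr ik => ik.2

/-- The natural filtration of the added noises. -/
def noiseFiltration (hη : ∀ k, Measurable (η (k + 1))) (hξ : ∀ i k, Measurable (ξ i k)) :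
    Filtration ℕ mΩ where
  seq k := ⨆ s ∈ {s : ℕ ⊕ (Fin m × ℕ) | noiseTime s ≤ k},
    MeasurableSpace.comap (noiseFamily η ξ s) inferInstance
  mono' _ _ hkl := biSup_mono fun _ hs => le_trans hs hkl
  le' _ := iSup₂_le fun s _ => (measurable_noiseFamily hη hξ s).comap_le

lemma measurable_noiseFiltration (hη : ∀ k, Measurable (η (k + 1)))
    (hξ : ∀ i k, Measurable (ξ i k)) {s : ℕ ⊕ (Fin m × ℕ)} {k : ℕ} (hs : noiseTime s ≤ k) :
    Measurable[noiseFiltration hη hξ k] (noiseFamily η ξ s) := by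
  refine Measurable.mono (comap_measurable (noiseFamily η ξ s)) ?_ le_rfl
  exact le_biSup (fun s => MeasurableSpace.comap (noiseFamily η ξ s) inferInstance)
    (show s ∈ {s : ℕ ⊕ (Fin m × ℕ) | noiseTime s ≤ k} from hs)

lemma integral_comp_of_map_eq {Y : Ω → ℝ} {ν : Measure ℝ} (hY : Measurable Y)
    (hlaw : μ.map Y = ν) {f : ℝ → ℝ} (hf : Measurable f) :
    ∫ w, f (Y w) ∂μ = ∫ x, f x ∂ν := by
  rw [← hlaw, integral_map hY.aemeasurable hf.aestronglyMeasurable]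

lemma integrable_comp_of_map_eq {Y : Ω → ℝ} {ν : Measure ℝ} (hY : Measurable Y)
    (hlaw : μ.map Y = ν) {f : ℝ → ℝ} (hf : Measurable f) (hint : Integrable f ν) :
    Integrable (fun w => f (Y w)) μ := by
  rw [← hlaw] at hint
  exact (integrable_map_measure hf.aestronglyMeasurable hY.aemeasurable).1 hint

/-- The noise added to the output is a martingale difference sequence. -/
lemma isBoundedMDS_noise (hη : ∀ k, Measurable (η (k + 1))) (hξ : ∀ i k, Measurable (ξ i k))
    (hind : iIndepFun (noiseFamily η ξ) μ) (hb₀ : 0 < b₀)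
    (hη_law : ∀ k, μ.map (η (k + 1)) = laplaceMeasure b₀) :
    IsBoundedMDS μ (noiseFiltration hη hξ) η 4 (∫ x, |x| ^ 4 ∂(laplaceMeasure b₀)) := by
  have hindep : ∀ k, Indep (MeasurableSpace.comap (η (k + 1)) inferInstance)
      (noiseFiltration hη hξ k) μ := by
    intro k
    -- The variable η_{k+1} has time k + 1, hence is not among those generating the σ-algebra at
    -- time k.
    have h := indep_iSup_of_disjoint (fun s => (measurable_noiseFamily hη hξ s).comap_le) hind
      (S := {Sum.inl k}) (T := {s : ℕ ⊕ (Fin m × ℕ) | noiseTime s ≤ k})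
      (by simp [noiseTime])
    rw [iSup_singleton] at h
    exact h
  refine ⟨fun k => measurable_noiseFiltration hη hξ (s := Sum.inl k) le_rfl, fun k => ?_,
    fun k => ?_, fun k S hS => ?_⟩
  · exact integrable_comp_of_map_eq (hη k) (hη_law k) measurable_id
      (integrable_id_laplaceMeasure hb₀)
  · refine (condExp_indep_eq (hη k).comap_le ((noiseFiltration hη hξ).le k)
      (comap_measurable (η (k + 1))).stronglyMeasurable (hindep k)).trans ?_
    refine ae_of_all _ fun w => ?_
    have := integral_comp_of_map_eq (hη k) (hη_law k) (f := fun x => x) measurable_id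
    simp only [this, integral_id_laplaceMeasure hb₀, Pi.zero_apply]
  · have hS' := (noiseFiltration hη hξ).le k _ hS
    have h := lintegral_mul_eq_lintegral_mul_lintegral_of_independent_measurableSpace
      (hη k).comap_le ((noiseFiltration hη hξ).le k) (hindep k)
      (f := fun w => ENNReal.ofReal (|η (k + 1) w| ^ (4 : ℝ)))
      (g := S.indicator fun _ => (1 : ℝ≥0∞))
      (((measurable_id.abs.pow_const (4 : ℝ)).ennreal_ofReal).comp
        (comap_measurable (η (k + 1))))
      (measurable_const.indicator hS)
    have h1 : ∫⁻ w in S, ENNReal.ofReal (|η (k + 1) w| ^ (4 : ℝ)) ∂μ =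
        ∫⁻ w, ENNReal.ofReal (|η (k + 1) w| ^ (4 : ℝ)) * S.indicator (fun _ => 1) w ∂μ := by
      rw [← lintegral_indicator hS']
      refine lintegral_congr fun w => ?_
      by_cases hw : w ∈ S <;> simp [hw]
    rw [h1, h, lintegral_indicator_const hS', one_mul]
    refine mul_le_mul_left (le_of_eq ?_) _
    rw [← integral_comp_of_map_eq (hη k) (hη_law k) (by fun_prop),
      ofReal_integral_eq_lintegral_ofReal
        (integrable_comp_of_map_eq (hη k) (hη_law k) (f := fun x => |x| ^ 4) (by fun_prop)
          (integrable_abs_pow_laplaceMeasure hb₀ 4))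
        (ae_of_all _ fun w => by positivity)]
    refine lintegral_congr fun w => ?_
    rw [← Real.rpow_natCast]
    norm_num

/-- The strong law of large numbers for the squares of a Laplace noise. -/
lemma ae_tendsto_sum_sq_div {b : ℝ} (hb : 0 < b) {Y : ℕ → Ω → ℝ} (hY : ∀ k, Measurable (Y k))
    (hlaw : ∀ k, μ.map (Y k) = laplaceMeasure b) (hind : iIndepFun Y μ) :
    ∀ᵐ w ∂μ, Tendsto (fun n : ℕ => (∑ k ∈ Finset.range n, Y k w ^ 2) / n) atTop
      (𝓝 (2 * b ^ 2)) := by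
  have hsq : Measurable fun x : ℝ => x ^ 2 := measurable_id.pow_const 2
  have hint : Integrable (fun x : ℝ => x ^ 2) (laplaceMeasure b) := by
    simpa using integrable_abs_pow_laplaceMeasure hb 2
  have h := strong_law_ae_real (fun k w => Y k w ^ 2)
    (integrable_comp_of_map_eq (hY 0) (hlaw 0) hsq hint)
    (fun i j hij => (hind.indepFun hij).comp hsq hsq)
    (fun i => IdentDistrib.comp (u := fun x => x ^ 2)
      ⟨(hY i).aemeasurable, (hY 0).aemeasurable, by rw [hlaw, hlaw]⟩ hsq)
  have hmean : ∫ w, Y 0 w ^ 2 ∂μ = 2 * b ^ 2 := by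
    rw [integral_comp_of_map_eq (hY 0) (hlaw 0) hsq]
    simpa using integral_abs_pow_laplaceMeasure hb 2
  rwa [hmean] at h

end Noise

/-! ### The noise bound as a measurable event -/

section Bounds

variable {ι : Type*} [Fintype ι] [DecidableEq ι]

/-- The self-normalized noise sums grow at most like the growth scale of the leverages. -/
def HasNoiseBound (α β κ : ℝ) (φ : ℕ → ι → ℝ) (w : ℕ → ℝ) : Prop :=
  ∃ C : ℝ, ∀ n, quadForm α φ w 0 n ≤ C * growthScale β κ (leverageSum α φ n)

lemma measurableSet_hasNoiseBound {Z : Type*} [MeasurableSpace Z] {α β κ : ℝ} (hα : 0 < α)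
    (hκ : 0 ≤ κ) {φ : ℕ → Z → ι → ℝ} {w : ℕ → Z → ℝ} (hφ : ∀ k, Measurable (φ k))
    (hw : ∀ k, Measurable (w k)) :
    MeasurableSet {z | HasNoiseBound α β κ (fun t => φ t z) fun t => w t z} := by
  have h : {z | HasNoiseBound α β κ (fun t => φ t z) fun t => w t z} = ⋃ C : ℕ, ⋂ n,
      {z | quadForm α (fun t => φ t z) (fun t => w t z) 0 n ≤
        C * growthScale β κ (leverageSum α (fun t => φ t z) n)} := by
    ext z
    simp only [HasNoiseBound, Set.mem_ofPred_eq, Set.mem_iUnion, Set.mem_iInter]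
    refine ⟨fun ⟨C, hC⟩ => ?_, fun ⟨C, hC⟩ => ⟨C, hC⟩⟩
    -- Positivity of the growth scale lets the constant be an integer, so the event is a countable
    -- union.
    obtain ⟨K, hK⟩ := exists_nat_ge C
    refine ⟨K, fun n => (hC n).trans (mul_le_mul_of_nonneg_right hK ?_)⟩
    exact zero_le_one.trans (one_le_growthScale hκ (one_le_leverageSum hα _ n))
  rw [h]
  refine MeasurableSet.iUnion fun C => MeasurableSet.iInter fun n => measurableSet_le ?_ ?_
  · exact measurable_quadForm (fun t _ => hφ t) (fun t _ => hw (t + 1)) 0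
  · exact ((measurable_growthScale β κ).comp (measurable_leverageSum fun t _ => hφ t)).const_mul _

lemma quadForm_congr {α : ℝ} {φ : ℕ → ι → ℝ} {w w' : ℕ → ℝ} (h : ∀ t, w (t + 1) = w' (t + 1))
    (v : ι → ℝ) (k : ℕ) : quadForm α φ w v k = quadForm α φ w' v k := by
  simp only [quadForm, noiseSum, h]

end Bounds

/-! ### Transfer to the noisy, non-adapted regressors -/

section Transfer

variable {Ω : Type*} [mΩ : MeasurableSpace Ω] {μ : Measure Ω} [IsProbabilityMeasure μ]
  {p m : ℕ} {q : Fin m → ℕ} {u : Fin m → ℕ → Ω → ℝ} {ω y η : ℕ → Ω → ℝ}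
  {ξ : Fin m → ℕ → Ω → ℝ} {b₀ α β κ : ℝ}

/-- The noisy regressor as a function of the process and of the added noises. -/
def noisyRegressor (p : ℕ) {m : ℕ} (q : Fin m → ℕ) (k : ℕ)
    (z : ProcessSpace m × (ℕ ⊕ (Fin m × ℕ) → ℝ)) : RegIndex p q → ℝ :=
  regressor q (noisyOutput z.1.1 fun t => z.2 (Sum.inl (t - 1)))
    (noisyInput z.1.2.1 fun i t => z.2 (Sum.inr (i, t))) k

lemma measurable_noisyOutput {Z : Type*} {mZ : MeasurableSpace Z} {y η : ℕ → Z → ℝ} {k : ℕ}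
    (hy : Measurable (y k)) (hη : k ≠ 0 → Measurable (η k)) :
    Measurable fun z => noisyOutput (fun t => y t z) (fun t => η t z) k := by
  unfold noisyOutput
  split_ifs with h
  exacts [measurable_const, hy.add (hη h)]

lemma measurable_noisyRegressor (k : ℕ) : Measurable (noisyRegressor p q k) :=
  measurable_regressor (y := fun t (z : ProcessSpace m × (ℕ ⊕ (Fin m × ℕ) → ℝ)) =>
      noisyOutput z.1.1 (fun t => z.2 (Sum.inl (t - 1))) t)
    (u := fun i t z => noisyInput z.1.2.1 (fun i t => z.2 (Sum.inr (i, t))) i t)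
    (fun t _ => measurable_noisyOutput (k := t)
      (y := fun t (z : ProcessSpace m × (ℕ ⊕ (Fin m × ℕ) → ℝ)) => z.1.1 t)
      (η := fun t z => z.2 (Sum.inl (t - 1))) (by fun_prop) fun _ => by fun_prop)
    (fun i t _ => by unfold noisyInput; fun_prop)

lemma noisyRegressor_apply (w : Ω) (k : ℕ) :
    noisyRegressor p q k ((fun k => y k w, fun i k => u i k w, fun k => ω (k + 1) w),
      fun s => noiseFamily η ξ s w) =
    regressor q (noisyOutput (fun t => y t w) fun t => η t w)
      (noisyInput (fun i t => u i t w) fun i t => ξ i t w) k := by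
  have : noisyOutput (fun t => y t w) (fun t => noiseFamily η ξ (Sum.inl (t - 1)) w) =
      noisyOutput (fun t => y t w) fun t => η t w := by
    funext t
    rcases t with _ | t
    · rfl
    · simp [noisyOutput, noiseFamily]
  rw [← this]
  rfl

/-- Additivity at time 0 relies on y_0 = 0, because the transmitted output is set to zero there. -/
lemma regressor_noisy {y : ℕ → ℝ} (hy : y 0 = 0) (u : Fin m → ℕ → ℝ) (η : ℕ → ℝ)
    (ξ : Fin m → ℕ → ℝ) (k : ℕ) :
    (regressor q (noisyOutput y η) (noisyInput u ξ) k : RegIndex p q → ℝ) =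
      regressor q y u k + regressor q (noisyOutput 0 η) ξ k := by
  funext s
  rcases s with j | ij
  · simp only [regressor, lag, Pi.add_apply]
    split_ifs with h
    · by_cases hk : k - (j : ℕ) = 0 <;> simp [noisyOutput, hk, hy]
    · simp
  · simp only [regressor, lag, Pi.add_apply, noisyInput]
    split_ifs <;> simp

/-- Bound on the system noise part, the added noises being frozen. -/
lemma ae_hasNoiseBound_system {ℱ : Filtration ℕ mΩ} (hω : IsMartingaleDifference μ ℱ ω β)
    (hadapted : ∀ k, Measurable[ℱ k] fun w =>
      (regressor q (fun t => y t w) (fun i t => u i t w) k : RegIndex p q → ℝ))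
    (hy0 : ∀ w, y 0 w = 0) (hβ : 2 ≤ β) (hκ : 1 < κ) (hα : 0 < α)
    (n : ℕ ⊕ (Fin m × ℕ) → ℝ) :
    ∀ᵐ w ∂μ, HasNoiseBound α β κ (fun k => noisyRegressor p q k
      ((fun k => y k w, fun i k => u i k w, fun k => ω (k + 1) w), n)) fun t => ω t w := by
  -- With the added noises frozen, the noisy regressor is the true one plus a deterministic vector,
  -- hence still adapted to ℱ.
  have hφ : ∀ k w, noisyRegressor p q k
      ((fun k => y k w, fun i k => u i k w, fun k => ω (k + 1) w), n) =
      regressor q (fun t => y t w) (fun i t => u i t w) k +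
        regressor q (noisyOutput 0 fun t => n (Sum.inl (t - 1)))
          (fun i t => n (Sum.inr (i, t))) k := fun k w => regressor_noisy (hy0 w) _ _ _ k
  refine hω.ae_exists_quadForm_le hβ hκ hα (φ := fun k w => noisyRegressor p q k
    ((fun k => y k w, fun i k => u i k w, fun k => ω (k + 1) w), n)) fun k => ?_
  simp_rw [hφ]
  exact (hadapted k).add_const _

/-- Bound on the part of the noise added to the output, the process being frozen. -/
lemma ae_hasNoiseBound_added (hη : ∀ k, Measurable (η (k + 1))) (hξ : ∀ i k, Measurable (ξ i k))
    (hind : iIndepFun (noiseFamily η ξ) μ) (hb₀ : 0 < b₀)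
    (hη_law : ∀ k, μ.map (η (k + 1)) = laplaceMeasure b₀) (hκ : 1 < κ) (hα : 0 < α)
    (z : ProcessSpace m) :
    ∀ᵐ w ∂μ, HasNoiseBound α 4 κ (fun k => noisyRegressor p q k
      (z, fun s => noiseFamily η ξ s w)) fun t => η t w := by
  refine (isBoundedMDS_noise hη hξ hind hb₀ hη_law).ae_exists_quadForm_le
    (integral_nonneg fun x => by positivity) (by norm_num) hκ hα
    (φ := fun k w => noisyRegressor p q k (z, fun s => noiseFamily η ξ s w)) fun k => ?_
  refine measurable_regressor
    (y := fun t w => noisyOutput z.1 (fun t => noiseFamily η ξ (Sum.inl (t - 1)) w) t)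
    (u := fun i t w => noisyInput z.2.1 (fun i t => noiseFamily η ξ (Sum.inr (i, t)) w) i t)
    (fun t ht => measurable_noisyOutput (y := fun t _ => z.1 t)
      (η := fun t w => noiseFamily η ξ (Sum.inl (t - 1)) w) measurable_const fun h0 => ?_)
    (fun i t ht => ?_)
  -- For t ≠ 0 the family member at t - 1 is η_t, whose time is t ≤ k.
  · exact measurable_noiseFiltration hη hξ (by simp only [noiseTime]; omega)
  · exact (measurable_noiseFiltration hη hξ (s := Sum.inr (i, t)) ht).const_add _

lemma HasNoiseBound.congr {ι : Type*} [Fintype ι] [DecidableEq ι] {φ : ℕ → ι → ℝ} {w w' : ℕ → ℝ}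
    (h : HasNoiseBound α β κ φ w) (hw : ∀ t, w (t + 1) = w' (t + 1)) :
    HasNoiseBound α β κ φ w' := by
  obtain ⟨C, hC⟩ := h
  exact ⟨C, fun n => (quadForm_congr hw 0 n).symm.le.trans (hC n)⟩

/-- The self-normalized sums of the system noise and of the noise added to the output are
controlled by the leverages. -/
theorem ae_hasNoiseBound {ℱ : Filtration ℕ mΩ} (hω : IsMartingaleDifference μ ℱ ω β)
    (hadapted : ∀ k, Measurable[ℱ k] fun w =>
      (regressor q (fun t => y t w) (fun i t => u i t w) k : RegIndex p q → ℝ))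
    (hy : ∀ k, Measurable (y k)) (hu : ∀ i k, Measurable (u i k)) (hy0 : ∀ w, y 0 w = 0)
    (hη : ∀ k, Measurable (η (k + 1))) (hξ : ∀ i k, Measurable (ξ i k))
    (hindep : IndependentNoises μ y u ω η ξ) (hb₀ : 0 < b₀)
    (hη_law : ∀ k, μ.map (η (k + 1)) = laplaceMeasure b₀) (hβ : 2 ≤ β) (hκ : 1 < κ)
    (hα : 0 < α) :
    ∀ᵐ w ∂μ, ∀ φ : ℕ → RegIndex p q → ℝ,
      (∀ k, φ k = regressor q (noisyOutput (fun t => y t w) fun t => η t w)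
        (noisyInput (fun i t => u i t w) fun i t => ξ i t w) k) →
      HasNoiseBound α β κ φ (fun t => ω t w) ∧ HasNoiseBound α 4 κ φ fun t => η t w := by
  have hωm : ∀ k, Measurable (ω (k + 1)) := fun k => (hω.1 k).mono (ℱ.le _) le_rfl
  have hX := measurable_process hy hu hωm
  have hN : Measurable fun w s => noiseFamily η ξ s w :=
    measurable_pi_lambda _ (measurable_noiseFamily hη hξ)
  have hκ0 : 0 ≤ κ := zero_le_one.trans hκ.le
  -- System noise: the added noises are frozen. For η the roles are exchanged.
  have h1 := ae_mem_of_indepFun_right hX hN hindep.2.symm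
    (measurableSet_hasNoiseBound (β := β) hα hκ0
      (fun k => measurable_noisyRegressor (p := p) (q := q) k)
      (w := fun k z => z.1.2.2 (k - 1)) fun k => by fun_prop)
    fun n => (ae_hasNoiseBound_system hω hadapted hy0 hβ hκ hα n).mono fun w hw => hw.congr
      fun t => rfl
  have h2 := ae_mem_of_indepFun_left hX hN hindep.2.symm
    (measurableSet_hasNoiseBound (β := 4) hα hκ0
      (fun k => measurable_noisyRegressor (p := p) (q := q) k)
      (w := fun k z => z.2 (Sum.inl (k - 1))) fun k => by fun_prop)
    fun z => (ae_hasNoiseBound_added hη hξ hindep.1 hb₀ hη_law hκ hα z).mono fun w hw => hw.congr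
      fun t => rfl
  filter_upwards [h1, h2] with w hw1 hw2 φ hφ
  have he : (fun k => noisyRegressor p q k ((fun k => y k w, fun i k => u i k w,
      fun k => ω (k + 1) w), fun s => noiseFamily η ξ s w)) = φ := by
    funext k
    rw [hφ, noisyRegressor_apply]
  simp only [he] at hw1 hw2
  exact ⟨hw1.congr fun t => rfl, hw2.congr fun t => rfl⟩

end Transfer

/-! ### The estimation error along a trajectory -/

section EstimationError

variable {p m : ℕ} {q : Fin m → ℕ}

/-- With fourth moments the scale is linear, the smallest possible on [1, ∞), so the excitation
condition tuned to ω also handles η. -/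
lemma HasNoiseBound.of_four {ι : Type*} [Fintype ι] [DecidableEq ι] {α β κ : ℝ}
    {φ : ℕ → ι → ℝ} {w : ℕ → ℝ} (hα : 0 < α) (hκ : 0 ≤ κ) (h : HasNoiseBound α 4 κ φ w) :
    HasNoiseBound α β κ φ w := by
  obtain ⟨C, hC⟩ := h
  refine ⟨|C|, fun n => (hC n).trans ?_⟩
  have h1 := one_le_leverageSum hα φ n
  have h2 : growthScale 4 κ (leverageSum α φ n) = leverageSum α φ n := by
    norm_num [growthScale]
  have h3 : leverageSum α φ n ≤ growthScale β κ (leverageSum α φ n) := by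
    unfold growthScale
    split_ifs
    · exact le_rfl
    · have h4 := one_le_log_exp_add (zero_le_one.trans h1)
      have h5 := Real.one_le_rpow h4 hκ
      rw [logScale]
      nlinarith [Real.exp_pos 1]
  rw [h2]
  calc C * leverageSum α φ n ≤ |C| * leverageSum α φ n :=
        mul_le_mul_of_nonneg_right (le_abs_self _) (by linarith)
    _ ≤ _ := mul_le_mul_of_nonneg_left h3 (abs_nonneg _)

/-- Under the excitation condition, the self-normalized noise sums are negligible. -/
lemma HasNoiseBound.tendsto {ι : Type*} [Fintype ι] [DecidableEq ι] {α β κ : ℝ}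
    {φ : ℕ → ι → ℝ} {w : ℕ → ℝ} (hα : 0 < α) (hκ : 0 ≤ κ) (h : HasNoiseBound α β κ φ w)
    {l : ℕ → ℝ} (hl : ∀ᶠ k in atTop, 0 < l k)
    (hexc : Tendsto (fun k : ℕ => (if 2 < β then Real.log (energy φ k) else
      Real.log (energy φ k) * Real.log (Real.exp 1 + Real.log (energy φ k)) ^ κ) / l (k + 1))
      atTop (𝓝 0)) :
    Tendsto (fun k => Real.sqrt (quadForm α φ w 0 k / l k)) atTop (𝓝 0) := by
  obtain ⟨C, hC⟩ := h
  obtain ⟨C', hC'⟩ := exists_growthScale_leverageSum_le (ι := ι) (β := β) hα hκ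
  rw [← Real.sqrt_zero]
  -- The shift by one aligns the energy up to k with the information matrix at k + 1.
  refine (Real.continuous_sqrt.tendsto 0).comp ((tendsto_add_atTop_iff_nat 1).1 ?_)
  have hlim := hexc.const_mul (|C| * C')
  rw [mul_zero] at hlim
  have hl1 : ∀ᶠ k in atTop, 0 < l (k + 1) := (tendsto_add_atTop_nat 1).eventually hl
  refine tendsto_of_tendsto_of_tendsto_of_le_of_le' tendsto_const_nhds hlim ?_ ?_
  · filter_upwards [hl1] with k hk
    exact div_nonneg (quadForm_nonneg hα _ _ _ _) hk.le
  · filter_upwards [hl1] with k hk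
    rw [← mul_div_assoc]
    refine div_le_div_of_nonneg_right ?_ hk.le
    have h0 : 0 ≤ growthScale β κ (leverageSum α φ (k + 1)) :=
      zero_le_one.trans (one_le_growthScale hκ (one_le_leverageSum hα φ _))
    calc _ ≤ _ := hC (k + 1)
      _ ≤ |C| * growthScale β κ (leverageSum α φ (k + 1)) :=
        mul_le_mul_of_nonneg_right (le_abs_self C) h0
      _ ≤ _ := by
        rw [mul_assoc]
        exact mul_le_mul_of_nonneg_left (hC' φ k) (abs_nonneg _)

lemma dotProduct_sq_le {ι : Type*} [Fintype ι] [DecidableEq ι] (x y : ι → ℝ) :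
    (x ⬝ᵥ y) ^ 2 ≤ euclNorm x ^ 2 * (y ⬝ᵥ y) := by
  rw [euclNorm_sq]
  simpa [dotProduct, sq] using Finset.sum_mul_sq_le_sq_mul_sq Finset.univ x y

lemma sum_dotProduct_regressor_self_le (y : ℕ → ℝ) (u : Fin m → ℕ → ℝ) (n : ℕ) :
    ∑ k ∈ Finset.range n, (regressor q y u k : RegIndex p q → ℝ) ⬝ᵥ regressor q y u k ≤
      p * ∑ k ∈ Finset.range n, y k ^ 2 + ∑ i, (q i : ℝ) * ∑ k ∈ Finset.range n, u i k ^ 2 := by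
  have hlag : ∀ (x : ℕ → ℝ) (j : ℕ), ∑ k ∈ Finset.range n, lag x k j ^ 2 ≤
      ∑ k ∈ Finset.range n, x k ^ 2 := fun x j =>
    sum_lag_le (f := fun t => t ^ 2) (by norm_num) (fun t => sq_nonneg t) x j n
  have h1 : ∀ k, (regressor q y u k : RegIndex p q → ℝ) ⬝ᵥ regressor q y u k =
      ∑ j : Fin p, lag y k j ^ 2 + ∑ i, ∑ j : Fin (q i), lag (u i) k j ^ 2 := by
    intro k
    rw [dotProduct_regressor]
    simp only [arCoeff, inCoeff, regressor, sq]
  simp_rw [h1]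
  rw [Finset.sum_add_distrib, Finset.sum_comm]
  refine add_le_add ?_ ?_
  · refine (Finset.sum_le_sum fun (j : Fin p) _ => hlag y j).trans_eq ?_
    simp
  · rw [Finset.sum_comm]
    refine Finset.sum_le_sum fun i _ => ?_
    rw [Finset.sum_comm]
    refine (Finset.sum_le_sum fun (j : Fin (q i)) _ => hlag (u i) j).trans_eq ?_
    simp

lemma sum_noisyOutput_zero_sq_le (η : ℕ → ℝ) (n : ℕ) :
    ∑ k ∈ Finset.range n, noisyOutput 0 η k ^ 2 ≤ ∑ k ∈ Finset.range n, η (k + 1) ^ 2 := by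
  rcases n with _ | n
  · simp
  · rw [Finset.sum_range_succ']
    simp only [noisyOutput, Nat.add_eq_zero_iff, one_ne_zero, and_false, if_false, if_true,
      Pi.zero_apply, zero_add]
    rw [zero_pow two_ne_zero, add_zero]
    exact Finset.sum_le_sum_of_subset_of_nonneg (Finset.range_mono (Nat.le_succ n))
      fun _ _ _ => sq_nonneg _

/-- The estimation error is bounded by the two noise terms and the errors-in-variables term. -/
lemma euclNorm_sub_estimate_le {α : ℝ} (hα : 0 < α) {θ θ₀ : RegIndex p q → ℝ}
    {u ξ : Fin m → ℕ → ℝ} {y ω η : ℕ → ℝ} (hy : IsOutput θ u ω y)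
    {φ : ℕ → RegIndex p q → ℝ}
    (hφ : ∀ k, φ k = regressor q (noisyOutput y η) (noisyInput u ξ) k) (k : ℕ)
    (hl : 0 < lambdaMin (infoMatrix α φ k)) :
    euclNorm (θ - estimate α θ₀ φ (noisyOutput y η) k) ≤
      Real.sqrt (quadForm α φ ω 0 k / lambdaMin (infoMatrix α φ k)) +
      Real.sqrt (quadForm α φ η 0 k / lambdaMin (infoMatrix α φ k)) +
      Real.sqrt ((α⁻¹ * ((α • (θ₀ - θ)) ⬝ᵥ (α • (θ₀ - θ))) + euclNorm θ ^ 2 *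
        (p * ∑ t ∈ Finset.range k, η (t + 1) ^ 2 +
          ∑ i, (q i : ℝ) * ∑ t ∈ Finset.range k, ξ i t ^ 2))
        / lambdaMin (infoMatrix α φ k)) := by
  set ζ : ℕ → RegIndex p q → ℝ := fun t => regressor q (noisyOutput 0 η) ξ t with hζ
  -- The errors-in-variables residual; weights are read at t + 1, hence the shift of ζ.
  set s : ℕ → ℝ := fun t => -(θ ⬝ᵥ ζ (t - 1)) with hs
  set e : ℕ → ℝ := fun t => ω t + η t + s t with he
  have hφζ : ∀ t, φ t = regressor q y u t + ζ t := fun t => by rw [hφ, regressor_noisy hy.1]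
  have hest := estimate_sub hα θ₀ θ φ (noisyOutput y η) e (fun t => by
    have : noisyOutput y η (t + 1) = y (t + 1) + η (t + 1) := by simp [noisyOutput]
    rw [this, hy.2 t, dotProduct_comm (φ t), hφζ, dotProduct_add]
    simp only [he, hs, Nat.add_sub_cancel]
    ring) k
  have hsum : α • (θ₀ - θ) + noiseSum φ e k =
      (0 + noiseSum φ ω k) + (0 + noiseSum φ η k) + (α • (θ₀ - θ) + noiseSum φ s k) := by
    simp only [noiseSum, he, add_smul, Finset.sum_add_distrib]
    abel
  have hneg : euclNorm (θ - estimate α θ₀ φ (noisyOutput y η) k) =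
      euclNorm (estimate α θ₀ φ (noisyOutput y η) k - θ) := by
    simpa [euclNorm] using norm_sub_rev (WithLp.toLp 2 θ)
      (WithLp.toLp 2 (estimate α θ₀ φ (noisyOutput y η) k))
  rw [hneg, hest, hsum, mulVec_add, mulVec_add]
  refine (euclNorm_add_le _ _).trans (add_le_add ((euclNorm_add_le _ _).trans
    (add_le_add (euclNorm_covMatrix_mulVec_le hα φ k _ hl)
      (euclNorm_covMatrix_mulVec_le hα φ k _ hl)))
    ((euclNorm_covMatrix_mulVec_le hα φ k _ hl).trans ?_))
  refine Real.sqrt_le_sqrt (div_le_div_of_nonneg_right ?_ hl.le)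
  refine (quadForm_le_sum_sq hα φ s _ k).trans (add_le_add le_rfl ?_)
  calc ∑ t ∈ Finset.range k, s (t + 1) ^ 2
      ≤ ∑ t ∈ Finset.range k, euclNorm θ ^ 2 * (ζ t ⬝ᵥ ζ t) := by
        refine Finset.sum_le_sum fun t _ => ?_
        simp only [hs, Nat.add_sub_cancel, neg_sq]
        exact dotProduct_sq_le θ (ζ t)
    _ = euclNorm θ ^ 2 * ∑ t ∈ Finset.range k, ζ t ⬝ᵥ ζ t := by rw [Finset.mul_sum]
    _ ≤ _ := by
        refine mul_le_mul_of_nonneg_left ?_ (sq_nonneg _)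
        refine (sum_dotProduct_regressor_self_le _ _ k).trans ?_
        exact add_le_add (mul_le_mul_of_nonneg_left (sum_noisyOutput_zero_sq_le η k)
          (Nat.cast_nonneg p)) le_rfl

/-- The asymptotic bound on the estimation error along one trajectory. -/
lemma limsup_euclNorm_sub_estimate_le {α β κ : ℝ} (hα : 0 < α) (hκ : 0 ≤ κ)
    {θ θ₀ : RegIndex p q → ℝ} {u ξ : Fin m → ℕ → ℝ} {y ω η : ℕ → ℝ} (hy : IsOutput θ u ω y)
    {φ : ℕ → RegIndex p q → ℝ}
    (hφ : ∀ k, φ k = regressor q (noisyOutput y η) (noisyInput u ξ) k)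
    (hω : HasNoiseBound α β κ φ ω) (hη : HasNoiseBound α 4 κ φ η)
    (hexc : Tendsto (fun k : ℕ => (if 2 < β then Real.log (energy φ k) else
      Real.log (energy φ k) * Real.log (Real.exp 1 + Real.log (energy φ k)) ^ κ) /
        lambdaMin (infoMatrix α φ (k + 1))) atTop (𝓝 0))
    {γ : ℝ} (hγ : 0 < γ) (hlim : liminf (fun k : ℕ =>
      ((lambdaMin ((1 / (k : ℝ)) • infoMatrix α φ k) : ℝ) : EReal)) atTop = (γ : EReal))
    {b₀ : ℝ} {b : Fin m → ℝ}
    (hη2 : Tendsto (fun n : ℕ => (∑ k ∈ Finset.range n, η (k + 1) ^ 2) / n) atTop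
      (𝓝 (2 * b₀ ^ 2)))
    (hξ2 : ∀ i, Tendsto (fun n : ℕ => (∑ k ∈ Finset.range n, ξ i k ^ 2) / n) atTop
      (𝓝 (2 * b i ^ 2))) :
    limsup (fun k : ℕ => ((euclNorm (θ - estimate α θ₀ φ (noisyOutput y η) k) : ℝ) : EReal))
        atTop ≤
      ((2 * euclNorm θ * Real.sqrt ((p * b₀ ^ 2 + ∑ i, (q i : ℝ) * b i ^ 2) / γ) : ℝ) :
        EReal) := by
  set l : ℕ → ℝ := fun k => lambdaMin (infoMatrix α φ k) with hl
  -- Half of γ is a strict lower bound for the normalized eigenvalue, eventually in k; this loss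
  -- already fits the stated constant.
  have hlow : ∀ᶠ k : ℕ in atTop, 0 < (k : ℝ) * (γ / 2) ∧ (k : ℝ) * (γ / 2) ≤ l k := by
    have h1 : ((γ / 2 : ℝ) : EReal) < liminf (fun k : ℕ =>
        ((lambdaMin ((1 / (k : ℝ)) • infoMatrix α φ k) : ℝ) : EReal)) atTop := by
      rw [hlim]
      exact EReal.coe_lt_coe_iff.2 (by linarith)
    filter_upwards [eventually_lt_of_lt_liminf h1, eventually_gt_atTop 0] with k hk hk0
    have hk0' : (0 : ℝ) < k := by exact_mod_cast hk0
    rw [EReal.coe_lt_coe_iff, lambdaMin_smul (by positivity)] at hk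
    refine ⟨by positivity, ?_⟩
    have : (k : ℝ) * (1 / k * l k) = l k := by field_simp
    rw [← this]
    exact mul_le_mul_of_nonneg_left hk.le hk0'.le
  have hlpos : ∀ᶠ k in atTop, 0 < l k := hlow.mono fun k hk => hk.1.trans_le hk.2
  set c : ℝ := α⁻¹ * ((α • (θ₀ - θ)) ⬝ᵥ (α • (θ₀ - θ))) with hc
  have hc0 : 0 ≤ c := mul_nonneg (inv_nonneg.2 hα.le) (by
    rw [← euclNorm_sq]; exact sq_nonneg _)
  set A : ℕ → ℝ := fun k => c + euclNorm θ ^ 2 * (p * ∑ t ∈ Finset.range k, η (t + 1) ^ 2 +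
    ∑ i, (q i : ℝ) * ∑ t ∈ Finset.range k, ξ i t ^ 2) with hA
  have hA0 : ∀ k, 0 ≤ A k := fun k => by positivity
  set σ : ℝ := p * b₀ ^ 2 + ∑ i, (q i : ℝ) * b i ^ 2 with hσ
  have hAlim : Tendsto (fun k : ℕ => A k / k) atTop (𝓝 (euclNorm θ ^ 2 * (2 * σ))) := by
    have h1 := ((hη2.const_mul (p : ℝ)).add (tendsto_finsetSum Finset.univ fun i _ =>
      (hξ2 i).const_mul (q i : ℝ))).const_mul (euclNorm θ ^ 2)
    have h2 := (tendsto_const_div_atTop_nhds_zero_nat c).add h1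
    convert h2 using 2 with k
    · simp only [hA, add_div, mul_div_assoc, Finset.sum_div]
    · rw [hσ, zero_add, mul_add, Finset.mul_sum]
      congr 2
      · ring
      · exact Finset.sum_congr rfl fun i _ => by ring
  -- The second moment 2b² of a Laplace variable and the margin γ/2 each contribute a factor 2, and
  -- √4 is the 2 in the conclusion.
  have hthird : Tendsto (fun k : ℕ => Real.sqrt (A k / (k * (γ / 2)))) atTop
      (𝓝 (2 * euclNorm θ * Real.sqrt (σ / γ))) := by
    have h1 := (Real.continuous_sqrt.tendsto _).comp (hAlim.div_const (γ / 2))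
    have h2 : Real.sqrt (euclNorm θ ^ 2 * (2 * σ) / (γ / 2)) =
        2 * euclNorm θ * Real.sqrt (σ / γ) := by
      rw [show euclNorm θ ^ 2 * (2 * σ) / (γ / 2) = (2 * euclNorm θ) ^ 2 * (σ / γ) by
        field_simp, Real.sqrt_mul (sq_nonneg _),
        Real.sqrt_sq (mul_nonneg zero_le_two (euclNorm_nonneg θ))]
    rw [h2] at h1
    refine h1.congr fun k => ?_
    simp only [Function.comp_apply, div_div]
  have htotal := ((hω.tendsto hα hκ hlpos hexc).add
    ((hη.of_four (β := β) hα hκ).tendsto hα hκ hlpos hexc)).add hthird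
  rw [zero_add, zero_add] at htotal
  rw [← ((continuous_coe_real_ereal.tendsto _).comp htotal).limsup_eq]
  refine limsup_le_limsup ?_
  filter_upwards [hlow] with k hk
  refine EReal.coe_le_coe_iff.2 ((euclNorm_sub_estimate_le hα hy hφ k
    (hk.1.trans_le hk.2)).trans (add_le_add le_rfl (Real.sqrt_le_sqrt ?_)))
  exact div_le_div_of_nonneg_left (hA0 k) hk.1 hk.2

end EstimationError

end

end DPLS

/-! ### Assembly of privacy and the asymptotic error bound -/

open DPLS in
theorem theorem4
    {Ω : Type*} [mΩ : MeasurableSpace Ω] (μ : Measure Ω) [IsProbabilityMeasure μ]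
    -- system orders and parameters
    (p m : ℕ) (q : Fin m → ℕ) (θ : RegIndex p q → ℝ)
    -- inputs, system noises and outputs
    (u : Fin m → ℕ → Ω → ℝ) (ω y : ℕ → Ω → ℝ)
    (hu : ∀ i k, Measurable (u i k))
    (hy : ∀ w, IsOutput θ (fun i k => u i k w) (fun k => ω k w) (fun k => y k w))
    -- added Laplacian noises
    (b₀ : ℝ) (b : Fin m → ℝ) (hb₀ : 0 < b₀) (hb : ∀ i, 0 < b i)
    (η : ℕ → Ω → ℝ) (ξ : Fin m → ℕ → Ω → ℝ)
    (hη : ∀ k, Measurable (η (k + 1))) (hξ : ∀ i k, Measurable (ξ i k))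
    (hη_law : ∀ k, μ.map (η (k + 1)) = laplaceMeasure b₀)
    (hξ_law : ∀ i k, μ.map (ξ i k) = laplaceMeasure (b i))
    -- asymptotic stability and independence of the added noises
    (hstable : AsymptoticallyStable (arCoeff θ))
    (hindep : IndependentNoises μ y u ω η ξ)
    -- martingale difference system noise and adapted regressors
    (ℱ : Filtration ℕ mΩ) (β : ℝ) (hβ : 2 ≤ β)
    (hω : IsMartingaleDifference μ ℱ ω β)
    (hadapted : ∀ k, Measurable[ℱ k] fun w =>
      (regressor q (fun t => y t w) (fun i t => u i t w) k : RegIndex p q → ℝ))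
    -- noise levels
    (ε δ : ℝ) (hε : 0 < ε) (hδ : 0 < δ)
    (c₀ lam : ℝ) (hc₀ : 0 < c₀) (hlam : lam ∈ Set.Ioo (0 : ℝ) 1)
    (hA : ∀ k : ℕ, matNorm (companionMatrix (arCoeff θ) ^ k) ≤ c₀ * lam ^ k)
    (hlevel₀ : C₁ p c₀ lam / b₀ * δ ≤ ε)
    (hlevel : ∀ i, (C₂ θ c₀ lam i / b₀ + 1 / b i) * δ ≤ ε)
    -- the algorithm, run on the noisy data
    (α : ℝ) (hα : 0 < α) (θ₀ : RegIndex p q → ℝ)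
    (ybar : ℕ → Ω → ℝ)
    (hybar : ∀ k w, ybar k w = noisyOutput (fun t => y t w) (fun t => η t w) k)
    (φbar : ℕ → Ω → RegIndex p q → ℝ)
    (hφbar : ∀ k w, φbar k w = regressor q (fun t => ybar t w)
      (noisyInput (fun i t => u i t w) (fun i t => ξ i t w)) k)
    (P : ℕ → Ω → Matrix (RegIndex p q) (RegIndex p q) ℝ)
    (hP : ∀ k w, P k w = covMatrix α (fun t => φbar t w) k)
    (est : ℕ → Ω → RegIndex p q → ℝ)
    (hest : ∀ k w, est k w = estimate α θ₀ (fun t => φbar t w) (fun t => ybar t w) k)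
    -- excitation
    (κ : ℝ) (hκ : 1 < κ)
    (hexc_eq : β = 2 → ∀ᵐ w ∂μ, Tendsto (fun k : ℕ =>
      Real.log (energy (fun t => φbar t w) k) *
          (Real.log (Real.exp 1 + Real.log (energy (fun t => φbar t w) k))) ^ κ /
        lambdaMin (P (k + 1) w)⁻¹) atTop (𝓝 0))
    (hexc_gt : 2 < β → ∀ᵐ w ∂μ, Tendsto (fun k : ℕ =>
      Real.log (energy (fun t => φbar t w) k) / lambdaMin (P (k + 1) w)⁻¹) atTop (𝓝 0))
    (γ₁ : Ω → ℝ)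
    (hγ₁ : ∀ᵐ w ∂μ, 0 < γ₁ w ∧
      liminf (fun k : ℕ => ((lambdaMin ((1 / (k : ℝ)) • (P k w)⁻¹) : ℝ) : EReal)) atTop =
        ((γ₁ w : ℝ) : EReal)) :
    -- differential privacy for participant `0`
    (∀ T₁ T₂ : ℕ, 1 ≤ T₁ → T₁ ≤ T₂ →
      IsDifferentiallyPrivate μ ε δ (outputMechanism θ u ω η T₁ T₂)) ∧
    -- differential privacy for participants `1, …, m`
    (∀ (i : Fin m) (T₁ T₂ : ℕ), 1 ≤ T₁ → T₁ ≤ T₂ →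
      IsDifferentiallyPrivate μ ε δ (inputMechanism θ u ω η ξ i T₁ T₂)) ∧
    -- asymptotic estimation error
    ∀ᵐ w ∂μ, limsup (fun k : ℕ => ((euclNorm (θ - est k w) : ℝ) : EReal)) atTop ≤
      ((2 * euclNorm θ *
        Real.sqrt ((p * b₀ ^ 2 + ∑ i, (q i : ℝ) * b i ^ 2) / γ₁ w) : ℝ) : EReal) := by
  have hωm : ∀ k, Measurable (ω (k + 1)) := fun k => (hω.1 k).mono (ℱ.le _) le_rfl
  have hym := measurable_output hy hu hωm
  refine ⟨fun T₁ T₂ _ hT => isDifferentiallyPrivate_outputMechanism hindep hym hu hωm hb₀ hb hη hξ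
      hη_law hξ_law hc₀ hlam hA hlevel₀ hT,
    fun i T₁ T₂ _ hT => isDifferentiallyPrivate_inputMechanism hindep hym hu hωm hb₀ hb hη hξ
      hη_law hξ_law hc₀ hlam hA i (hlevel i) hT, ?_⟩
  have hexc : ∀ᵐ w ∂μ, Tendsto (fun k : ℕ => (if 2 < β then
      Real.log (energy (fun t => φbar t w) k) else Real.log (energy (fun t => φbar t w) k) *
        Real.log (Real.exp 1 + Real.log (energy (fun t => φbar t w) k)) ^ κ) /
          lambdaMin (P (k + 1) w)⁻¹) atTop (𝓝 0) := by
    rcases hβ.eq_or_lt with h | h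
    · simpa only [← h, lt_self_iff_false, if_false] using hexc_eq h.symm
    · simpa only [h, if_true] using hexc_gt h
  -- Subfamilies of the independent noise family, each identically distributed, obey the strong law.
  have hη2 := ae_tendsto_sum_sq_div hb₀ (Y := fun k => η (k + 1)) hη hη_law
    (hindep.1.precomp (g := fun k => Sum.inl k) Sum.inl_injective)
  have hξ2 := ae_all_iff.2 fun i => ae_tendsto_sum_sq_div (hb i) (Y := ξ i) (hξ i) (hξ_law i)
    (hindep.1.precomp (g := fun k => Sum.inr (i, k)) fun k l h => by simpa using h)
  filter_upwards [ae_hasNoiseBound hω hadapted hym hu (fun w => (hy w).1) hη hξ hindep hb₀ hη_law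
    hβ hκ hα, hexc, hη2, hξ2, hγ₁] with w hbound hexcw hη2w hξ2w hγw
  have hybarw : (fun t => ybar t w) = noisyOutput (fun t => y t w) fun t => η t w :=
    funext fun t => hybar t w
  have hφw : ∀ k, φbar k w = regressor q (noisyOutput (fun t => y t w) fun t => η t w)
      (noisyInput (fun i t => u i t w) fun i t => ξ i t w) k := fun k => by
    rw [hφbar, hybarw]
  have hPw : ∀ k, (P k w)⁻¹ = infoMatrix α (fun t => φbar t w) k := fun k => by
    rw [hP, inv_covMatrix hα]
  obtain ⟨hbω, hbη⟩ := hbound (fun t => φbar t w) hφw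
  simp only [hPw] at hexcw hγw
  simp only [hest, hybarw]
  exact limsup_euclNorm_sub_estimate_le hα (zero_le_one.trans hκ.le) (hy w) hφw hbω hbη hexcw
    hγw.1 hγw.2 hη2w hξ2w
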